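/- **Generalized von Neumann Lemma.** *Notation.* For a finite set $B$ and a set $A$ let $\mathbb P(A:B)=|A\cap B|/|B|$; sets are identified with their indicator functions and $\mathbb E$ denotes the average over a finite set. Let $H$ be a subspace of $\mathbb F_5^n$. For $x=(x_1,x_2,x_3)\in H^3$ write $x\cdot e_j=x_j$ for $j=1,2,3$ and $x\cdot e_4=x_1+x_2+x_3$. Any three of these four coordinates determine $x$, and can take arbitrary values in $H$. For $f:X\times Y\to\mathbb R$ put $$\|f\|_{\Box(X\times Y)}^4=\mathbb E_{x,x'\in X;\,y,y'\in Y} f(x,y)f(x,y')f(x',y)f(x',y'),$$ and for $f:H^3\to\mathbb R$ put $$\|f\|_{\Box(H^3)}^8=\mathbb E_{x^0,x^1\in H^3}\prod_{\omega\in\{0,1\}^3}f(x_1^{\omega_1},x_2^{\omega_2},x_3^{\omega_3}).$$ For $g:H^3\to\mathbb R$ and $1\le \ell\le 4$, $\|g\|_{\Box\{i:i\ne\ell\}}$ is the norm $\|\cdot\|_{\Box(H^3)}$ of $g$ regarded as a function of the three coordinates $x\cdot e_i$, $i\neq \ell$. For $f:H\to\mathbb R$, $\|f\|_{U(3)}$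 is the norm $\|\cdot\|_{\Box(H^3)}$ of $(x,y,z)\mapsto f(x+y+z)$. A *corner-system* $\mathcal A$ consists of a subspace $H$ of $\mathbb F_5^n$, sets $S_i\subset H$ $(1\le i\le 4)$, sets $R_{j,k}\subset S_j\times S_k$ $(1\le j<k\le4)$, a set $T\subset H^3$ such that $(x\cdot e_j,x\cdot e_k)\in R_{j,k}$ for all $x\in T$ and all $j<k$, and a set $A\subset T$. Put $$T_\ell=\{x\in H^3: (x\cdot e_j,x\cdot e_k)\in R_{j,k}\text{ for all } j<k \text{ with } j,k\ne \ell\},$$ $\delta_j=\mathbb P(S_j:H)$, $\delta_{j,k}=\mathbb P(R_{j,k}:S_j\times S_k)$, $\delta_{T:\ell}=\mathbb P(T:T_\ell)$, $\delta_{A:T}=\mathbb P(A:T)$. Given constants $C_{\rm admiss}$ and $\kappa_{\rm admiss}$, the system is *$\varepsilon$-admissible* if $$\frac{\|T-\delta_{T:\ell}T_\ell\|_{\Box\{i:i\ne\ell\}}}{\|T_\ell\|_{\Box\{i:i\ne\ell\}}}\le\kappa_{\rm admiss}\,\varepsilon^{C_{\rm admiss}}\,\delta_{T:\ell}^{C_{\rm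 admiss}}\qquad(1\le\ell\le4),$$ $$\|R_{j,k}-\delta_{j,k}\|_{\Box(S_j\times S_k)}\le\kappa_{\rm admiss}\,\varepsilon^{C_{\rm admiss}}\,\mathbb P(T:H^3)^{C_{\rm admiss}}\qquad(1\le j<k\le4),$$ $$\|S_j-\delta_j\|_{U(3)}\le\kappa_{\rm admiss}\,\varepsilon^{C_{\rm admiss}}\,\mathbb P(T:H^3)^{C_{\rm admiss}}\qquad(1\le j\le4).$$ *Statement.* There are absolute constants $C_0\ge 64$, $0<\kappa_0<1$ and $\kappa>0$ such that the following holds whenever $C_{\rm admiss}\ge C_0$ and $0<\kappa_{\rm admiss}\le\kappa_0$. Let $\mathcal A$ be a corner-system, in any dimension $n$, which is $\delta_{A:T}$-admissible. Suppose that $$\delta_{A:T}\cdot\prod_{j=1}^4\delta_j\cdot\prod_{1\le j<k\le4}\delta_{j,k}\cdot\prod_{\ell=1}^4\delta_{T:\ell}\cdot|H|^4>4|A|$$ and $$\max_{1\le\ell\le4}\frac{\|A-\delta_{A:T}T\|_{\Box\{i:i\ne\ell\}}}{\|T\|_{\Box\{i:i\ne\ell\}}}\le\kappa\,\delta_{A:T}^4.$$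 Then $A$ contains a nontrivial corner: there are $x_1,x_2,x_3,h\in H$ with $h\ne0$ such that $(x_1,x_2,x_3)$, $(x_1+h,x_2,x_3)$, $(x_1,x_2+h,x_3)$ and $(x_1,x_2,x_3+h)$ all belong to $A$. -/

import Mathlib

open scoped BigOperators

noncomputable section

namespace Corners

/-- Indicator function of a finite set. -/
def ind {α : Type*} [DecidableEq α] (A : Finset α) : α → ℝ := fun x => if x ∈ A then 1 else 0

/-- `P(A : B) = |A ∩ B| / |B|`, the density of `A` in `B` (equal to `0` when `B` is empty). -/
def prob {α : Type*} [DecidableEq α] (A B : Finset α) : ℝ :=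
  ((A ∩ B).card : ℝ) / (B.card : ℝ)

/-- Two-dimensional box norm of `f` on `X × Y`. -/
def boxNorm2 {α β : Type*} (X : Finset α) (Y : Finset β) (f : α → β → ℝ) : ℝ :=
  (𝔼 x ∈ X, 𝔼 x' ∈ X, 𝔼 y ∈ Y, 𝔼 y' ∈ Y,
    f x y * f x y' * f x' y * f x' y') ^ (1 / 4 : ℝ)

variable {G : Type*} [AddCommGroup G] [Fintype G] [DecidableEq G]

/-- Three-dimensional box norm of `f` on `G × G × G`. -/
def boxNorm3 {G : Type*} [Fintype G] (f : G → G → G → ℝ) : ℝ :=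
  (𝔼 x : G, 𝔼 x' : G, 𝔼 y : G, 𝔼 y' : G, 𝔼 z : G, 𝔼 z' : G,
    f x y z * f x y' z * f x' y z * f x' y' z *
      (f x y z' * f x y' z' * f x' y z' * f x' y' z')) ^ (1 / 8 : ℝ)

/-- The `U(3)` norm: the box norm of `f (x + y + z)`. -/
def u3Norm {G : Type*} [AddCommGroup G] [Fintype G] (f : G → ℝ) : ℝ :=
  boxNorm3 fun x y z => f (x + y + z)

/-- The four coordinates `x ⬝ e_i` of a point of `G × G × G`, where `e_1, e_2, e_3` is the
standard basis and `e_4 = e_1 + e_2 + e_3`. The indices `1, 2, 3, 4` are `0, 1, 2, 3 : Fin 4`. -/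
def coord {G : Type*} [AddCommGroup G] (i : Fin 4) (x : G × G × G) : G :=
  ![x.1, x.2.1, x.2.2, x.1 + x.2.1 + x.2.2] i

/-- The point of `G × G × G` whose three coordinates `x ⬝ e_i`, `i ≠ ℓ`, in increasing order of
`i`, are `a, b, c`. -/
def ofCoords {G : Type*} [AddCommGroup G] (l : Fin 4) (a b c : G) : G × G × G :=
  ![(c - a - b, a, b), (a, c - a - b, b), (a, b, c - a - b), (a, b, c)] l

/-- `l.succAbove 0 < l.succAbove 1 < l.succAbove 2` are the three indices different from `l`. -/
theorem coord_ofCoords {G : Type*} [AddCommGroup G] (l : Fin 4) (a b c : G) :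
    coord (l.succAbove 0) (ofCoords l a b c) = a ∧
    coord (l.succAbove 1) (ofCoords l a b c) = b ∧
    coord (l.succAbove 2) (ofCoords l a b c) = c := by
  fin_cases l
  · refine ⟨rfl, rfl, ?_⟩
    change c - a - b + a + b = c
    abel
  · refine ⟨rfl, rfl, ?_⟩
    change a + (c - a - b) + b = c
    abel
  · refine ⟨rfl, rfl, ?_⟩
    change a + b + (c - a - b) = c
    abel
  · exact ⟨rfl, rfl, rfl⟩

theorem ofCoords_coord {G : Type*} [AddCommGroup G] (l : Fin 4) (x : G × G × G) :
    ofCoords l (coord (l.succAbove 0) x) (coord (l.succAbove 1) x)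
      (coord (l.succAbove 2) x) = x := by
  obtain ⟨a, b, c⟩ := x
  fin_cases l
  · change (a + b + c - b - c, b, c) = (a, b, c)
    congr 1
    abel
  · change (a, a + b + c - a - c, c) = (a, b, c)
    congr 2
    abel
  · change (a, b, a + b + c - a - b) = (a, b, c)
    congr 2
    abel
  · rfl

/-- The box norm of `g : G × G × G → ℝ` in the coordinates `x ⬝ e_i`, `i ≠ l`. -/
def coordBoxNorm {G : Type*} [AddCommGroup G] [Fintype G] (l : Fin 4) (g : G × G × G → ℝ) : ℝ :=
  boxNorm3 fun a b c => g (ofCoords l a b c)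

/-- A `T`-system in `G`: sets `S_i ⊆ G`, `R_{j,k} ⊆ S_j × S_k` for `j < k`, and a subset `T` of
`G × G × G` which is contained in the lift `{x | (x ⬝ e_j, x ⬝ e_k) ∈ R_{j,k}}` of every `R_{j,k}`,
`j < k`. The sets `R j k` with `k ≤ j` play no role. -/
structure TSystem (G : Type*) [AddCommGroup G] [DecidableEq G] where
  S : Fin 4 → Finset G
  R : Fin 4 → Fin 4 → Finset (G × G)
  T : Finset (G × G × G)
  R_subset : ∀ j k, j < k → R j k ⊆ S j ×ˢ S k
  T_subset : ∀ j k, j < k → ∀ x ∈ T, (coord j x, coord k x) ∈ R j k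

/-- A corner-system: a `T`-system together with a subset `A` of `T`. -/
structure CornerSystem (G : Type*) [AddCommGroup G] [DecidableEq G] extends TSystem G where
  A : Finset (G × G × G)
  A_subset : A ⊆ T

namespace TSystem

/-- `T_l`, the intersection of the lifts of the `R_{j,k}` with `j < k` and `j, k ≠ l`. -/
def Tface (𝒯 : TSystem G) (l : Fin 4) : Finset (G × G × G) :=
  Finset.univ.filter fun x =>
    ∀ j k, j < k → j ≠ l → k ≠ l → (coord j x, coord k x) ∈ 𝒯.R j k

/-- `δ_j = P(S_j : G)`. -/
def densS (𝒯 : TSystem G) (j : Fin 4) : ℝ := prob (𝒯.S j) Finset.univ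

/-- `δ_{j,k} = P(R_{j,k} : S_j × S_k)`. -/
def densR (𝒯 : TSystem G) (j k : Fin 4) : ℝ := prob (𝒯.R j k) (𝒯.S j ×ˢ 𝒯.S k)

/-- `δ_{T : l} = P(T : T_l)`. -/
def densT (𝒯 : TSystem G) (l : Fin 4) : ℝ := prob 𝒯.T (𝒯.Tface l)

/-- `ε`-admissibility, with the constants `C` and `κ`. -/
structure Admissible (C κ ε : ℝ) (𝒯 : TSystem G) : Prop where
  box3 : ∀ l, coordBoxNorm l (fun x => ind 𝒯.T x - 𝒯.densT l * ind (𝒯.Tface l) x)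
      / coordBoxNorm l (ind (𝒯.Tface l)) ≤ κ * ε ^ C * 𝒯.densT l ^ C
  box2 : ∀ j k, j < k →
    boxNorm2 (𝒯.S j) (𝒯.S k) (fun x y => ind (𝒯.R j k) (x, y) - 𝒯.densR j k)
      ≤ κ * ε ^ C * prob 𝒯.T Finset.univ ^ C
  box1 : ∀ j, u3Norm (fun x => ind (𝒯.S j) x - 𝒯.densS j)
      ≤ κ * ε ^ C * prob 𝒯.T Finset.univ ^ C

end TSystem

/-- `δ_{A : T} = P(A : T)`. -/
def CornerSystem.densA (𝒜 : CornerSystem G) : ℝ := prob 𝒜.A 𝒜.T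

/-- `A` contains a nontrivial three-dimensional corner. -/
def HasCorner {G : Type*} [AddCommGroup G] (A : Finset (G × G × G)) : Prop :=
  ∃ x y z h : G, h ≠ 0 ∧ (x, y, z) ∈ A ∧ (x + h, y, z) ∈ A ∧ (x, y + h, z) ∈ A ∧ (x, y, z + h) ∈ A

end Corners

end

/-!
# The generalized von Neumann lemma for three-dimensional corners

Four points `(x, y, z)`, `(x + h, y, z)`, `(x, y + h, z)`, `(x, y, z + h)` are determined by
`y_0 = x`, `y_1 = y`, `y_2 = z`, `y_3 = x + y + z + h`: the `l`-th of them is the point whose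
coordinates `x ⬝ e_j`, `j ≠ l`, are the `y_j`. So corners in `A` are tetrahedra on the vertex
classes `S_0, …, S_3` all of whose faces lie in `A`, and such a tetrahedron is degenerate, `h = 0`,
exactly when its four faces are the same point of `A`. The sets `R_{j,k}` and `T` form a two-level
system of weights on the edges and faces of the tetrahedron (`WeightSystem`, `TSystem.weights`).

The engine is a weighted von Neumann inequality, `abs_expect_prod_pow_le`: by repeated use of the
Cauchy-Schwarz inequality, doubling one vertex at a time, an average of a product of functions
bounded by weights is controlled by the box norm of one of them, provided that all the products of
copies of the weights which occur have average close to `1` (`LinearForms`). It is applied at three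
levels. With weight `1` it counts graphs (`abs_expect_edges_sub_le`): every `R_{j,k}` is replaced by
its density. With the edges as weights it counts hypergraphs (`WeightSystem.abs_expect_sub_one_le`):
every face is replaced by its density relative to its edges. The hypothesis bounds the error at a
face only in terms of the density of that face; removing the faces in increasing order of density
makes this harmless. The outcome is that the weights of the edges and faces satisfy the linear forms
condition (`TSystem.linearForms_weights`). With these as weights the inequality replaces `A` by
`ε T`, `ε` being the density of `A` in `T` (`TSystem.expect_tetra_ge`): the number of tetrahedra in
`A` is about `ε ^ 4` times the product of all the densities.

If `A` had no nontrivial corner, all its tetrahedra would be degenerate, at most `|A|` of them. When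
`ε > 3 / 4` this contradicts the assumed lower bound on the sizes. When `ε ≤ 3 / 4` the function
`A - ε T` is bounded away from `0` on `T`, and the terms of its box norm in which the two copies of
the first variable coincide form a nonnegative part of it, of proportion `1 / |S_0|`. As the box
norm is small, `|S_0|` times a product of densities must be large (`TSystem.diagonal_lower_bound`).
The three faces containing the vertex `0` together give a lower bound for the number of tetrahedra
over a point of `T`, which again exceeds what degenerate tetrahedra can provide.
-/

namespace Corners

/-! ### Averages over finite product spaces -/

section Averages

variable {J Ω : Type*} [Fintype J] [DecidableEq J] [Fintype Ω]

/-- Resampling the coordinates in `B` does not change an average. -/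
theorem expect_piecewise (B : Finset J) (F : (J → Ω) → ℝ) :
    𝔼 x : J → Ω, 𝔼 x' : J → Ω, F (B.piecewise x' x) = 𝔼 x : J → Ω, F x := by
  classical
  rcases isEmpty_or_nonempty (J → Ω) with h | h
  · simp
  have h1 : ∀ G : (J → Ω) × (J → Ω) → ℝ,
      𝔼 x : J → Ω, 𝔼 x' : J → Ω, G (x, x') = 𝔼 p : (J → Ω) × (J → Ω), G p := by
    intro G
    rw [← Finset.univ_product_univ, Finset.expect_product]
  have h2 : 𝔼 x : J → Ω, F x = 𝔼 x : J → Ω, 𝔼 _x' : J → Ω, F x := by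
    simp
  rw [h2, h1 (fun p => F (B.piecewise p.2 p.1)), h1 (fun p => F p.1)]
  have hinv : Function.Involutive fun p : (J → Ω) × (J → Ω) =>
      (B.piecewise p.2 p.1, B.piecewise p.1 p.2) := by
    intro p
    ext j
    · by_cases hj : j ∈ B <;> simp [hj]
    · by_cases hj : j ∈ B <;> simp [hj]
  exact Fintype.expect_equiv hinv.toPerm _ _ fun p => rfl

/-- The Cauchy-Schwarz inequality for averages with a nonnegative weight. -/
theorem expect_mul_sq_le_weighted {α : Type*} [Fintype α] (C A ν : α → ℝ)
    (hC : ∀ x, |C x| ≤ ν x) :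
    (𝔼 x, C x * A x) ^ 2 ≤ (𝔼 x, ν x) * 𝔼 x, ν x * A x ^ 2 := by
  have hν : ∀ x, 0 ≤ ν x := fun x => (abs_nonneg _).trans (hC x)
  have h1 : |𝔼 x, C x * A x| ≤ 𝔼 x, √(ν x) * (√(ν x) * |A x|) := by
    refine (Finset.abs_expect_le _ _).trans (Finset.expect_le_expect fun x _ => ?_)
    rw [abs_mul, ← mul_assoc, Real.mul_self_sqrt (hν x)]
    exact mul_le_mul_of_nonneg_right (hC x) (abs_nonneg _)
  calc (𝔼 x, C x * A x) ^ 2 = |𝔼 x, C x * A x| ^ 2 := (sq_abs _).symm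
    _ ≤ (𝔼 x, √(ν x) * (√(ν x) * |A x|)) ^ 2 := pow_le_pow_left₀ (abs_nonneg _) h1 2
    _ ≤ (𝔼 x, √(ν x) ^ 2) * 𝔼 x, (√(ν x) * |A x|) ^ 2 :=
        Finset.expect_mul_sq_le_sq_mul_sq _ _ _
    _ = _ := by
        congr 1
        · exact Finset.expect_congr rfl fun x _ => Real.sq_sqrt (hν x)
        · exact Finset.expect_congr rfl fun x _ => by
            rw [mul_pow, Real.sq_sqrt (hν x), sq_abs]

/-- Cauchy-Schwarz with duplication of variables: if `C` and its majorant `ν` do not depend on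
the block `B`, then `C` can be replaced by `ν` at the cost of multiplying `h` with a copy in which
the variables of `B` are renamed, by `τ`, to those of the dummy block `B'`. -/
theorem expect_mul_sq_le_duplicate (B B' : Finset J) (τ : Equiv.Perm J)
    (hτ : ∀ j ∈ B, τ j ∈ B') (hτ' : ∀ j, j ∉ B → j ∉ B' → τ j = j)
    (C ν h : (J → Ω) → ℝ) (hC : ∀ x, |C x| ≤ ν x)
    (dC : DependsOn C {j | j ∉ B}) (dν : DependsOn ν {j | j ∉ B ∧ j ∉ B'})
    (dh : DependsOn h {j | j ∉ B'}) :
    (𝔼 x, C x * h x) ^ 2 ≤ (𝔼 x, ν x) * 𝔼 x, ν x * h x * h (x ∘ τ) := by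
  classical
  set A : (J → Ω) → ℝ := fun x => 𝔼 x' : J → Ω, h (B.piecewise x' x) with hA
  have dA : ∀ x x' : J → Ω, A (B.piecewise x' x) = A x := by
    intro x x'
    refine Finset.expect_congr rfl fun y _ => congrArg h ?_
    ext j
    by_cases hj : j ∈ B <;> simp [hj]
  have cC : ∀ x x' : J → Ω, C (B.piecewise x' x) = C x := fun x x' =>
    dC fun j hj => Finset.piecewise_eq_of_notMem _ _ _ hj
  have cν : ∀ x x' : J → Ω, ν (B.piecewise x' x) = ν x := fun x x' =>
    dν fun j hj => Finset.piecewise_eq_of_notMem _ _ _ hj.1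
  have cν' : ∀ x x' : J → Ω, ν (B'.piecewise x' x) = ν x := fun x x' =>
    dν fun j hj => Finset.piecewise_eq_of_notMem _ _ _ hj.2
  have ch' : ∀ x x' : J → Ω, h (B'.piecewise x' x) = h x := fun x x' =>
    dh fun j hj => Finset.piecewise_eq_of_notMem _ _ _ hj
  have e1 : 𝔼 x, C x * h x = 𝔼 x, C x * A x := by
    rw [← expect_piecewise B]
    refine Finset.expect_congr rfl fun x _ => ?_
    rw [hA, Finset.mul_expect]
    exact Finset.expect_congr rfl fun x' _ => by rw [cC]
  have e2 : 𝔼 x, ν x * h x * A x = 𝔼 x, ν x * A x ^ 2 := by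
    rw [← expect_piecewise B]
    refine Finset.expect_congr rfl fun x _ => ?_
    have : ν x * A x ^ 2 = (ν x * A x) * 𝔼 x' : J → Ω, h (B.piecewise x' x) := by
      rw [hA]; ring
    rw [this, Finset.mul_expect]
    exact Finset.expect_congr rfl fun x' _ => by rw [cν, dA]; ring
  have e3 : 𝔼 x, ν x * h x * h (x ∘ τ) = 𝔼 x, ν x * h x * A x := by
    rw [← expect_piecewise B']
    refine Finset.expect_congr rfl fun x _ => ?_
    rw [hA, Finset.mul_expect]
    have : ∀ x' : J → Ω, ν (B'.piecewise x' x) * h (B'.piecewise x' x)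
        * h (B'.piecewise x' x ∘ τ) = ν x * h x * h (B.piecewise (x' ∘ τ) x) := by
      intro x'
      rw [cν', ch']
      congr 1
      refine dh fun j hj => ?_
      by_cases hjB : j ∈ B
      · simp [hjB, hτ j hjB]
      · have hj' : j ∉ B' := hj
        simp [hjB, hτ' j hjB hj', hj']
    simp_rw [this]
    exact Fintype.expect_equiv (Equiv.arrowCongr τ.symm (Equiv.refl Ω)) _ _ fun x' => by
      congr 3
  rw [e1, e3, e2]
  exact expect_mul_sq_le_weighted C A ν hC

/-- Pulling back along an injective map of index sets does not change an average. -/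
theorem expect_comp_injective {K : Type*} [Fintype K] [DecidableEq K] [Nonempty Ω] {f : K → J}
    (hf : Function.Injective f) (F : (K → Ω) → ℝ) :
    𝔼 x : J → Ω, F (x ∘ f) = 𝔼 y : K → Ω, F y := by
  classical
  let e : (J → Ω) ≃ (K → Ω) × ({j // ¬ j ∈ Set.range f} → Ω) :=
    (Equiv.piEquivPiSubtypeProd (fun j => j ∈ Set.range f) fun _ => Ω).trans
      (Equiv.prodCongr (Equiv.arrowCongr (Equiv.ofInjective f hf).symm (Equiv.refl Ω))
        (Equiv.refl _))
  have h1 : 𝔼 x : J → Ω, F (x ∘ f)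
      = 𝔼 p : (K → Ω) × ({j // ¬ j ∈ Set.range f} → Ω), F p.1 := by
    refine Fintype.expect_equiv e _ _ fun x => congrArg F ?_
    ext k
    rfl
  rw [h1, ← Finset.univ_product_univ, Finset.expect_product]
  simp

end Averages

/-! ### Doubling variables and a weighted von Neumann inequality -/

section Doubling

/-- The point of `V → Ω` picked out of a doubled point `x : V × Bool → Ω` by a set `s` of vertices:
the second copy of the variable is used at the vertices of `s`, and the first copy elsewhere. -/
def select {V Ω : Type*} [DecidableEq V] (x : V × Bool → Ω) (s : Finset V) : V → Ω :=
  fun v => x (v, decide (v ∈ s))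

/-- The permutation of `V × Bool` exchanging the two copies of each vertex of `D`. -/
def toggle {V : Type*} [DecidableEq V] (D : Finset V) : Equiv.Perm (V × Bool) :=
  Function.Involutive.toPerm (fun p => if p.1 ∈ D then (p.1, !p.2) else p) <| by
    rintro ⟨v, b⟩
    by_cases hv : v ∈ D <;> simp [hv]

theorem toggle_apply {V : Type*} [DecidableEq V] (D : Finset V) (p : V × Bool) :
    toggle D p = if p.1 ∈ D then (p.1, !p.2) else p := rfl

theorem select_comp_toggle {V Ω : Type*} [DecidableEq V] (x : V × Bool → Ω) (D s : Finset V) :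
    select (x ∘ toggle D) s = select x (symmDiff s D) := by
  ext v
  by_cases hD : v ∈ D <;> by_cases hs : v ∈ s <;>
    simp [select, toggle_apply, Finset.mem_symmDiff, hD, hs]

theorem apply_select_congr {V Ω : Type*} [DecidableEq V] {φ : (V → Ω) → ℝ} {e : Finset V}
    (hφ : DependsOn φ (e : Set V)) {x y : V × Bool → Ω} {s t : Finset V}
    (h : ∀ v ∈ e, x (v, decide (v ∈ s)) = y (v, decide (v ∈ t))) :
    φ (select x s) = φ (select y t) :=
  hφ fun v hv => h v (by simpa using hv)

/-- The average over doubled points of the product of all the copies `(i, s)`, `s ⊆ D ∩ e i`, of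
the functions attached to `i ∈ I`. The function attached to `i` is `g i` when `e i` contains all
the doubled vertices `D`, and its majorant `ν i` otherwise. -/
noncomputable def cubeForm {V Ω ι : Type*} [Fintype V] [DecidableEq V] [Fintype Ω] (I : Finset ι)
    (e : ι → Finset V) (g ν : ι → (V → Ω) → ℝ) (D : Finset V) : ℝ :=
  𝔼 x : V × Bool → Ω, ∏ i ∈ I, ∏ s ∈ (D ∩ e i).powerset,
    (if D ⊆ e i then g i else ν i) (select x s)

variable {V Ω ι : Type*} [Fintype V] [DecidableEq V] [Fintype Ω]
  {I : Finset ι} {e : ι → Finset V} {g ν : ι → (V → Ω) → ℝ}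

theorem cubeForm_empty [Nonempty Ω] :
    cubeForm I e g ν ∅ = 𝔼 x : V → Ω, ∏ i ∈ I, g i x := by
  have h := expect_comp_injective (Ω := Ω) (f := fun v : V => (v, false))
    (fun a b hab => (Prod.mk.inj hab).1) (fun y => ∏ i ∈ I, g i y)
  rw [← h]
  refine Finset.expect_congr rfl fun x _ => Finset.prod_congr rfl fun i _ => ?_
  simp only [Finset.empty_inter, Finset.powerset_empty, Finset.prod_singleton,
    Finset.empty_subset, if_true]
  congr 1

/-- One application of the Cauchy-Schwarz inequality: doubling the vertex `c`. -/
theorem cubeForm_sq_le (dg : ∀ i ∈ I, DependsOn (g i) (e i : Set V))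
    (dν : ∀ i ∈ I, DependsOn (ν i) (e i : Set V)) (hg : ∀ i ∈ I, ∀ x, |g i x| ≤ ν i x)
    {D : Finset V} {c : V} (hc : c ∉ D) :
    cubeForm I e g ν D ^ 2 ≤
      (𝔼 x : V × Bool → Ω, ∏ i ∈ I with c ∉ e i, ∏ s ∈ (D ∩ e i).powerset, ν i (select x s))
        * cubeForm I e g ν (insert c D) := by
  have hν : ∀ i ∈ I, ∀ x, 0 ≤ ν i x := fun i hi x => (abs_nonneg _).trans (hg i hi x)
  set φ : ι → (V → Ω) → ℝ := fun i => if D ⊆ e i then g i else ν i with hφ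
  have dφ : ∀ i ∈ I, DependsOn (φ i) (e i : Set V) := by
    intro i hi
    simp only [hφ]
    split_ifs
    exacts [dg i hi, dν i hi]
  have bφ : ∀ i ∈ I, ∀ x, |φ i x| ≤ ν i x := by
    intro i hi x
    simp only [hφ]
    split_ifs
    exacts [hg i hi x, (abs_of_nonneg (hν i hi x)).le]
  have hsD : ∀ {i : ι} {s : Finset V}, s ∈ (D ∩ e i).powerset → c ∉ s := fun hs hcs =>
    hc (Finset.mem_inter.1 (Finset.mem_powerset.1 hs hcs)).1
  have key := expect_mul_sq_le_duplicate (Ω := Ω) {((c, false) : V × Bool)} {((c, true) : V × Bool)}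
    (toggle {c})
    (by simp [toggle_apply]) (by
      rintro ⟨v, b⟩ h1 h2
      have hv : v ≠ c := by
        rintro rfl
        cases b <;> simp at h1 h2
      simp [toggle_apply, hv])
    (fun x => ∏ i ∈ I with c ∉ e i, ∏ s ∈ (D ∩ e i).powerset, φ i (select x s))
    (fun x => ∏ i ∈ I with c ∉ e i, ∏ s ∈ (D ∩ e i).powerset, ν i (select x s))
    (fun x => ∏ i ∈ I with c ∈ e i, ∏ s ∈ (D ∩ e i).powerset, φ i (select x s))
    (by
      intro x
      simp only [Finset.abs_prod]
      refine Finset.prod_le_prod (fun i _ => Finset.prod_nonneg fun s _ => abs_nonneg _) ?_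
      intro i hi
      exact Finset.prod_le_prod (fun s _ => abs_nonneg _)
        fun s _ => bφ i (Finset.mem_filter.1 hi).1 _)
    (by
      intro x y hxy
      refine Finset.prod_congr rfl fun i hi => Finset.prod_congr rfl fun s hs => ?_
      rw [Finset.mem_filter] at hi
      refine apply_select_congr (dφ i hi.1) fun v hv => hxy _ ?_
      have : v ≠ c := by rintro rfl; exact hi.2 hv
      simp [this])
    (by
      intro x y hxy
      refine Finset.prod_congr rfl fun i hi => Finset.prod_congr rfl fun s hs => ?_
      rw [Finset.mem_filter] at hi
      refine apply_select_congr (dν i hi.1) fun v hv => hxy _ ?_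
      have : v ≠ c := by rintro rfl; exact hi.2 hv
      simp [this])
    (by
      intro x y hxy
      refine Finset.prod_congr rfl fun i hi => Finset.prod_congr rfl fun s hs => ?_
      rw [Finset.mem_filter] at hi
      refine apply_select_congr (dφ i hi.1) fun v hv => hxy _ ?_
      have := hsD hs
      simp only [Finset.mem_singleton, Set.mem_ofPred_eq, Prod.mk.injEq, decide_eq_true_eq]
      rintro ⟨rfl, h⟩
      exact this h)
  have e1 : cubeForm I e g ν D = 𝔼 x : V × Bool → Ω,
      (∏ i ∈ I with c ∉ e i, ∏ s ∈ (D ∩ e i).powerset, φ i (select x s)) *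
      (∏ i ∈ I with c ∈ e i, ∏ s ∈ (D ∩ e i).powerset, φ i (select x s)) := by
    refine Finset.expect_congr rfl fun x _ => ?_
    rw [mul_comm, Finset.prod_filter_mul_prod_filter_not]
  have e2 : cubeForm I e g ν (insert c D) = 𝔼 x : V × Bool → Ω,
      (∏ i ∈ I with c ∉ e i, ∏ s ∈ (D ∩ e i).powerset, ν i (select x s)) *
      (∏ i ∈ I with c ∈ e i, ∏ s ∈ (D ∩ e i).powerset, φ i (select x s)) *
      (∏ i ∈ I with c ∈ e i, ∏ s ∈ (D ∩ e i).powerset, φ i (select (x ∘ toggle {c}) s)) := by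
    refine Finset.expect_congr rfl fun x _ => ?_
    rw [← Finset.prod_filter_mul_prod_filter_not I (fun i => c ∈ e i), mul_assoc, mul_comm,
      ← Finset.prod_mul_distrib]
    congr 1
    · refine Finset.prod_congr rfl fun i hi => ?_
      rw [Finset.mem_filter] at hi
      rw [Finset.insert_inter_of_notMem hi.2]
      have : ¬ insert c D ⊆ e i := fun h => hi.2 (h (Finset.mem_insert_self _ _))
      simp only [if_neg this]
    · refine Finset.prod_congr rfl fun i hi => ?_
      rw [Finset.mem_filter] at hi
      rw [Finset.insert_inter_of_mem hi.2, Finset.prod_powerset_insert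
        (fun h => hc (Finset.mem_inter.1 h).1)]
      have : insert c D ⊆ e i ↔ D ⊆ e i := by
        rw [Finset.insert_subset_iff]; exact and_iff_right hi.2
      simp only [this]
      congr 1
      refine Finset.prod_congr rfl fun s hs => ?_
      have hcs : symmDiff s {c} = insert c s := by
        have := hsD hs
        ext v
        simp only [Finset.mem_insert, Finset.mem_symmDiff, Finset.mem_singleton]
        by_cases hv : v = c
        · subst hv; simp [this]
        · simp [hv]
      rw [select_comp_toggle, hcs]
  rw [e1, e2]
  exact key

/-- Second moment bound: if the average of `Ψ` against `W`, and against `W` times its copy with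
renamed variables outside `D`, is almost the same as that of `Ψ`, then `W` may be replaced by `1`
in averages against functions bounded by `Ψ`. -/
theorem expect_mul_sub_one_sq_le {D : Finset V} {Φ Ψ W : (V × Bool → Ω) → ℝ}
    (hΦ : ∀ x, |Φ x| ≤ Ψ x)
    (dΦ : DependsOn Φ {p : V × Bool | p.1 ∈ D}) (dΨ : DependsOn Ψ {p : V × Bool | p.1 ∈ D})
    (dW : DependsOn W {p : V × Bool | p.1 ∈ D ∨ p.2 = false}) :
    (𝔼 x, Φ x * (W x - 1)) ^ 2 ≤
      (𝔼 x, Ψ x) * 𝔼 x, Ψ x * (W x - 1) * (W (x ∘ toggle Dᶜ) - 1) := by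
  refine expect_mul_sq_le_duplicate (Dᶜ ×ˢ {false}) (Dᶜ ×ˢ {true}) (toggle Dᶜ) ?_ ?_ Φ Ψ
    (fun x => W x - 1) hΦ ?_ ?_ ?_
  · rintro ⟨v, b⟩ h
    simp only [Finset.mem_product, Finset.mem_compl, Finset.mem_singleton] at h
    simp [toggle_apply, h.1, h.2]
  · rintro ⟨v, b⟩ h1 h2
    simp only [Finset.mem_product, Finset.mem_compl, Finset.mem_singleton] at h1 h2
    have : v ∈ D := by
      by_contra hv
      cases b
      · exact h1 ⟨hv, rfl⟩
      · exact h2 ⟨hv, rfl⟩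
    simp [toggle_apply, this]
  · intro x y hxy
    refine dΦ fun p hp => hxy p ?_
    have hp' : p.1 ∈ D := hp
    simp only [Finset.mem_product, Finset.mem_compl, Set.mem_ofPred_eq]
    tauto
  · intro x y hxy
    refine dΨ fun p hp => hxy p ?_
    have hp' : p.1 ∈ D := hp
    simp only [Finset.mem_product, Finset.mem_compl, Set.mem_ofPred_eq]
    tauto
  · intro x y hxy
    refine congrArg (· - 1) (dW fun p hp => hxy p ?_)
    have hp' : p.1 ∈ D ∨ p.2 = false := hp
    simp only [Finset.mem_product, Finset.mem_compl, Finset.mem_singleton, Set.mem_ofPred_eq,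
      not_and]
    rcases hp' with h | h <;> simp [h]

/-- The linear forms condition for the weights `ν i`: the average of any product of distinct copies
`(i, s)`, `s ⊆ e i`, is `1` up to `err`, provided that the family of copies contains with `(k, s)`
also all the `(i, s ∩ e i)` with `e i ⊆ e k`. -/
def LinearForms {V Ω ι : Type*} [Fintype V] [DecidableEq V] [Fintype Ω] (I : Finset ι)
    (e : ι → Finset V) (ν : ι → (V → Ω) → ℝ) (err : ℝ) : Prop :=
  ∀ P : Finset (Σ _ : ι, Finset V),
    (∀ q ∈ P, q.1 ∈ I ∧ q.2 ⊆ e q.1) →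
    (∀ q ∈ P, ∀ i ∈ I, e i ⊆ e q.1 → (⟨i, q.2 ∩ e i⟩ : Σ _ : ι, Finset V) ∈ P) →
    |(𝔼 x : V × Bool → Ω, ∏ q ∈ P, ν q.1 (select x q.2)) - 1| ≤ err

/-- Iterated Cauchy-Schwarz: all the vertices of `D` have been doubled. -/
theorem abs_cubeForm_empty_pow_le (dg : ∀ i ∈ I, DependsOn (g i) (e i : Set V))
    (dν : ∀ i ∈ I, DependsOn (ν i) (e i : Set V)) (hg : ∀ i ∈ I, ∀ x, |g i x| ≤ ν i x)
    {err : ℝ} (h0 : 0 ≤ err) (hlin : LinearForms I e ν err) (D : Finset V) :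
    |cubeForm I e g ν ∅| ^ 2 ^ D.card * (1 + err)
      ≤ (1 + err) ^ 2 ^ D.card * |cubeForm I e g ν D| ∧
    ∀ c ∉ D, |cubeForm I e g ν ∅| ^ 2 ^ (D.card + 1) * (1 + err)
      ≤ (1 + err) ^ 2 ^ (D.card + 1) * max (cubeForm I e g ν (insert c D)) 0 := by
  have hν : ∀ i ∈ I, ∀ x, 0 ≤ ν i x := fun i hi x => (abs_nonneg _).trans (hg i hi x)
  have step : ∀ D : Finset V, ∀ c ∉ D,
      |cubeForm I e g ν ∅| ^ 2 ^ D.card * (1 + err)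
        ≤ (1 + err) ^ 2 ^ D.card * |cubeForm I e g ν D| →
      |cubeForm I e g ν ∅| ^ 2 ^ (D.card + 1) * (1 + err)
        ≤ (1 + err) ^ 2 ^ (D.card + 1) * max (cubeForm I e g ν (insert c D)) 0 := by
    intro D c hc hD
    set N := 𝔼 x : V × Bool → Ω,
      ∏ i ∈ I with c ∉ e i, ∏ s ∈ (D ∩ e i).powerset, ν i (select x s) with hN
    have hN0 : 0 ≤ N := Finset.expect_nonneg fun x _ => Finset.prod_nonneg fun i hi =>
      Finset.prod_nonneg fun s _ => hν i (Finset.mem_filter.1 hi).1 _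
    have hN1 : N ≤ 1 + err := by
      have := hlin ((I.filter fun i => c ∉ e i).sigma fun i => (D ∩ e i).powerset) (by
          rintro ⟨i, s⟩ hq
          simp only [Finset.mem_sigma, Finset.mem_filter, Finset.mem_powerset] at hq
          exact ⟨hq.1.1, hq.2.trans Finset.inter_subset_right⟩) (by
          rintro ⟨k, s⟩ hq i hi hik
          simp only [Finset.mem_sigma, Finset.mem_filter, Finset.mem_powerset] at hq ⊢
          exact ⟨⟨hi, fun h => hq.1.2 (hik h)⟩, Finset.inter_subset_inter_right
            (hq.2.trans Finset.inter_subset_left)⟩)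
      simp only [Finset.prod_sigma] at this
      have := (abs_le.1 this).2
      simp only [hN]
      linarith
    have h1 := cubeForm_sq_le dg dν hg hc
    rw [← hN] at h1
    have h2 : cubeForm I e g ν D ^ 2 ≤ (1 + err) * max (cubeForm I e g ν (insert c D)) 0 :=
      h1.trans ((mul_le_mul_of_nonneg_left (le_max_left _ _) hN0).trans
        (mul_le_mul_of_nonneg_right hN1 (le_max_right _ _)))
    have h3 : (|cubeForm I e g ν ∅| ^ 2 ^ D.card * (1 + err)) ^ 2
        ≤ ((1 + err) ^ 2 ^ D.card * |cubeForm I e g ν D|) ^ 2 :=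
      pow_le_pow_left₀ (by positivity) hD 2
    have h4 : (|cubeForm I e g ν ∅| ^ 2 ^ (D.card + 1) * (1 + err)) * (1 + err) ≤
        ((1 + err) ^ 2 ^ (D.card + 1) * max (cubeForm I e g ν (insert c D)) 0) * (1 + err) := by
      calc (|cubeForm I e g ν ∅| ^ 2 ^ (D.card + 1) * (1 + err)) * (1 + err)
          = (|cubeForm I e g ν ∅| ^ 2 ^ D.card * (1 + err)) ^ 2 := by rw [pow_succ 2, pow_mul]; ring
        _ ≤ ((1 + err) ^ 2 ^ D.card * |cubeForm I e g ν D|) ^ 2 := h3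
        _ = (1 + err) ^ 2 ^ (D.card + 1) * cubeForm I e g ν D ^ 2 := by
          rw [mul_pow, sq_abs, pow_succ 2, pow_mul]
        _ ≤ (1 + err) ^ 2 ^ (D.card + 1) *
            ((1 + err) * max (cubeForm I e g ν (insert c D)) 0) :=
          mul_le_mul_of_nonneg_left h2 (by positivity)
        _ = _ := by ring
    exact le_of_mul_le_mul_right h4 (by positivity)
  have all : ∀ D : Finset V, |cubeForm I e g ν ∅| ^ 2 ^ D.card * (1 + err)
        ≤ (1 + err) ^ 2 ^ D.card * |cubeForm I e g ν D| := by
    intro D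
    induction D using Finset.induction_on with
    | empty => simp [mul_comm]
    | insert c D hc ih =>
      rw [Finset.card_insert_of_notMem hc]
      refine (step D c hc ih).trans (mul_le_mul_of_nonneg_left ?_ (by positivity))
      exact max_le (le_abs_self _) (abs_nonneg _)
  exact ⟨all D, fun c hc => step D c hc (all D)⟩

/-- The weighted generalized von Neumann inequality. If the weights `ν i` satisfy the linear forms
condition, the average of `∏ g i` is controlled by the average of the product of all the `2 ^ k`
copies of a single `g i₀`, weighted by the copies of those `ν i` that live inside `e i₀`. -/
theorem abs_expect_prod_pow_le [DecidableEq ι] [Nonempty Ω]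
    (dg : ∀ i ∈ I, DependsOn (g i) (e i : Set V))
    (dν : ∀ i ∈ I, DependsOn (ν i) (e i : Set V)) (hg : ∀ i ∈ I, ∀ x, |g i x| ≤ ν i x)
    {err : ℝ} (h0 : 0 ≤ err) (hlin : LinearForms I e ν err) {i₀ : ι} (hi₀ : i₀ ∈ I)
    (hne : (e i₀).Nonempty) (hmax : ∀ i ∈ I, i ≠ i₀ → ¬ e i₀ ⊆ e i) {β : ℝ} (hβ : 0 ≤ β)
    (hbox : 𝔼 x : V × Bool → Ω, (∏ s ∈ (e i₀).powerset, g i₀ (select x s)) *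
      ∏ i ∈ I with i ≠ i₀ ∧ e i ⊆ e i₀, ∏ s ∈ (e i).powerset, ν i (select x s) ≤ β) :
    |𝔼 x : V → Ω, ∏ i ∈ I, g i x| ^ 2 ^ (e i₀).card
      ≤ (1 + err) ^ 2 ^ (e i₀).card * (β + 2 * √((1 + err) * err)) := by
  classical
  have hν : ∀ i ∈ I, ∀ x, 0 ≤ ν i x := fun i hi x => (abs_nonneg _).trans (hg i hi x)
  obtain ⟨c, hc⟩ := hne
  set D := e i₀ with hD
  have h1 := (abs_cubeForm_empty_pow_le dg dν hg h0 hlin (D.erase c)).2 c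
    (Finset.notMem_erase c D)
  rw [Finset.insert_erase hc, Finset.card_erase_add_one hc, cubeForm_empty] at h1
  have h2 : |𝔼 x : V → Ω, ∏ i ∈ I, g i x| ^ 2 ^ D.card
      ≤ (1 + err) ^ 2 ^ D.card * max (cubeForm I e g ν D) 0 := by
    refine le_trans ?_ h1
    exact le_mul_of_one_le_right (by positivity) (by linarith)
  refine h2.trans (mul_le_mul_of_nonneg_left ?_ (by positivity))
  refine max_le ?_ (by positivity)
  -- The copies of the weights inside `D` go into `Φ` and `Ψ`, the others into `W`.
  set Φ : (V × Bool → Ω) → ℝ := fun x => (∏ s ∈ D.powerset, g i₀ (select x s)) *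
      ∏ i ∈ I with i ≠ i₀ ∧ e i ⊆ D, ∏ s ∈ (e i).powerset, ν i (select x s) with hΦ
  set Ψ : (V × Bool → Ω) → ℝ := fun x =>
      ∏ i ∈ I with e i ⊆ D, ∏ s ∈ (e i).powerset, ν i (select x s) with hΨ
  set W : (V × Bool → Ω) → ℝ := fun x =>
      ∏ i ∈ I with ¬ e i ⊆ D, ∏ s ∈ (D ∩ e i).powerset, ν i (select x s) with hW
  have hsplit : ∀ F : ι → ℝ,
      ∏ i ∈ I with e i ⊆ D, F i = F i₀ * ∏ i ∈ I with i ≠ i₀ ∧ e i ⊆ D, F i := by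
    intro F
    have : (I.filter fun i => e i ⊆ D) =
        insert i₀ (I.filter fun i => i ≠ i₀ ∧ e i ⊆ D) := by
      ext i
      simp only [Finset.mem_filter, Finset.mem_insert]
      by_cases hi : i = i₀
      · subst hi; simp [hi₀, hD]
      · simp [hi]
    rw [this, Finset.prod_insert (by simp)]
  have hcube : cubeForm I e g ν D = 𝔼 x, Φ x * W x := by
    refine Finset.expect_congr rfl fun x _ => ?_
    rw [← Finset.prod_filter_mul_prod_filter_not I (fun i => e i ⊆ D), hsplit]
    simp only [hΦ, hW]
    congr 1
    · congr 1
      · rw [if_pos (Finset.Subset.refl _), Finset.inter_self]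
      · refine Finset.prod_congr rfl fun i hi => ?_
        simp only [Finset.mem_filter] at hi
        rw [if_neg (hmax i hi.1 hi.2.1), Finset.inter_eq_right.2 hi.2.2]
    · refine Finset.prod_congr rfl fun i hi => ?_
      simp only [Finset.mem_filter] at hi
      rw [if_neg (hmax i hi.1 fun h => hi.2 (by rw [h]))]
  have hΦΨ : ∀ x, |Φ x| ≤ Ψ x := by
    intro x
    simp only [hΦ, hΨ, hsplit, abs_mul]
    have hin : 0 ≤ ∏ i ∈ I with i ≠ i₀ ∧ e i ⊆ D, ∏ s ∈ (e i).powerset, ν i (select x s) :=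
      Finset.prod_nonneg fun i hi =>
        Finset.prod_nonneg fun s _ => hν i (Finset.mem_filter.1 hi).1 _
    rw [abs_of_nonneg hin]
    refine mul_le_mul_of_nonneg_right ?_ hin
    rw [Finset.abs_prod]
    exact Finset.prod_le_prod (fun s _ => abs_nonneg _) fun s _ => hg i₀ hi₀ _
  have dΨ : DependsOn Ψ {p : V × Bool | p.1 ∈ D} := by
    intro x y hxy
    refine Finset.prod_congr rfl fun i hi => Finset.prod_congr rfl fun s _ => ?_
    simp only [Finset.mem_filter] at hi
    exact apply_select_congr (dν i hi.1) fun v hv => hxy _ (hi.2 hv)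
  have dΦ : DependsOn Φ {p : V × Bool | p.1 ∈ D} := by
    intro x y hxy
    simp only [hΦ]
    congr 1
    · exact Finset.prod_congr rfl fun s _ =>
        apply_select_congr (dg i₀ hi₀) fun v hv => hxy _ hv
    · refine Finset.prod_congr rfl fun i hi => Finset.prod_congr rfl fun s _ => ?_
      simp only [Finset.mem_filter] at hi
      exact apply_select_congr (dν i hi.1) fun v hv => hxy _ (hi.2.2 hv)
  have dW : DependsOn W {p : V × Bool | p.1 ∈ D ∨ p.2 = false} := by
    intro x y hxy
    refine Finset.prod_congr rfl fun i hi => Finset.prod_congr rfl fun s hs => ?_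
    simp only [Finset.mem_filter, Finset.mem_powerset] at hi hs
    refine apply_select_congr (dν i hi.1) fun v hv => hxy _ ?_
    by_cases hvD : v ∈ D
    · exact Or.inl hvD
    · refine Or.inr (decide_eq_false fun hvs => hvD (Finset.mem_inter.1 (hs hvs)).1)
  have hvar := expect_mul_sub_one_sq_le hΦΨ dΦ dΨ dW
  -- The four families of copies that occur when the second moment is expanded.
  set Pin : Finset (Σ _ : ι, Finset V) :=
    (I.filter fun i => e i ⊆ D).sigma fun i => (e i).powerset with hPin
  set Pout : Finset (Σ _ : ι, Finset V) :=
    (I.filter fun i => ¬ e i ⊆ D).sigma fun i => (D ∩ e i).powerset with hPout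
  set Pout' : Finset (Σ _ : ι, Finset V) :=
    (I.filter fun i => ¬ e i ⊆ D).sigma
      fun i => (e i).powerset.filter fun s => e i \ D ⊆ s with hPout'
  set Q : (Σ _ : ι, Finset V) → (V × Bool → Ω) → ℝ := fun q x => ν q.1 (select x q.2) with hQ
  have qin : ∀ x, Ψ x = ∏ q ∈ Pin, Q q x := fun x => by
    simp only [hΨ, hPin, hQ, Finset.prod_sigma]
  have qout : ∀ x, W x = ∏ q ∈ Pout, Q q x := fun x => by
    simp only [hW, hPout, hQ, Finset.prod_sigma]
  have qout' : ∀ x, W (x ∘ toggle Dᶜ) = ∏ q ∈ Pout', Q q x := fun x => by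
    simp only [hW, hPout', hQ, Finset.prod_sigma]
    refine Finset.prod_congr rfl fun i hi => ?_
    simp only [Finset.mem_filter] at hi
    refine Finset.prod_bij' (fun s _ => s ∪ (e i \ D)) (fun s _ => s ∩ D) ?_ ?_ ?_ ?_ ?_
    · intro s hs
      simp only [Finset.mem_powerset, Finset.mem_filter] at hs ⊢
      exact ⟨Finset.union_subset (hs.trans Finset.inter_subset_right) Finset.sdiff_subset,
        Finset.subset_union_right⟩
    · intro s hs
      simp only [Finset.mem_powerset, Finset.mem_filter] at hs ⊢
      rw [Finset.inter_comm]
      exact Finset.inter_subset_inter_left hs.1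
    · intro s hs
      simp only [Finset.mem_powerset] at hs
      ext v
      have := @hs v
      simp only [Finset.mem_inter, Finset.mem_union, Finset.mem_sdiff] at this ⊢
      tauto
    · intro s hs
      simp only [Finset.mem_powerset, Finset.mem_filter] at hs
      ext v
      have h1 := @hs.1 v
      have h2 := @hs.2 v
      simp only [Finset.mem_inter, Finset.mem_union, Finset.mem_sdiff] at h2 ⊢
      tauto
    · intro s hs
      simp only [Finset.mem_powerset] at hs
      rw [select_comp_toggle]
      refine apply_select_congr (dν i hi.1) fun v hv => ?_
      congr 2
      have := @hs v
      simp only [Finset.mem_inter, Finset.mem_union, Finset.mem_sdiff, Finset.mem_symmDiff,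
        Finset.mem_compl] at this ⊢
      simp only [decide_eq_decide]
      tauto
  have d1 : Disjoint Pin Pout := by
    rw [Finset.disjoint_left]
    rintro ⟨i, s⟩ h1 h2
    simp only [hPin, hPout, Finset.mem_sigma, Finset.mem_filter] at h1 h2
    exact h2.1.2 h1.1.2
  have d2 : Disjoint Pin Pout' := by
    rw [Finset.disjoint_left]
    rintro ⟨i, s⟩ h1 h2
    simp only [hPin, hPout', Finset.mem_sigma, Finset.mem_filter] at h1 h2
    exact h2.1.2 h1.1.2
  have d3 : Disjoint (Pin ∪ Pout) Pout' := by
    rw [Finset.disjoint_union_left]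
    refine ⟨d2, ?_⟩
    rw [Finset.disjoint_left]
    rintro ⟨i, s⟩ h1 h2
    simp only [hPout, hPout', Finset.mem_sigma, Finset.mem_filter, Finset.mem_powerset] at h1 h2
    obtain ⟨v, hv, hvD⟩ := Finset.not_subset.1 h1.1.2
    exact hvD (Finset.mem_inter.1 (h1.2 (h2.2.2 (Finset.mem_sdiff.2 ⟨hv, hvD⟩)))).1
  have lin : ∀ P : Finset (Σ _ : ι, Finset V), (P = Pin ∨ P = Pin ∪ Pout ∨ P = Pin ∪ Pout' ∨
      P = Pin ∪ Pout ∪ Pout') → |(𝔼 x : V × Bool → Ω, ∏ q ∈ P, Q q x) - 1| ≤ err := by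
    have m1 : ∀ q ∈ Pin, (q.1 ∈ I ∧ q.2 ⊆ e q.1) ∧ ∀ i ∈ I, e i ⊆ e q.1 →
        (⟨i, q.2 ∩ e i⟩ : Σ _ : ι, Finset V) ∈ Pin := by
      rintro ⟨k, s⟩ hq
      simp only [hPin, Finset.mem_sigma, Finset.mem_filter, Finset.mem_powerset] at hq ⊢
      exact ⟨⟨hq.1.1, hq.2⟩, fun i hi hik =>
        ⟨⟨hi, hik.trans hq.1.2⟩, Finset.inter_subset_right⟩⟩
    have m2 : ∀ q ∈ Pout, (q.1 ∈ I ∧ q.2 ⊆ e q.1) ∧ ∀ i ∈ I, e i ⊆ e q.1 →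
        (⟨i, q.2 ∩ e i⟩ : Σ _ : ι, Finset V) ∈ Pin ∪ Pout := by
      rintro ⟨k, s⟩ hq
      simp only [hPin, hPout, Finset.mem_union, Finset.mem_sigma, Finset.mem_filter,
        Finset.mem_powerset] at hq ⊢
      refine ⟨⟨hq.1.1, hq.2.trans Finset.inter_subset_right⟩, fun i hi hik => ?_⟩
      by_cases hiD : e i ⊆ D
      · exact Or.inl ⟨⟨hi, hiD⟩, Finset.inter_subset_right⟩
      · exact Or.inr ⟨⟨hi, hiD⟩, Finset.inter_subset_inter_right
          (hq.2.trans Finset.inter_subset_left)⟩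
    have m3 : ∀ q ∈ Pout', (q.1 ∈ I ∧ q.2 ⊆ e q.1) ∧ ∀ i ∈ I, e i ⊆ e q.1 →
        (⟨i, q.2 ∩ e i⟩ : Σ _ : ι, Finset V) ∈ Pin ∪ Pout' := by
      rintro ⟨k, s⟩ hq
      simp only [hPin, hPout', Finset.mem_union, Finset.mem_sigma, Finset.mem_filter,
        Finset.mem_powerset] at hq ⊢
      refine ⟨⟨hq.1.1, hq.2.1⟩, fun i hi hik => ?_⟩
      by_cases hiD : e i ⊆ D
      · exact Or.inl ⟨⟨hi, hiD⟩, Finset.inter_subset_right⟩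
      · exact Or.inr ⟨⟨hi, hiD⟩, Finset.inter_subset_right, Finset.subset_inter
          ((Finset.sdiff_subset_sdiff hik (Finset.Subset.refl D)).trans hq.2.2)
          Finset.sdiff_subset⟩
    rintro P (rfl | rfl | rfl | rfl)
    · exact hlin _ (fun q hq => (m1 q hq).1) fun q hq => (m1 q hq).2
    · refine hlin _ (fun q hq => ?_) fun q hq i hi hiq => ?_
      · rcases Finset.mem_union.1 hq with h | h
        exacts [(m1 q h).1, (m2 q h).1]
      · rcases Finset.mem_union.1 hq with h | h
        exacts [Finset.mem_union_left _ ((m1 q h).2 i hi hiq), (m2 q h).2 i hi hiq]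
    · refine hlin _ (fun q hq => ?_) fun q hq i hi hiq => ?_
      · rcases Finset.mem_union.1 hq with h | h
        exacts [(m1 q h).1, (m3 q h).1]
      · rcases Finset.mem_union.1 hq with h | h
        exacts [Finset.mem_union_left _ ((m1 q h).2 i hi hiq), (m3 q h).2 i hi hiq]
    · refine hlin _ (fun q hq => ?_) fun q hq i hi hiq => ?_
      · rcases Finset.mem_union.1 hq with h | h
        · rcases Finset.mem_union.1 h with h | h
          exacts [(m1 q h).1, (m2 q h).1]
        · exact (m3 q h).1
      · rcases Finset.mem_union.1 hq with h | h
        · rcases Finset.mem_union.1 h with h | h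
          exacts [Finset.mem_union_left _ (Finset.mem_union_left _ ((m1 q h).2 i hi hiq)),
            Finset.mem_union_left _ ((m2 q h).2 i hi hiq)]
        · rcases Finset.mem_union.1 ((m3 q h).2 i hi hiq) with h' | h'
          exacts [Finset.mem_union_left _ (Finset.mem_union_left _ h'),
            Finset.mem_union_right _ h']
  have l1 := abs_le.1 (lin Pin (Or.inl rfl))
  have l2 := abs_le.1 (lin (Pin ∪ Pout) (Or.inr (Or.inl rfl)))
  have l3 := abs_le.1 (lin (Pin ∪ Pout') (Or.inr (Or.inr (Or.inl rfl))))
  have l4 := abs_le.1 (lin (Pin ∪ Pout ∪ Pout') (Or.inr (Or.inr (Or.inr rfl))))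
  simp only [Finset.prod_union d3, Finset.prod_union d1, Finset.prod_union d2, ← qin, ← qout,
    ← qout'] at l1 l2 l3 l4
  have hexp : 𝔼 x, Ψ x * (W x - 1) * (W (x ∘ toggle Dᶜ) - 1) =
      (𝔼 x, Ψ x * W x * W (x ∘ toggle Dᶜ)) - (𝔼 x, Ψ x * W x)
        - (𝔼 x, Ψ x * W (x ∘ toggle Dᶜ)) + 𝔼 x, Ψ x := by
    rw [← Finset.expect_sub_distrib, ← Finset.expect_sub_distrib, ← Finset.expect_add_distrib]
    exact Finset.expect_congr rfl fun x _ => by ring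
  have hvar' : (𝔼 x, Φ x * (W x - 1)) ^ 2 ≤ (2 * √((1 + err) * err)) ^ 2 := by
    rw [mul_pow, Real.sq_sqrt (by positivity)]
    refine hvar.trans ?_
    have hΨ0 : 0 ≤ 𝔼 x, Ψ x := Finset.expect_nonneg fun x _ => (abs_nonneg _).trans (hΦΨ x)
    have : 𝔼 x, Ψ x * (W x - 1) * (W (x ∘ toggle Dᶜ) - 1) ≤ 4 * err := by
      rw [hexp]; linarith [l1.1, l1.2, l2.1, l2.2, l3.1, l3.2, l4.1, l4.2]
    calc _ ≤ (𝔼 x, Ψ x) * (4 * err) := mul_le_mul_of_nonneg_left this hΨ0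
      _ ≤ (1 + err) * (4 * err) :=
        mul_le_mul_of_nonneg_right (by linarith [l1.2]) (by positivity)
      _ = _ := by ring
  have hfin := abs_le_of_sq_le_sq hvar' (by positivity)
  have hsum : 𝔼 x, Φ x * W x = (𝔼 x, Φ x) + 𝔼 x, Φ x * (W x - 1) := by
    rw [← Finset.expect_add_distrib]
    exact Finset.expect_congr rfl fun x _ => by ring
  rw [hcube, hsum]
  exact add_le_add hbox (abs_le.1 hfin).2

end Doubling

/-! ### Weight systems and configurations -/

/-- A two-level system of weights on `K → Ω`: edge weights, indexed by `E` and depending on two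
coordinates, and face weights, indexed by `L` and depending on three coordinates. All of them are
indicator functions, a face weight being supported where the weights of its edges are `1`. The
number `d b` is the density of the weight `b` relative to the weights of its edges. -/
structure WeightSystem (K Ω E L : Type*) where
  sp : E ⊕ L → Finset K
  w : E ⊕ L → (K → Ω) → ℝ
  d : E ⊕ L → ℝ
  sp_injective : Function.Injective sp
  card_edge : ∀ a, (sp (Sum.inl a)).card = 2
  card_face : ∀ l, (sp (Sum.inr l)).card = 3
  dependsOn : ∀ b, DependsOn (w b) (sp b : Set K)
  zero_or_one : ∀ b z, w b z = 0 ∨ w b z = 1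
  d_pos : ∀ b, 0 < d b
  d_le_one : ∀ b, d b ≤ 1
  supp : ∀ a l z, sp (Sum.inl a) ⊆ sp (Sum.inr l) → w (Sum.inr l) z ≠ 0 → w (Sum.inl a) z ≠ 0

/-- A family, indexed by `ι`, of partite embeddings of elements of `B` in a vertex set `J` coloured
by `K`: the `i`-th member is a copy of `base i`, whose vertex of colour `k` is `v i k`. -/
structure Config (K J B ι : Type*) where
  col : J → K
  base : ι → B
  v : ι → K → J
  col_v : ∀ i k, col (v i k) = k

namespace Config

variable {K J B ι : Type*}

theorem v_injective (c : Config K J B ι) (i : ι) : Function.Injective (c.v i) := fun a b h => by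
  rw [← c.col_v i a, ← c.col_v i b, h]

variable [DecidableEq J]

/-- The set of vertices of the `i`-th member of a configuration. -/
def verts (c : Config K J B ι) (sp : B → Finset K) (i : ι) : Finset J :=
  (sp (c.base i)).image (c.v i)

theorem card_verts (c : Config K J B ι) (sp : B → Finset K) (i : ι) :
    (c.verts sp i).card = (sp (c.base i)).card :=
  Finset.card_image_of_injective _ (c.v_injective i)

theorem v_eq_of_mem {c : Config K J B ι} {sp : B → Finset K} {i k : ι} {a : K}
    (ha : c.v i a ∈ c.verts sp k) : a ∈ sp (c.base k) ∧ c.v i a = c.v k a := by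
  obtain ⟨b, hb, hba⟩ := Finset.mem_image.1 ha
  have : b = a := by rw [← c.col_v k b, ← c.col_v i a, hba]
  subst this
  exact ⟨hb, hba.symm⟩

theorem subset_of_verts_subset {c : Config K J B ι} {sp : B → Finset K} {i k : ι}
    (h : c.verts sp i ⊆ c.verts sp k) :
    sp (c.base i) ⊆ sp (c.base k) ∧ ∀ a ∈ sp (c.base i), c.v i a = c.v k a :=
  ⟨fun _ ha => (v_eq_of_mem (h (Finset.mem_image_of_mem _ ha))).1,
    fun _ ha => (v_eq_of_mem (h (Finset.mem_image_of_mem _ ha))).2⟩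

theorem dependsOn_comp {Ω : Type*} (c : Config K J B ι) (sp : B → Finset K) (i : ι)
    {φ : (K → Ω) → ℝ} (hφ : DependsOn φ (sp (c.base i) : Set K)) :
    DependsOn (fun x : J → Ω => φ (x ∘ c.v i)) (c.verts sp i : Set J) := fun _ _ hxy =>
  hφ fun _ ha => hxy _ (Finset.mem_coe.2 (Finset.mem_image_of_mem (c.v i) (Finset.mem_coe.1 ha)))

/-- The configuration of all the copies `(i, s)` in the doubled vertex set. -/
def double (c : Config K J B ι) : Config K (J × Bool) B (Σ _ : ι, Finset J) where
  col p := c.col p.1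
  base q := c.base q.1
  v q k := (c.v q.1 k, decide (c.v q.1 k ∈ q.2))
  col_v q k := c.col_v q.1 k

theorem double_injOn {c : Config K J B ι} {sp : B → Finset K} {I : Finset ι}
    (hI : Set.InjOn (c.verts sp) I) {P : Finset (Σ _ : ι, Finset J)}
    (hP : ∀ q ∈ P, q.1 ∈ I ∧ q.2 ⊆ c.verts sp q.1) : Set.InjOn (c.double.verts sp) P := by
  have h1 : ∀ q, (c.double.verts sp q).image Prod.fst = c.verts sp q.1 := by
    intro q
    simp only [verts, double, Finset.image_image]
    rfl
  have h2 : ∀ q ∈ P, ∀ j, j ∈ q.2 ↔ (j, true) ∈ c.double.verts sp q := by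
    intro q hq j
    simp only [verts, double, Finset.mem_image, Prod.mk.injEq, decide_eq_true_eq]
    constructor
    · intro hj
      obtain ⟨a, ha, rfl⟩ := Finset.mem_image.1 ((hP q hq).2 hj)
      exact ⟨a, ha, rfl, hj⟩
    · rintro ⟨a, _, rfl, h⟩
      exact h
  intro q hq q' hq' h
  have e1 : q.1 = q'.1 := hI (hP q hq).1 (hP q' hq').1 (by rw [← h1, ← h1, h])
  have e2 : q.2 = q'.2 := by
    ext j
    rw [h2 q hq, h2 q' hq', h]
  obtain ⟨i, s⟩ := q
  obtain ⟨i', s'⟩ := q'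
  simp only at e1 e2
  rw [e1, e2]

end Config

section Box

variable {K J Ω : Type*} [Fintype K] [DecidableEq K] [Fintype J] [DecidableEq J] [Fintype Ω]

/-- The `2 ^ |c|`-th power of the box norm of `f` in the coordinates in `c`. -/
noncomputable def boxE {K Ω : Type*} [Fintype K] [DecidableEq K] [Fintype Ω] (c : Finset K)
    (f : (K → Ω) → ℝ) : ℝ :=
  𝔼 x : K × Bool → Ω, ∏ s ∈ c.powerset, f (select x s)

theorem expect_prod_select_comp [Nonempty Ω] {v : K → J} (hv : Function.Injective v)
    (c : Finset K) (f : (K → Ω) → ℝ) :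
    𝔼 x : J × Bool → Ω, ∏ s ∈ (c.image v).powerset, f (select x s ∘ v) = boxE c f := by
  have hinj : Function.Injective (fun p : K × Bool => (v p.1, p.2)) := fun p q h => by
    simp only [Prod.mk.injEq] at h
    exact Prod.ext (hv h.1) h.2
  rw [boxE, ← expect_comp_injective hinj]
  refine Finset.expect_congr rfl fun x _ => ?_
  have himage : (c.image v).powerset = c.powerset.image (Finset.image v) := by
    ext s
    simp only [Finset.mem_powerset, Finset.mem_image, Finset.subset_image_iff]
  rw [himage, Finset.prod_image fun s _ t _ h => Finset.image_injective hv h]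
  refine Finset.prod_congr rfl fun s _ => congrArg f ?_
  ext k
  simp [select, hv.eq_iff]

theorem boxE_div (c : Finset K) (f : (K → Ω) → ℝ) (r : ℝ) :
    boxE c (fun z => f z / r) = boxE c f / r ^ 2 ^ c.card := by
  simp only [boxE, Finset.expect_div, Finset.prod_div_distrib, Finset.prod_const,
    Finset.card_powerset]

end Box

namespace WeightSystem

variable {K J Ω E L ι : Type*}

theorem nonneg (𝒲 : WeightSystem K Ω E L) (b : E ⊕ L) (z : K → Ω) : 0 ≤ 𝒲.w b z := by
  rcases 𝒲.zero_or_one b z with h | h <;> simp [h]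

theorem le_one (𝒲 : WeightSystem K Ω E L) (b : E ⊕ L) (z : K → Ω) : 𝒲.w b z ≤ 1 := by
  rcases 𝒲.zero_or_one b z with h | h <;> simp [h]

theorem eq_one (𝒲 : WeightSystem K Ω E L) {b : E ⊕ L} {z : K → Ω} (h : 𝒲.w b z ≠ 0) :
    𝒲.w b z = 1 := (𝒲.zero_or_one b z).resolve_left h

theorem card_le (𝒲 : WeightSystem K Ω E L) (b : E ⊕ L) : (𝒲.sp b).card ≤ 3 := by
  rcases b with a | l
  · rw [𝒲.card_edge]; norm_num
  · rw [𝒲.card_face]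

/-- The weight `w b` divided by its density. -/
noncomputable def nw (𝒲 : WeightSystem K Ω E L) (b : E ⊕ L) (z : K → Ω) : ℝ := 𝒲.w b z / 𝒲.d b

theorem nw_nonneg (𝒲 : WeightSystem K Ω E L) (b : E ⊕ L) (z : K → Ω) : 0 ≤ 𝒲.nw b z :=
  div_nonneg (𝒲.nonneg b z) (𝒲.d_pos b).le

theorem nw_dependsOn (𝒲 : WeightSystem K Ω E L) (b : E ⊕ L) :
    DependsOn (𝒲.nw b) (𝒲.sp b : Set K) := fun x y h => by
  rw [nw, nw, 𝒲.dependsOn b h]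

variable [Fintype K] [DecidableEq K] [Fintype J] [DecidableEq J] [Fintype Ω]
  [Nonempty Ω] [DecidableEq ι] {𝒲 : WeightSystem K Ω E L} {c : Config K J (E ⊕ L) ι} {I : Finset ι}

/-- Counting copies of a graph: the edge weights are replaced by their densities one by one, each
time at the cost of the box norm of `w a - d a`. -/
theorem abs_expect_edges_sub_le {b : ℝ} (hb : 0 ≤ b)
    (h2 : ∀ a : E, boxE (𝒲.sp (Sum.inl a)) (fun z => 𝒲.w (Sum.inl a) z - 𝒲.d (Sum.inl a)) ≤ b ^ 4)
    (hI : Set.InjOn (c.verts 𝒲.sp) I) (hE : ∀ i ∈ I, ∃ a, c.base i = Sum.inl a) :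
    |(𝔼 x : J → Ω, ∏ i ∈ I, 𝒲.w (c.base i) (x ∘ c.v i)) - ∏ i ∈ I, 𝒲.d (c.base i)|
      ≤ I.card * b := by
  induction I using Finset.induction_on with
  | empty => simp
  | insert i₀ I hi₀ ih =>
    have ih' := ih (hI.mono (by simp)) fun i hi => hE i (Finset.mem_insert_of_mem hi)
    obtain ⟨a, ha⟩ := hE i₀ (Finset.mem_insert_self _ _)
    set γ : ι → (K → Ω) → ℝ := fun i =>
      if i = i₀ then fun z => 𝒲.w (c.base i) z - 𝒲.d (c.base i) else 𝒲.w (c.base i) with hγ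
    have γ0 : γ i₀ = fun z => 𝒲.w (Sum.inl a) z - 𝒲.d (Sum.inl a) := by simp [hγ, ha]
    have γ1 : ∀ i ∈ I, γ i = 𝒲.w (c.base i) := fun i hi => by
      have : i ≠ i₀ := by rintro rfl; exact hi₀ hi
      simp [hγ, this]
    have hcard : ∀ i ∈ insert i₀ I, (c.verts 𝒲.sp i).card = 2 := fun i hi => by
      obtain ⟨a', ha'⟩ := hE i hi
      rw [c.card_verts, ha', 𝒲.card_edge]
    have key := abs_expect_prod_pow_le (Ω := Ω) (I := insert i₀ I) (e := c.verts 𝒲.sp)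
      (g := fun i x => γ i (x ∘ c.v i)) (ν := fun _ _ => 1)
      (fun i _ => c.dependsOn_comp 𝒲.sp i (by
        intro x y h
        simp only [hγ]
        split_ifs
        · simp only [𝒲.dependsOn _ h]
        · exact 𝒲.dependsOn _ h))
      (fun i _ x y _ => rfl)
      (fun i _ x => by
        simp only [hγ]
        have := 𝒲.nonneg (c.base i) (x ∘ c.v i)
        have := 𝒲.le_one (c.base i) (x ∘ c.v i)
        have := 𝒲.d_pos (c.base i)
        have := 𝒲.d_le_one (c.base i)
        split_ifs <;> rw [abs_le] <;> constructor <;> linarith)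
      (err := 0) le_rfl (by intro P _ _; simp) (Finset.mem_insert_self i₀ I)
      (Finset.card_pos.1 (by rw [hcard i₀ (Finset.mem_insert_self _ _)]; norm_num))
      (fun i hi hne hsub => hne (hI hi (Finset.mem_insert_self _ _)
        (Finset.eq_of_subset_of_card_le hsub (by
          rw [hcard i hi, hcard i₀ (Finset.mem_insert_self _ _)])).symm))
      (β := b ^ 4) (by positivity) (by
        simp only [Finset.prod_const_one, mul_one]
        refine le_of_eq_of_le ?_ (h2 a)
        rw [← expect_prod_select_comp (c.v_injective i₀), γ0, ← ha]
        rfl)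
    rw [hcard i₀ (Finset.mem_insert_self _ _)] at key
    have key' : |𝔼 x : J → Ω, ∏ i ∈ insert i₀ I, γ i (x ∘ c.v i)| ≤ b := by
      refine le_of_pow_le_pow_left₀ (n := 4) (by norm_num) hb ?_
      simpa using key
    have hsplit : (𝔼 x : J → Ω, ∏ i ∈ insert i₀ I, 𝒲.w (c.base i) (x ∘ c.v i))
        - ∏ i ∈ insert i₀ I, 𝒲.d (c.base i)
        = (𝔼 x : J → Ω, ∏ i ∈ insert i₀ I, γ i (x ∘ c.v i)) + 𝒲.d (c.base i₀) *
          ((𝔼 x : J → Ω, ∏ i ∈ I, 𝒲.w (c.base i) (x ∘ c.v i)) - ∏ i ∈ I, 𝒲.d (c.base i)) := by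
      rw [Finset.prod_insert hi₀, mul_sub, ← add_sub_assoc, Finset.mul_expect,
        ← Finset.expect_add_distrib]
      congr 1
      refine Finset.expect_congr rfl fun x _ => ?_
      have hrest : ∏ i ∈ I, γ i (x ∘ c.v i) = ∏ i ∈ I, 𝒲.w (c.base i) (x ∘ c.v i) :=
        Finset.prod_congr rfl fun i hi => by rw [γ1 i hi]
      rw [Finset.prod_insert hi₀, Finset.prod_insert hi₀, γ0, hrest, ha]
      ring
    rw [hsplit, Finset.card_insert_of_notMem hi₀]
    push_cast
    refine (abs_add_le _ _).trans ?_
    rw [abs_mul, abs_of_pos (𝒲.d_pos _)]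
    have : 𝒲.d (c.base i₀) * |(𝔼 x : J → Ω, ∏ i ∈ I, 𝒲.w (c.base i) (x ∘ c.v i))
        - ∏ i ∈ I, 𝒲.d (c.base i)| ≤ 1 * (I.card * b) :=
      mul_le_mul (𝒲.d_le_one _) ih' (abs_nonneg _) zero_le_one
    linarith

/-- Counting copies of a graph, in terms of the normalised weights. -/
theorem abs_expect_edges_sub_one_le {b p : ℝ} (hb : 0 ≤ b)
    (h2 : ∀ a : E, boxE (𝒲.sp (Sum.inl a)) (fun z => 𝒲.w (Sum.inl a) z - 𝒲.d (Sum.inl a)) ≤ b ^ 4)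
    (hp : 0 < p) (hpd : ∀ a : E, p ≤ 𝒲.d (Sum.inl a)) {n : ℕ} (hn : I.card ≤ n)
    (hI : Set.InjOn (c.verts 𝒲.sp) I) (hE : ∀ i ∈ I, ∃ a, c.base i = Sum.inl a) :
    |(𝔼 x : J → Ω, ∏ i ∈ I, 𝒲.nw (c.base i) (x ∘ c.v i)) - 1| ≤ n * b / p ^ n := by
  have hd : 0 < ∏ i ∈ I, 𝒲.d (c.base i) := Finset.prod_pos fun i _ => 𝒲.d_pos _
  rcases I.eq_empty_or_nonempty with rfl | ⟨i₁, hi₁⟩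
  · simp; positivity
  have hp1 : p ≤ 1 := by
    obtain ⟨a, ha⟩ := hE i₁ hi₁
    exact (hpd a).trans (𝒲.d_le_one _)
  have hle : p ^ n ≤ ∏ i ∈ I, 𝒲.d (c.base i) := by
    calc p ^ n ≤ p ^ I.card := pow_le_pow_of_le_one hp.le hp1 hn
      _ = ∏ _i ∈ I, p := by rw [Finset.prod_const]
      _ ≤ _ := Finset.prod_le_prod (fun _ _ => hp.le) fun i hi => by
        obtain ⟨a, ha⟩ := hE i hi
        rw [ha]
        exact hpd a
  have h1 := abs_expect_edges_sub_le hb h2 hI hE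
  have h3 : (𝔼 x : J → Ω, ∏ i ∈ I, 𝒲.nw (c.base i) (x ∘ c.v i)) - 1
      = ((𝔼 x : J → Ω, ∏ i ∈ I, 𝒲.w (c.base i) (x ∘ c.v i)) - ∏ i ∈ I, 𝒲.d (c.base i))
        / ∏ i ∈ I, 𝒲.d (c.base i) := by
    rw [sub_div, div_self hd.ne', Finset.expect_div]
    simp only [nw, Finset.prod_div_distrib]
  rw [h3, abs_div, abs_of_pos hd]
  have : (I.card : ℝ) ≤ n := by exact_mod_cast hn
  exact div_le_div₀ (by positivity) (h1.trans (mul_le_mul_of_nonneg_right this hb)) (by positivity)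
    hle

/-- The generalized von Neumann inequality for a configuration: the face `i₀` carries a function
`f` supported on the edges of the face, and the box norm of `f` is compared with that of a function
`h` of the same kind. -/
theorem abs_expect_face_pow_le {γ μ : ι → (K → Ω) → ℝ}
    (dγ : ∀ i ∈ I, DependsOn (γ i) (𝒲.sp (c.base i) : Set K))
    (dμ : ∀ i ∈ I, DependsOn (μ i) (𝒲.sp (c.base i) : Set K))
    (hγ : ∀ i ∈ I, ∀ z, |γ i z| ≤ μ i z) {err : ℝ} (h0 : 0 ≤ err) (h1 : err ≤ 1)
    (hlin : LinearForms I (c.verts 𝒲.sp) (fun i x => μ i (x ∘ c.v i)) err)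
    (hI : Set.InjOn (c.verts 𝒲.sp) I) {i₀ : ι} (hi₀ : i₀ ∈ I) {l : L}
    (hl : c.base i₀ = Sum.inr l)
    (hμ : ∀ i ∈ I, ∀ a, c.base i = Sum.inl a → μ i = 𝒲.nw (Sum.inl a))
    {h : (K → Ω) → ℝ} (hh0 : ∀ z, 0 ≤ h z) (hhμ : ∀ z, h z ≤ μ i₀ z)
    (hγsupp : ∀ a z, 𝒲.sp (Sum.inl a) ⊆ 𝒲.sp (Sum.inr l) → γ i₀ z ≠ 0 → 𝒲.w (Sum.inl a) z ≠ 0)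
    (hhsupp : ∀ a z, 𝒲.sp (Sum.inl a) ⊆ 𝒲.sp (Sum.inr l) → h z ≠ 0 → 𝒲.w (Sum.inl a) z ≠ 0)
    {H : ℝ} (hH : 0 ≤ H)
    (hbox : boxE (𝒲.sp (Sum.inr l)) (γ i₀) ≤ H * boxE (𝒲.sp (Sum.inr l)) h) :
    |𝔼 x : J → Ω, ∏ i ∈ I, γ i (x ∘ c.v i)| ^ 8 ≤ 2 ^ 8 * (2 * H + 2 * √(2 * err)) := by
  set e := c.verts 𝒲.sp with he
  set D := e i₀ with hD
  have hμ0 : ∀ i ∈ I, ∀ z, 0 ≤ μ i z := fun i hi z => (abs_nonneg _).trans (hγ i hi z)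
  have hcardD : D.card = 3 := by rw [hD, he, c.card_verts, hl, 𝒲.card_face]
  have hbase : D = (𝒲.sp (Sum.inr l)).image (c.v i₀) := by rw [hD, he, Config.verts, hl]
  -- the members living inside `D`, other than `i₀`, are edges of the face
  have hin : ∀ i ∈ I, i ≠ i₀ → e i ⊆ D → ∃ a, c.base i = Sum.inl a ∧
      𝒲.sp (Sum.inl a) ⊆ 𝒲.sp (Sum.inr l) ∧ ∀ k ∈ 𝒲.sp (Sum.inl a), c.v i k = c.v i₀ k := by
    intro i hi hne hsub
    have hs := Config.subset_of_verts_subset hsub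
    rcases hb : c.base i with a | l'
    · rw [hb, hl] at hs
      exact ⟨a, rfl, hs⟩
    · refine absurd (hI hi hi₀ (Finset.eq_of_subset_of_card_le hsub ?_)) hne
      rw [hcardD, he, c.card_verts, hb, 𝒲.card_face]
  set ρ : ℝ := ∏ i ∈ I with i ≠ i₀ ∧ e i ⊆ D, ∏ _s ∈ (e i).powerset, (1 / 𝒲.d (c.base i)) with hρ
  have hρ0 : 0 ≤ ρ := Finset.prod_nonneg fun i _ => Finset.prod_nonneg fun _ _ =>
    one_div_nonneg.2 (𝒲.d_pos _).le
  have hpt : ∀ f : (K → Ω) → ℝ,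
      (∀ a z, 𝒲.sp (Sum.inl a) ⊆ 𝒲.sp (Sum.inr l) → f z ≠ 0 → 𝒲.w (Sum.inl a) z ≠ 0) →
      ∀ x : J × Bool → Ω, (∏ s ∈ D.powerset, f (select x s ∘ c.v i₀)) *
        ∏ i ∈ I with i ≠ i₀ ∧ e i ⊆ D, ∏ s ∈ (e i).powerset, μ i (select x s ∘ c.v i)
        = ρ * ∏ s ∈ D.powerset, f (select x s ∘ c.v i₀) := by
    intro f hf x
    by_cases hz : ∏ s ∈ D.powerset, f (select x s ∘ c.v i₀) = 0
    · rw [hz]; simp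
    rw [mul_comm]
    congr 1
    refine Finset.prod_congr rfl fun i hi => Finset.prod_congr rfl fun s hs => ?_
    simp only [Finset.mem_filter] at hi
    obtain ⟨a, ha, hsub, hv⟩ := hin i hi.1 hi.2.1 hi.2.2
    have hfs : f (select x s ∘ c.v i₀) ≠ 0 := Finset.prod_ne_zero_iff.1 hz s
      (Finset.mem_powerset.2 ((Finset.mem_powerset.1 hs).trans hi.2.2))
    have hw := 𝒲.eq_one (hf a _ hsub hfs)
    rw [hμ i hi.1 a ha, nw, ha, ← hw]
    congr 1
    refine 𝒲.dependsOn _ fun k hk => ?_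
    rw [Function.comp_apply, Function.comp_apply, hv k (by simpa using hk)]
  have hbox' : 𝔼 x : J × Bool → Ω, (∏ s ∈ D.powerset, γ i₀ (select x s ∘ c.v i₀)) *
      ∏ i ∈ I with i ≠ i₀ ∧ e i ⊆ D, ∏ s ∈ (e i).powerset, μ i (select x s ∘ c.v i) ≤ 2 * H := by
    calc _ = ρ * boxE (𝒲.sp (Sum.inr l)) (γ i₀) := by
          rw [Finset.expect_congr rfl fun x _ => hpt _ hγsupp x, ← Finset.mul_expect,
            ← expect_prod_select_comp (c.v_injective i₀), ← hbase]
      _ ≤ ρ * (H * boxE (𝒲.sp (Sum.inr l)) h) := mul_le_mul_of_nonneg_left hbox hρ0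
      _ = H * 𝔼 x : J × Bool → Ω, (∏ s ∈ D.powerset, h (select x s ∘ c.v i₀)) *
          ∏ i ∈ I with i ≠ i₀ ∧ e i ⊆ D, ∏ s ∈ (e i).powerset, μ i (select x s ∘ c.v i) := by
          rw [Finset.expect_congr rfl fun x _ => hpt _ hhsupp x, ← Finset.mul_expect,
            ← expect_prod_select_comp (c.v_injective i₀), ← hbase]
          ring
      _ ≤ H * (1 + err) := by
          refine mul_le_mul_of_nonneg_left ?_ hH
          have hl1 := (abs_le.1 (hlin ((I.filter fun i => e i ⊆ D).sigma fun i => (e i).powerset)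
            (by
              rintro ⟨i, s⟩ hq
              simp only [Finset.mem_sigma, Finset.mem_filter, Finset.mem_powerset] at hq
              exact ⟨hq.1.1, hq.2⟩)
            (by
              rintro ⟨k, s⟩ hq i hi hik
              simp only [Finset.mem_sigma, Finset.mem_filter, Finset.mem_powerset] at hq ⊢
              exact ⟨⟨hi, hik.trans hq.1.2⟩, Finset.inter_subset_right⟩))).2
          refine le_trans (Finset.expect_le_expect fun x _ => ?_) (sub_le_iff_le_add'.1 hl1)
          have : (I.filter fun i => e i ⊆ D) =
              insert i₀ (I.filter fun i => i ≠ i₀ ∧ e i ⊆ D) := by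
            ext i
            simp only [Finset.mem_filter, Finset.mem_insert]
            by_cases hi : i = i₀
            · subst hi; simp [hi₀, hD]
            · simp [hi]
          rw [Finset.prod_sigma, this, Finset.prod_insert (by simp)]
          refine mul_le_mul_of_nonneg_right ?_ ?_
          · exact Finset.prod_le_prod (fun s _ => hh0 _) fun s _ => hhμ _
          · exact Finset.prod_nonneg fun i hi => Finset.prod_nonneg fun s _ =>
              hμ0 i (Finset.mem_filter.1 hi).1 _
      _ ≤ 2 * H := by nlinarith
  have key := abs_expect_prod_pow_le (Ω := Ω) (I := I) (e := e)
    (g := fun i x => γ i (x ∘ c.v i)) (ν := fun i x => μ i (x ∘ c.v i))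
    (fun i hi => c.dependsOn_comp 𝒲.sp i (dγ i hi))
    (fun i hi => c.dependsOn_comp 𝒲.sp i (dμ i hi))
    (fun i hi x => hγ i hi _) h0 hlin hi₀ (Finset.card_pos.1 (by rw [← hD, hcardD]; norm_num))
    (fun i hi hne hsub => hne (hI hi hi₀ (Finset.eq_of_subset_of_card_le hsub (by
      rw [← hD, hcardD, c.card_verts]; exact 𝒲.card_le _)).symm))
    (β := 2 * H) (by positivity) hbox'
  rw [← hD, hcardD] at key
  refine key.trans ?_
  have e1 : (1 + err) ^ 2 ^ 3 ≤ 2 ^ 8 := by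
    exact pow_le_pow_left₀ (by linarith) (by linarith) (2 ^ 3)
  refine mul_le_mul e1 ?_ (by positivity) (by positivity)
  have : √((1 + err) * err) ≤ √(2 * err) :=
    Real.sqrt_le_sqrt (mul_le_mul_of_nonneg_right (by linarith) h0)
  linarith

end WeightSystem

namespace WeightSystem

/-! ### Counting copies of a hypergraph -/

variable {K J Ω E L ι : Type*} [Fintype E] [DecidableEq K]

/-- The product of the weights of the edges of the face `l`. -/
noncomputable def edgeProd (𝒲 : WeightSystem K Ω E L) (l : L) (z : K → Ω) : ℝ :=
  ∏ a : E with 𝒲.sp (Sum.inl a) ⊆ 𝒲.sp (Sum.inr l), 𝒲.w (Sum.inl a) z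

theorem edgeProd_nonneg (𝒲 : WeightSystem K Ω E L) (l : L) (z : K → Ω) : 0 ≤ 𝒲.edgeProd l z :=
  Finset.prod_nonneg fun _ _ => 𝒲.nonneg _ _

theorem edgeProd_le_one (𝒲 : WeightSystem K Ω E L) (l : L) (z : K → Ω) : 𝒲.edgeProd l z ≤ 1 :=
  Finset.prod_le_one (fun _ _ => 𝒲.nonneg _ _) fun _ _ => 𝒲.le_one _ _

theorem ne_zero_of_edgeProd_ne_zero {𝒲 : WeightSystem K Ω E L} {l : L} {a : E} {z : K → Ω}
    (ha : 𝒲.sp (Sum.inl a) ⊆ 𝒲.sp (Sum.inr l)) (h : 𝒲.edgeProd l z ≠ 0) :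
    𝒲.w (Sum.inl a) z ≠ 0 :=
  Finset.prod_ne_zero_iff.1 h a (by simpa using ha)

theorem edgeProd_dependsOn (𝒲 : WeightSystem K Ω E L) (l : L) :
    DependsOn (𝒲.edgeProd l) (𝒲.sp (Sum.inr l) : Set K) := fun _ _ h =>
  Finset.prod_congr rfl fun _ ha => 𝒲.dependsOn _ fun k hk =>
    h k ((Finset.mem_filter.1 ha).2 hk)

/-- The deviation of the face weight `l` from its density relative to the edges of the face. -/
noncomputable def dev (𝒲 : WeightSystem K Ω E L) (l : L) (z : K → Ω) : ℝ :=
  𝒲.w (Sum.inr l) z - 𝒲.d (Sum.inr l) * 𝒲.edgeProd l z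

theorem dev_dependsOn (𝒲 : WeightSystem K Ω E L) (l : L) :
    DependsOn (𝒲.dev l) (𝒲.sp (Sum.inr l) : Set K) := fun _ _ h => by
  rw [dev, dev, 𝒲.dependsOn _ h, 𝒲.edgeProd_dependsOn l h]

theorem abs_dev_le_one (𝒲 : WeightSystem K Ω E L) (l : L) (z : K → Ω) : |𝒲.dev l z| ≤ 1 := by
  have h1 := 𝒲.nonneg (Sum.inr l) z
  have h2 := 𝒲.le_one (Sum.inr l) z
  have h3 : 0 ≤ 𝒲.d (Sum.inr l) * 𝒲.edgeProd l z :=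
    mul_nonneg (𝒲.d_pos _).le (𝒲.edgeProd_nonneg l z)
  have h4 : 𝒲.d (Sum.inr l) * 𝒲.edgeProd l z ≤ 1 :=
    mul_le_one₀ (𝒲.d_le_one _) (𝒲.edgeProd_nonneg l z) (𝒲.edgeProd_le_one l z)
  rw [dev, abs_le]
  constructor <;> linarith

theorem ne_zero_of_dev_ne_zero {𝒲 : WeightSystem K Ω E L} {l : L} {a : E} {z : K → Ω}
    (ha : 𝒲.sp (Sum.inl a) ⊆ 𝒲.sp (Sum.inr l)) (h : 𝒲.dev l z ≠ 0) :
    𝒲.w (Sum.inl a) z ≠ 0 := by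
  intro h0
  have h1 : 𝒲.edgeProd l z = 0 := by
    by_contra h'
    exact ne_zero_of_edgeProd_ne_zero ha h' h0
  have h2 : 𝒲.w (Sum.inr l) z = 0 := by
    by_contra h'
    exact 𝒲.supp a l z ha h' h0
  exact h (by rw [dev, h1, h2]; ring)

variable [Fintype K] [Fintype J] [DecidableEq J] [Fintype Ω] [Nonempty Ω] [DecidableEq ι]
  {𝒲 : WeightSystem K Ω E L} {c : Config K J (E ⊕ L) ι} {I : Finset ι}

/-- Counting copies of a hypergraph: the normalised edge and face weights satisfy the linear forms
condition. The faces are replaced by their densities in increasing order of the densities, so that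
the error, which is small in terms of the density of the face being replaced, is also small in
terms of the densities of the faces still present. -/
theorem abs_expect_sub_one_le {b p : ℝ} (hb : 0 ≤ b)
    (h2 : ∀ a : E, boxE (𝒲.sp (Sum.inl a)) (fun z => 𝒲.w (Sum.inl a) z - 𝒲.d (Sum.inl a)) ≤ b ^ 4)
    (hp : 0 < p) (hpd : ∀ a : E, p ≤ 𝒲.d (Sum.inl a)) {η : L → ℝ} (hη : ∀ l, 0 ≤ η l)
    (h3 : ∀ l : L, boxE (𝒲.sp (Sum.inr l)) (𝒲.dev l) ≤
      η l * boxE (𝒲.sp (Sum.inr l)) (𝒲.edgeProd l))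
    {nE nF : ℕ} {θ ζ : ℝ} (hθ : (4 * nE : ℕ) * b / p ^ (4 * nE) ≤ θ) (hθ1 : θ ≤ 1) (hζ : 0 ≤ ζ)
    (hnum : ∀ l : L, 2 ^ 8 * (2 * η l + 2 * √(2 * θ)) ≤ (ζ * 𝒲.d (Sum.inr l) ^ nF) ^ 8)
    (hI : Set.InjOn (c.verts 𝒲.sp) I)
    (hcl : ∀ k ∈ I, ∀ a : E, 𝒲.sp (Sum.inl a) ⊆ 𝒲.sp (c.base k) →
      ∃ i ∈ I, c.base i = Sum.inl a ∧ ∀ k' ∈ 𝒲.sp (Sum.inl a), c.v i k' = c.v k k')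
    (hnE : (I.filter fun i => (c.base i).isLeft).card ≤ nE)
    (hnF : (I.filter fun i => ¬ (c.base i).isLeft).card ≤ nF) :
    |(𝔼 x : J → Ω, ∏ i ∈ I, 𝒲.nw (c.base i) (x ∘ c.v i)) - 1| ≤ θ + nF * ζ := by
  classical
  have hθ0 : 0 ≤ θ := le_trans (by positivity) hθ
  set Ie := I.filter fun i => (c.base i).isLeft with hIe
  set If := I.filter fun i => ¬ (c.base i).isLeft with hIf
  have memIe : ∀ {i}, i ∈ Ie → ∃ a, c.base i = Sum.inl a := fun hi =>
    Sum.isLeft_iff.1 (Finset.mem_filter.1 hi).2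
  have memIf : ∀ {i}, i ∈ If → ∃ l, c.base i = Sum.inr l := fun {i} hi => by
    have := (Finset.mem_filter.1 hi).2
    rwa [Sum.not_isLeft, Sum.isRight_iff] at this
  have hdisj : ∀ {F : Finset ι}, F ⊆ If → Disjoint Ie F := fun hF =>
    Finset.disjoint_of_subset_right hF (Finset.disjoint_filter_filter_not _ _ _)
  suffices main : ∀ F : Finset ι, F ⊆ If →
      |(𝔼 x : J → Ω, ∏ i ∈ Ie ∪ F, 𝒲.nw (c.base i) (x ∘ c.v i)) - 1| ≤ θ + F.card * ζ by
    have h := main If Finset.Subset.rfl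
    rw [Finset.filter_union_filter_not_eq] at h
    refine h.trans (add_le_add le_rfl (mul_le_mul_of_nonneg_right ?_ hζ))
    exact_mod_cast hnF
  intro F
  induction F using Finset.induction_on_min_value (f := fun i => 𝒲.d (c.base i)) with
  | empty =>
    intro _
    rw [Finset.union_empty, Finset.card_empty]
    simp only [Nat.cast_zero, zero_mul, add_zero]
    refine (abs_expect_edges_sub_one_le hb h2 hp hpd (n := 4 * nE) (hnE.trans (by omega))
      (hI.mono (Finset.coe_subset.2 (Finset.filter_subset _ _))) fun i hi => memIe hi).trans hθ
  | insert k₀ F hk₀ hmin ih =>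
    intro hF
    have hFI : F ⊆ If := (Finset.subset_insert _ _).trans hF
    have hk₀f : k₀ ∈ If := hF (Finset.mem_insert_self _ _)
    have hk₀I : k₀ ∈ I := (Finset.mem_filter.1 hk₀f).1
    obtain ⟨l, hl⟩ := memIf hk₀f
    have ih' := ih hFI
    set γ : ι → (K → Ω) → ℝ := fun i => if i = k₀ then 𝒲.dev l else
      if (c.base i).isLeft then 𝒲.nw (c.base i) else 𝒲.w (c.base i) with hγ
    set μ : ι → (K → Ω) → ℝ := fun i =>
      if (c.base i).isLeft then 𝒲.nw (c.base i) else fun _ => 1 with hμ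
    have hk₀l : ¬ (c.base k₀).isLeft := by simp [hl]
    have γ0 : γ k₀ = 𝒲.dev l := by simp [hγ]
    have μ0 : μ k₀ = fun _ => 1 := by simp [hμ, hl]
    have γe : ∀ i ∈ Ie, γ i = 𝒲.nw (c.base i) := fun i hi => by
      have h1 := (Finset.mem_filter.1 hi).2
      have : i ≠ k₀ := by rintro rfl; exact hk₀l h1
      simp [hγ, this, h1]
    have γf : ∀ i ∈ F, γ i = 𝒲.w (c.base i) := fun i hi => by
      have : i ≠ k₀ := by rintro rfl; exact hk₀ hi
      obtain ⟨l', hl'⟩ := memIf (hFI hi)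
      simp [hγ, this, hl']
    have hsubI : Ie ∪ insert k₀ F ⊆ I :=
      Finset.union_subset (Finset.filter_subset _ _) (hF.trans (Finset.filter_subset _ _))
    have hI' := hI.mono (Finset.coe_subset.2 hsubI)
    have hlin : LinearForms (Ie ∪ insert k₀ F) (c.verts 𝒲.sp) (fun i x => μ i (x ∘ c.v i)) θ := by
      intro P hP _
      have e1 : ∀ x : J × Bool → Ω, ∏ q ∈ P, μ q.1 (select x q.2 ∘ c.v q.1)
          = ∏ q ∈ P with (c.base q.1).isLeft, 𝒲.nw (c.double.base q) (x ∘ c.double.v q) := by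
        intro x
        rw [Finset.prod_filter]
        refine Finset.prod_congr rfl fun q _ => ?_
        simp only [hμ]
        split_ifs <;> rfl
      simp only [e1]
      have hP' : ∀ q ∈ P.filter fun q => (c.base q.1).isLeft,
          q.1 ∈ Ie ∪ insert k₀ F ∧ q.2 ⊆ c.verts 𝒲.sp q.1 := fun q hq =>
        hP q (Finset.mem_filter.1 hq).1
      refine (abs_expect_edges_sub_one_le hb h2 hp hpd (n := 4 * nE) ?_
        (Config.double_injOn hI' hP') fun q hq => ?_).trans hθ
      · have hsub : (P.filter fun q => (c.base q.1).isLeft) ⊆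
            Ie.sigma fun i => (c.verts 𝒲.sp i).powerset := by
          rintro ⟨i, s⟩ hq
          have h1 := hP' _ hq
          simp only [Finset.mem_filter, Finset.mem_sigma, Finset.mem_powerset, hIe] at hq h1 ⊢
          exact ⟨⟨hsubI h1.1, hq.2⟩, h1.2⟩
        refine (Finset.card_le_card hsub).trans ?_
        rw [Finset.card_sigma, Finset.sum_congr rfl (g := fun _ => 4)]
        · rw [Finset.sum_const, smul_eq_mul]; omega
        · intro i hi
          obtain ⟨a, ha⟩ := memIe hi
          rw [Finset.card_powerset, c.card_verts, ha, 𝒲.card_edge]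
          norm_num
      · exact Sum.isLeft_iff.1 (Finset.mem_filter.1 hq).2
    have key := abs_expect_face_pow_le (𝒲 := 𝒲) (c := c) (I := Ie ∪ insert k₀ F) (γ := γ) (μ := μ)
      (fun i _ => by
        simp only [hγ]
        split_ifs with h h'
        · subst h
          rw [hl]
          exact 𝒲.dev_dependsOn l
        · exact 𝒲.nw_dependsOn _
        · exact 𝒲.dependsOn _)
      (fun i _ => by
        simp only [hμ]
        split_ifs
        · exact 𝒲.nw_dependsOn _
        · exact fun _ _ _ => rfl)
      (fun i _ z => by
        simp only [hγ, hμ]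
        split_ifs with h h' h'
        · subst h
          exact absurd h' hk₀l
        · exact 𝒲.abs_dev_le_one l z
        · exact (abs_of_nonneg (𝒲.nw_nonneg _ _)).le
        · rw [abs_of_nonneg (𝒲.nonneg _ _)]
          exact 𝒲.le_one _ _)
      hθ0 hθ1 hlin hI' (i₀ := k₀) (by simp) hl
      (fun i _ a ha => by simp [hμ, ha])
      (h := 𝒲.edgeProd l) (𝒲.edgeProd_nonneg l) (fun z => by rw [μ0]; exact 𝒲.edgeProd_le_one l z)
      (fun a z ha h => ne_zero_of_dev_ne_zero ha (by rwa [γ0] at h))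
      (fun a z ha h => ne_zero_of_edgeProd_ne_zero ha h) (hη l) (by rw [γ0]; exact h3 l)
    have hX : |𝔼 x : J → Ω, ∏ i ∈ Ie ∪ insert k₀ F, γ i (x ∘ c.v i)|
        ≤ ζ * 𝒲.d (Sum.inr l) ^ nF :=
      le_of_pow_le_pow_left₀ (n := 8) (by norm_num)
        (mul_nonneg hζ (pow_nonneg (𝒲.d_pos _).le _)) (key.trans (hnum l))
    set R := ∏ i ∈ insert k₀ F, 𝒲.d (c.base i) with hR
    have hR0 : 0 < R := Finset.prod_pos fun i _ => 𝒲.d_pos _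
    have hRle : 𝒲.d (Sum.inr l) ^ nF ≤ R := by
      calc 𝒲.d (Sum.inr l) ^ nF ≤ 𝒲.d (Sum.inr l) ^ (insert k₀ F).card :=
            pow_le_pow_of_le_one (𝒲.d_pos _).le (𝒲.d_le_one _)
              ((Finset.card_le_card hF).trans hnF)
        _ = ∏ _i ∈ insert k₀ F, 𝒲.d (Sum.inr l) := by rw [Finset.prod_const]
        _ ≤ R := Finset.prod_le_prod (fun _ _ => (𝒲.d_pos _).le) fun i hi => by
            rcases Finset.mem_insert.1 hi with rfl | hi
            · rw [hl]
            · rw [← hl]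
              exact hmin i hi
    have hdiff : (𝔼 x : J → Ω, ∏ i ∈ Ie ∪ insert k₀ F, 𝒲.nw (c.base i) (x ∘ c.v i))
        = (𝔼 x : J → Ω, ∏ i ∈ Ie ∪ F, 𝒲.nw (c.base i) (x ∘ c.v i))
          + (𝔼 x : J → Ω, ∏ i ∈ Ie ∪ insert k₀ F, γ i (x ∘ c.v i)) / R := by
      rw [Finset.expect_div, ← Finset.expect_add_distrib]
      refine Finset.expect_congr rfl fun x _ => ?_
      rw [Finset.prod_union (hdisj hF), Finset.prod_union (hdisj hFI),
        Finset.prod_union (hdisj hF), Finset.prod_insert hk₀, Finset.prod_insert hk₀, hR,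
        Finset.prod_insert hk₀, γ0, hl,
        Finset.prod_congr rfl fun i hi => congrFun (γe i hi) (x ∘ c.v i),
        Finset.prod_congr rfl fun i hi => congrFun (γf i hi) (x ∘ c.v i)]
      have hF' : ∏ i ∈ F, 𝒲.nw (c.base i) (x ∘ c.v i)
          = (∏ i ∈ F, 𝒲.w (c.base i) (x ∘ c.v i)) / ∏ i ∈ F, 𝒲.d (c.base i) := by
        simp only [nw, Finset.prod_div_distrib]
      rw [hF']
      have hd1 := (𝒲.d_pos (Sum.inr l)).ne'
      have hd2 : ∏ i ∈ F, 𝒲.d (c.base i) ≠ 0 := (Finset.prod_pos fun i _ => 𝒲.d_pos _).ne'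
      by_cases hz : ∏ i ∈ Ie, 𝒲.nw (c.base i) (x ∘ c.v i) = 0
      · rw [hz]; simp
      have hone : 𝒲.edgeProd l (x ∘ c.v k₀) = 1 := by
        refine Finset.prod_eq_one fun a ha => 𝒲.eq_one ?_
        obtain ⟨i, hi, hia, hiv⟩ := hcl k₀ hk₀I a (by rw [hl]; exact (Finset.mem_filter.1 ha).2)
        have h1 : 𝒲.nw (c.base i) (x ∘ c.v i) ≠ 0 :=
          Finset.prod_ne_zero_iff.1 hz i (Finset.mem_filter.2 ⟨hi, by simp [hia]⟩)
        rw [nw, hia] at h1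
        have h2 : 𝒲.w (Sum.inl a) (x ∘ c.v i) ≠ 0 := fun h => h1 (by rw [h, zero_div])
        rwa [𝒲.dependsOn (Sum.inl a) (y := x ∘ c.v k₀) fun k hk => by
          rw [Function.comp_apply, Function.comp_apply, hiv k (by simpa using hk)]] at h2
      rw [dev, hone, nw]
      field_simp
      ring
    rw [hdiff, Finset.card_insert_of_notMem hk₀]
    push_cast
    have hlast : |(𝔼 x : J → Ω, ∏ i ∈ Ie ∪ insert k₀ F, γ i (x ∘ c.v i)) / R| ≤ ζ := by
      rw [abs_div, abs_of_pos hR0, div_le_iff₀ hR0]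
      exact hX.trans (mul_le_mul_of_nonneg_left hRle hζ)
    rw [abs_le] at ih' hlast ⊢
    constructor <;> linarith [ih'.1, ih'.2, hlast.1, hlast.2]

end WeightSystem

/-! ### Counting in a single simplex -/

/-- The configuration with one vertex of each colour and one copy of each element of `B`. -/
def Config.self (K B : Type*) : Config K K B B where
  col := id
  base := id
  v _ := id
  col_v _ _ := rfl

theorem Config.self_verts {K B : Type*} [DecidableEq K] (sp : B → Finset K) (b : B) :
    (Config.self K B).verts sp b = sp b := Finset.image_id

namespace WeightSystem

variable {K Ω E L : Type*} [Fintype E] [Fintype L] [DecidableEq E] [DecidableEq L] [DecidableEq K]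
  [Fintype K] [Fintype Ω] [Nonempty Ω] {𝒲 : WeightSystem K Ω E L}

/-- The normalised weights of the simplex satisfy the linear forms condition. -/
theorem linearForms_self {b p : ℝ} (hb : 0 ≤ b)
    (h2 : ∀ a : E, boxE (𝒲.sp (Sum.inl a)) (fun z => 𝒲.w (Sum.inl a) z - 𝒲.d (Sum.inl a)) ≤ b ^ 4)
    (hp : 0 < p) (hpd : ∀ a : E, p ≤ 𝒲.d (Sum.inl a)) {η : L → ℝ} (hη : ∀ l, 0 ≤ η l)
    (h3 : ∀ l : L, boxE (𝒲.sp (Sum.inr l)) (𝒲.dev l) ≤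
      η l * boxE (𝒲.sp (Sum.inr l)) (𝒲.edgeProd l))
    {nE nF : ℕ} (hnE : 4 * Fintype.card E ≤ nE) (hnF : 8 * Fintype.card L ≤ nF)
    {θ ζ : ℝ} (hθ : (4 * nE : ℕ) * b / p ^ (4 * nE) ≤ θ) (hθ1 : θ ≤ 1) (hζ : 0 ≤ ζ)
    (hnum : ∀ l : L, 2 ^ 8 * (2 * η l + 2 * √(2 * θ)) ≤ (ζ * 𝒲.d (Sum.inr l) ^ nF) ^ 8) :
    LinearForms Finset.univ 𝒲.sp 𝒲.nw (θ + nF * ζ) := by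
  intro P hP hcl
  have hI : Set.InjOn ((Config.self K (E ⊕ L)).verts 𝒲.sp) (Finset.univ : Finset (E ⊕ L)) :=
    fun x _ y _ h => 𝒲.sp_injective (by rwa [Config.self_verts, Config.self_verts] at h)
  have hP' : ∀ q ∈ P, q.1 ∈ (Finset.univ : Finset (E ⊕ L)) ∧
      q.2 ⊆ (Config.self K (E ⊕ L)).verts 𝒲.sp q.1 := fun q hq => by
    rw [Config.self_verts]
    exact hP q hq
  have key := abs_expect_sub_one_le (𝒲 := 𝒲) (c := (Config.self K (E ⊕ L)).double) (I := P)
    hb h2 hp hpd hη h3 (nE := nE) (nF := nF) hθ hθ1 hζ hnum (Config.double_injOn hI hP')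
    (by
      rintro ⟨k, s⟩ hk a ha
      refine ⟨⟨Sum.inl a, s ∩ 𝒲.sp (Sum.inl a)⟩, hcl ⟨k, s⟩ hk _ (Finset.mem_univ _) ha, rfl, ?_⟩
      intro k' hk'
      refine Prod.ext rfl ?_
      change decide (k' ∈ s ∩ 𝒲.sp (Sum.inl a)) = decide (k' ∈ s)
      simp [hk'])
    (by
      refine le_trans ?_ hnE
      have hsub : (P.filter fun q => (((Config.self K (E ⊕ L)).double).base q).isLeft) ⊆
          (Finset.univ.image Sum.inl).sigma fun i => (𝒲.sp i).powerset := by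
        rintro ⟨i, s⟩ hq
        simp only [Finset.mem_filter, Finset.mem_sigma, Finset.mem_powerset, Finset.mem_image,
          Finset.mem_univ, true_and] at hq ⊢
        obtain ⟨a, ha⟩ := Sum.isLeft_iff.1 hq.2
        exact ⟨⟨a, ha.symm⟩, (hP _ hq.1).2⟩
      refine (Finset.card_le_card hsub).trans ?_
      rw [Finset.card_sigma, Finset.sum_image fun _ _ _ _ h => Sum.inl_injective h]
      simp only [Finset.card_powerset, 𝒲.card_edge]
      simp [mul_comm])
    (by
      refine le_trans ?_ hnF
      have hsub : (P.filter fun q => ¬ (((Config.self K (E ⊕ L)).double).base q).isLeft) ⊆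
          (Finset.univ.image Sum.inr).sigma fun i => (𝒲.sp i).powerset := by
        rintro ⟨i, s⟩ hq
        simp only [Finset.mem_filter, Finset.mem_sigma, Finset.mem_powerset, Finset.mem_image,
          Finset.mem_univ, true_and] at hq ⊢
        have h1 := hq.2
        rw [Sum.not_isLeft, Sum.isRight_iff] at h1
        obtain ⟨a, ha⟩ := h1
        exact ⟨⟨a, ha.symm⟩, (hP _ hq.1).2⟩
      refine (Finset.card_le_card hsub).trans ?_
      rw [Finset.card_sigma, Finset.sum_image fun _ _ _ _ h => Sum.inr_injective h]
      simp only [Finset.card_powerset, 𝒲.card_face]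
      simp [mul_comm])
  exact key

/-- The count of simplices weighted by functions `α l` which look, in box norm, like `ε` times the
face weights: the functions `α l` are exchanged for `ε • w l` one by one. -/
theorem abs_expect_simplex_sub_le {err : ℝ} (h0 : 0 ≤ err) (h1 : err ≤ 1)
    (hlin : LinearForms Finset.univ 𝒲.sp 𝒲.nw err) {α : L → (K → Ω) → ℝ}
    (dα : ∀ l, DependsOn (α l) (𝒲.sp (Sum.inr l) : Set K)) (hα0 : ∀ l z, 0 ≤ α l z)
    (hα1 : ∀ l z, α l z ≤ 𝒲.w (Sum.inr l) z) {ε : ℝ} (hε0 : 0 ≤ ε) (hε1 : ε ≤ 1) {H : ℝ}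
    (hH : 0 ≤ H) (hbox : ∀ l, boxE (𝒲.sp (Sum.inr l)) (fun z => α l z - ε * 𝒲.w (Sum.inr l) z) ≤
      H * boxE (𝒲.sp (Sum.inr l)) (𝒲.w (Sum.inr l)))
    {θ : ℝ} (hθ : 0 ≤ θ) (hnum : 2 ^ 8 * (2 * H + 2 * √(2 * err)) ≤ θ ^ 8) :
    |(𝔼 z : K → Ω, (∏ a, 𝒲.nw (Sum.inl a) z) * ∏ l, (α l z / 𝒲.d (Sum.inr l)))
      - ε ^ Fintype.card L| ≤ Fintype.card L * θ + err := by
  set β : Finset L → L → (K → Ω) → ℝ := fun S l =>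
    if l ∈ S then fun z => α l z / 𝒲.d (Sum.inr l) else 𝒲.nw (Sum.inr l) with hβ
  set X : Finset L → ℝ := fun S => 𝔼 z : K → Ω, (∏ a, 𝒲.nw (Sum.inl a) z) * ∏ l, β S l z with hX
  have hd : ∀ l, 0 < 𝒲.d (Sum.inr l) := fun l => 𝒲.d_pos _
  have hverts : (Config.self K (E ⊕ L)).verts 𝒲.sp = 𝒲.sp := funext (Config.self_verts _)
  have step : ∀ (S : Finset L) (l₀ : L), l₀ ∉ S → |X (insert l₀ S) - ε * X S| ≤ θ := by
    intro S l₀ hl₀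
    set γ : E ⊕ L → (K → Ω) → ℝ := Sum.elim (fun a => 𝒲.nw (Sum.inl a)) fun l =>
      if l = l₀ then fun z => (α l z - ε * 𝒲.w (Sum.inr l) z) / 𝒲.d (Sum.inr l) else β S l with hγ
    have hw : ∀ z, |α l₀ z - ε * 𝒲.w (Sum.inr l₀) z| ≤ 𝒲.w (Sum.inr l₀) z := by
      intro z
      have := hα0 l₀ z
      have := hα1 l₀ z
      have h3 := 𝒲.nonneg (Sum.inr l₀) z
      rw [abs_le]
      constructor <;> nlinarith
    have key := abs_expect_face_pow_le (𝒲 := 𝒲) (c := Config.self K (E ⊕ L))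
      (I := Finset.univ) (γ := γ) (μ := 𝒲.nw)
      (by
        rintro (a | l) _
        · exact 𝒲.nw_dependsOn (Sum.inl a)
        · intro x y h
          have h4 := dα l h
          have h5 := 𝒲.dependsOn (Sum.inr l) h
          have h6 := 𝒲.nw_dependsOn (Sum.inr l) h
          simp only [hγ, hβ, Sum.elim_inr]
          split_ifs <;> simp only [h4, h5, h6])
      (fun b _ => 𝒲.nw_dependsOn b)
      (by
        rintro (a | l) _ z
        · exact (abs_of_nonneg (𝒲.nw_nonneg _ _)).le
        · simp only [hγ, hβ, Sum.elim_inr]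
          split_ifs with h h'
          · subst h
            rw [abs_div, abs_of_pos (hd _)]
            exact div_le_div_of_nonneg_right (hw z) (hd _).le
          · rw [abs_of_nonneg (div_nonneg (hα0 _ _) (hd _).le)]
            exact div_le_div_of_nonneg_right (hα1 l z) (hd _).le
          · exact (abs_of_nonneg (𝒲.nw_nonneg _ _)).le)
      h0 h1 (by rw [hverts]; exact hlin)
      (by rw [hverts]; exact 𝒲.sp_injective.injOn)
      (i₀ := Sum.inr l₀) (Finset.mem_univ _) (l := l₀) rfl
      (fun i _ a ha => congrArg 𝒲.nw ha)
      (h := 𝒲.nw (Sum.inr l₀)) (𝒲.nw_nonneg _) (fun z => le_rfl)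
      (fun a z ha h => by
        simp only [hγ, Sum.elim_inr, if_true] at h
        refine 𝒲.supp a l₀ z ha fun hz => h ?_
        have := hw z
        rw [hz, abs_nonpos_iff] at this
        rw [hz, this, zero_div])
      (fun a z ha h => 𝒲.supp a l₀ z ha fun hz => h (by rw [nw, hz, zero_div]))
      hH
      (by
        have e1 : γ (Sum.inr l₀) =
            fun z => (α l₀ z - ε * 𝒲.w (Sum.inr l₀) z) / 𝒲.d (Sum.inr l₀) := by
          simp [hγ]
        have e2 : 𝒲.nw (Sum.inr l₀) = fun z => 𝒲.w (Sum.inr l₀) z / 𝒲.d (Sum.inr l₀) := rfl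
        rw [e1, e2, boxE_div, boxE_div, ← mul_div_assoc]
        exact div_le_div_of_nonneg_right (hbox l₀) (pow_nonneg (hd l₀).le _))
    have hE : |𝔼 z : K → Ω, ∏ b, γ b z| ≤ θ :=
      le_of_pow_le_pow_left₀ (n := 8) (by norm_num) hθ (key.trans hnum)
    refine le_of_eq_of_le (congrArg _ ?_) hE
    simp only [hX]
    rw [Finset.mul_expect, ← Finset.expect_sub_distrib]
    refine Finset.expect_congr rfl fun z _ => ?_
    rw [Fintype.prod_sum_type, ← Finset.mul_prod_erase Finset.univ _ (Finset.mem_univ l₀),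
      ← Finset.mul_prod_erase Finset.univ (fun l => β S l z) (Finset.mem_univ l₀),
      ← Finset.mul_prod_erase Finset.univ (fun l => γ (Sum.inr l) z) (Finset.mem_univ l₀)]
    have r1 : ∏ l ∈ Finset.univ.erase l₀, β (insert l₀ S) l z
        = ∏ l ∈ Finset.univ.erase l₀, β S l z :=
      Finset.prod_congr rfl fun l hl => by simp [hβ, Finset.ne_of_mem_erase hl]
    have r2 : ∏ l ∈ Finset.univ.erase l₀, γ (Sum.inr l) z
        = ∏ l ∈ Finset.univ.erase l₀, β S l z :=
      Finset.prod_congr rfl fun l hl => by simp [hγ, Finset.ne_of_mem_erase hl]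
    rw [r1, r2]
    have s1 : β (insert l₀ S) l₀ z = α l₀ z / 𝒲.d (Sum.inr l₀) := by simp [hβ]
    have s2 : β S l₀ z = 𝒲.w (Sum.inr l₀) z / 𝒲.d (Sum.inr l₀) := by simp [hβ, hl₀, nw]
    have s3 : γ (Sum.inr l₀) z =
        (α l₀ z - ε * 𝒲.w (Sum.inr l₀) z) / 𝒲.d (Sum.inr l₀) := by simp [hγ]
    rw [s1, s2, s3]
    simp only [hγ, Sum.elim_inl]
    ring
  have hybrid : ∀ S : Finset L, |X S - ε ^ S.card * X ∅| ≤ S.card * θ := by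
    intro S
    induction S using Finset.induction_on with
    | empty => simp
    | insert l₀ S hl₀ ih =>
      have hs := step S l₀ hl₀
      rw [Finset.card_insert_of_notMem hl₀]
      have : X (insert l₀ S) - ε ^ (S.card + 1) * X ∅ =
          (X (insert l₀ S) - ε * X S) + ε * (X S - ε ^ S.card * X ∅) := by ring
      rw [this]
      refine (abs_add_le _ _).trans ?_
      rw [abs_mul, abs_of_nonneg hε0]
      have h5 : ε * |X S - ε ^ S.card * X ∅| ≤ 1 * (S.card * θ) :=
        mul_le_mul hε1 ih (abs_nonneg _) zero_le_one
      push_cast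
      linarith
  have hX0 : |X ∅ - 1| ≤ err := by
    have h2 := hlin (Finset.univ.sigma fun _ => {∅})
      (fun q hq => by
        simp only [Finset.mem_sigma, Finset.mem_singleton] at hq
        exact ⟨Finset.mem_univ _, by rw [hq.2]; exact Finset.empty_subset _⟩)
      (fun q hq i _ _ => by
        simp only [Finset.mem_sigma, Finset.mem_singleton, Finset.mem_univ, true_and] at hq ⊢
        rw [hq, Finset.empty_inter])
    refine le_of_eq_of_le (congrArg (fun t => |t - 1|) ?_) h2
    simp only [hX]
    rw [← expect_comp_injective (Ω := Ω) (f := fun v : K => (v, false))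
      (fun a b hab => (Prod.mk.inj hab).1)]
    refine Finset.expect_congr rfl fun x _ => ?_
    rw [Finset.prod_sigma, Fintype.prod_sum_type]
    simp only [Finset.prod_singleton, hβ, Finset.notMem_empty, if_false]
    rfl
  have hXu := hybrid Finset.univ
  rw [Finset.card_univ] at hXu
  have e1 : X Finset.univ =
      𝔼 z : K → Ω, (∏ a, 𝒲.nw (Sum.inl a) z) * ∏ l, (α l z / 𝒲.d (Sum.inr l)) := by
    simp [hX, hβ]
  rw [e1] at hXu
  have hpow : |ε ^ Fintype.card L * X ∅ - ε ^ Fintype.card L| ≤ err := by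
    have : ε ^ Fintype.card L * X ∅ - ε ^ Fintype.card L = ε ^ Fintype.card L * (X ∅ - 1) := by ring
    rw [this, abs_mul, abs_of_nonneg (pow_nonneg hε0 _)]
    calc _ ≤ 1 * err := mul_le_mul (pow_le_one₀ hε0 hε1) hX0 (abs_nonneg _) zero_le_one
      _ = err := one_mul _
  rw [abs_le] at hXu hpow ⊢
  constructor <;> linarith [hXu.1, hXu.2, hpow.1, hpow.2]

end WeightSystem

/-! ### The weight system of a `T`-system -/

/-- The pairs `j < k` of indices. -/
abbrev Edge : Type := {p : Fin 4 × Fin 4 // p.1 < p.2}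

/-- The coordinates on which the `R_{j,k}` and the faces depend. -/
def faceSpan : Edge ⊕ Fin 4 → Finset (Fin 4) :=
  Sum.elim (fun p => {p.1.1, p.1.2}) fun l => {l.succAbove 0, l.succAbove 1, l.succAbove 2}

theorem mem_faceSpan_inr {l j : Fin 4} : j ∈ faceSpan (Sum.inr l) ↔ j ≠ l := by
  revert l j
  decide

theorem faceSpan_injective : Function.Injective faceSpan := by decide

/-- The point of `G × G × G` whose coordinates `x ⬝ e_j`, `j ≠ l`, are the `y j`. -/
def facePt {G : Type*} [AddCommGroup G] (l : Fin 4) (y : Fin 4 → G) : G × G × G :=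
  ofCoords l (y (l.succAbove 0)) (y (l.succAbove 1)) (y (l.succAbove 2))

theorem coord_facePt {G : Type*} [AddCommGroup G] {l j : Fin 4} (h : j ≠ l) (y : Fin 4 → G) :
    coord j (facePt l y) = y j := by
  obtain ⟨i, rfl⟩ := Fin.exists_succAbove_eq h
  have := coord_ofCoords l (y (l.succAbove 0)) (y (l.succAbove 1)) (y (l.succAbove 2))
  fin_cases i
  exacts [this.1, this.2.1, this.2.2]

theorem facePt_coord {G : Type*} [AddCommGroup G] (l : Fin 4) (x : G × G × G) :
    facePt l (fun j => coord j x) = x := ofCoords_coord l x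

theorem facePt_congr {G : Type*} [AddCommGroup G] {l : Fin 4} {y y' : Fin 4 → G}
    (h : ∀ j, j ≠ l → y j = y' j) : facePt l y = facePt l y' := by
  rw [facePt, facePt, h _ (Fin.succAbove_ne l 0), h _ (Fin.succAbove_ne l 1),
    h _ (Fin.succAbove_ne l 2)]

theorem ind_zero_or_one {α : Type*} [DecidableEq α] (A : Finset α) (x : α) :
    ind A x = 0 ∨ ind A x = 1 := by
  unfold ind
  split_ifs <;> simp

theorem ind_ne_zero {α : Type*} [DecidableEq α] {A : Finset α} {x : α} :
    ind A x ≠ 0 ↔ x ∈ A := by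
  unfold ind
  split_ifs with h <;> simp [h]

theorem ind_of_mem {α : Type*} [DecidableEq α] {A : Finset α} {x : α} (h : x ∈ A) :
    ind A x = 1 := if_pos h

theorem ind_nonneg {α : Type*} [DecidableEq α] (A : Finset α) (x : α) : 0 ≤ ind A x := by
  rcases ind_zero_or_one A x with h | h <;> simp [h]

theorem prob_nonneg {α : Type*} [DecidableEq α] (A B : Finset α) : 0 ≤ prob A B := by
  unfold prob; positivity

theorem prob_le_one {α : Type*} [DecidableEq α] (A B : Finset α) : prob A B ≤ 1 := by
  unfold prob
  exact div_le_one_of_le₀ (by exact_mod_cast Finset.card_le_card Finset.inter_subset_right)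
    (by positivity)

variable {G : Type*} [AddCommGroup G] [DecidableEq G]

namespace TSystem

/-- Choices of one point in each of the sets `S_j`. In the counting arguments every vertex carries
such a choice, of which only the entry with the colour of the vertex is used: the variables then
all have the same type. -/
abbrev Pts (𝒯 : TSystem G) : Type _ := ∀ j : Fin 4, {x // x ∈ 𝒯.S j}

/-- The diagonal entries of a family of choices. -/
def diag (𝒯 : TSystem G) (z : Fin 4 → 𝒯.Pts) (j : Fin 4) : G := (z j j : G)

theorem coord_mem (𝒯 : TSystem G) {x : G × G × G} (hx : x ∈ 𝒯.T) (j : Fin 4) :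
    coord j x ∈ 𝒯.S j := by
  have key : ∀ j k, j < k → coord j x ∈ 𝒯.S j ∧ coord k x ∈ 𝒯.S k := fun j k h =>
    Finset.mem_product.1 (𝒯.R_subset j k h (𝒯.T_subset j k h x hx))
  by_cases h : j < 3
  · exact (key j 3 h).1
  · have : j = 3 := by omega
    subst this
    exact (key 0 3 (by decide)).2

variable [Fintype G]

theorem mem_Tface {𝒯 : TSystem G} {l : Fin 4} {x : G × G × G} : x ∈ 𝒯.Tface l ↔
    ∀ j k, j < k → j ≠ l → k ≠ l → (coord j x, coord k x) ∈ 𝒯.R j k := by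
  simp [Tface]

theorem T_subset_Tface (𝒯 : TSystem G) (l : Fin 4) : 𝒯.T ⊆ 𝒯.Tface l := fun x hx =>
  mem_Tface.2 fun j k h _ _ => 𝒯.T_subset j k h x hx

theorem coord_mem_of_mem_Tface {𝒯 : TSystem G} {l : Fin 4} {x : G × G × G} (hx : x ∈ 𝒯.Tface l)
    {j : Fin 4} (hj : j ≠ l) : coord j x ∈ 𝒯.S j := by
  rw [mem_Tface] at hx
  have h1 : ∀ l j : Fin 4, j ≠ l → ∃ k, k ≠ l ∧ (j < k ∨ k < j) := by decide
  obtain ⟨k, hk, h | h⟩ := h1 l j hj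
  · exact (Finset.mem_product.1 (𝒯.R_subset j k h (hx j k h hj hk))).1
  · exact (Finset.mem_product.1 (𝒯.R_subset k j h (hx k j h hk hj))).2

/-- The weight system given by the indicator functions of the `R_{j,k}` and of `T`. -/
noncomputable def weights (𝒯 : TSystem G) (hR : ∀ p : Edge, 0 < 𝒯.densR p.1.1 p.1.2)
    (hT : ∀ l, 0 < 𝒯.densT l) : WeightSystem (Fin 4) 𝒯.Pts Edge (Fin 4) where
  sp := faceSpan
  w := Sum.elim (fun p z => ind (𝒯.R p.1.1 p.1.2) (𝒯.diag z p.1.1, 𝒯.diag z p.1.2))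
    fun l z => ind 𝒯.T (facePt l (𝒯.diag z))
  d := Sum.elim (fun p => 𝒯.densR p.1.1 p.1.2) 𝒯.densT
  sp_injective := faceSpan_injective
  card_edge := by decide
  card_face := by decide
  dependsOn := by
    rintro (p | l) z z' h
    · have h1 := h p.1.1 (by simp [faceSpan])
      have h2 := h p.1.2 (by simp [faceSpan])
      simp only [Sum.elim_inl, diag, h1, h2]
    · refine congrArg (ind 𝒯.T) (facePt_congr fun j hj => ?_)
      simp only [diag]
      rw [h j (mem_faceSpan_inr.2 hj)]
  zero_or_one := by
    rintro (p | l) z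
    · exact ind_zero_or_one _ _
    · exact ind_zero_or_one _ _
  d_pos := by
    rintro (p | l)
    · exact hR p
    · exact hT l
  d_le_one := by
    rintro (p | l)
    · exact prob_le_one _ _
    · exact prob_le_one _ _
  supp := by
    intro p l z hsub h
    simp only [Sum.elim_inr, Sum.elim_inl, ind_ne_zero] at h ⊢
    have h1 := mem_faceSpan_inr.1 (hsub (by simp [faceSpan] : p.1.1 ∈ faceSpan (Sum.inl p)))
    have h2 := mem_faceSpan_inr.1 (hsub (by simp [faceSpan] : p.1.2 ∈ faceSpan (Sum.inl p)))
    have := 𝒯.T_subset _ _ p.2 _ h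
    rwa [coord_facePt h1, coord_facePt h2] at this

theorem edgeProd_weights (𝒯 : TSystem G) (hR : ∀ p : Edge, 0 < 𝒯.densR p.1.1 p.1.2)
    (hT : ∀ l, 0 < 𝒯.densT l) (l : Fin 4) (z : Fin 4 → 𝒯.Pts) :
    (𝒯.weights hR hT).edgeProd l z = ind (𝒯.Tface l) (facePt l (𝒯.diag z)) := by
  have hspan : ∀ p : Edge, faceSpan (Sum.inl p) ⊆ faceSpan (Sum.inr l) ↔
      p.1.1 ≠ l ∧ p.1.2 ≠ l := by
    intro p
    simp only [Finset.subset_iff, mem_faceSpan_inr]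
    simp [faceSpan]
  by_cases h : facePt l (𝒯.diag z) ∈ 𝒯.Tface l
  · rw [ind_of_mem h]
    refine Finset.prod_eq_one fun p hp => ind_of_mem ?_
    have h1 := (hspan p).1 (Finset.mem_filter.1 hp).2
    have := mem_Tface.1 h _ _ p.2 h1.1 h1.2
    rwa [coord_facePt h1.1, coord_facePt h1.2] at this
  · have h0 : ind (𝒯.Tface l) (facePt l (𝒯.diag z)) = 0 := if_neg h
    rw [h0]
    rw [mem_Tface] at h
    push Not at h
    obtain ⟨j, k, hjk, hj, hk, hn⟩ := h
    rw [coord_facePt hj, coord_facePt hk] at hn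
    refine Finset.prod_eq_zero (i := ⟨(j, k), hjk⟩) ?_ (if_neg hn)
    exact Finset.mem_filter.2 ⟨Finset.mem_univ _, (hspan _).2 ⟨hj, hk⟩⟩

end TSystem

/-! ### Box norms as averages over doubled points -/

theorem expect_fin_succ {Ω : Type*} [Fintype Ω] {n : ℕ} (F : (Fin (n + 1) → Ω) → ℝ) :
    𝔼 y : Fin (n + 1) → Ω, F y = 𝔼 a : Ω, 𝔼 y : Fin n → Ω, F (Fin.cons a y) := by
  rw [← Finset.expect_product', Finset.univ_product_univ]
  exact Fintype.expect_equiv (Fin.consEquiv fun _ => Ω).symm _ _ fun y => by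
    simp [Fin.consEquiv]

namespace TSystem

/-- The average over `Pts` of a function of one coordinate. -/
theorem expect_pts (𝒯 : TSystem G) [Nonempty 𝒯.Pts] (j : Fin 4) (F : {x // x ∈ 𝒯.S j} → ℝ) :
    𝔼 ω : 𝒯.Pts, F (ω j) = 𝔼 a : {x // x ∈ 𝒯.S j}, F a := by
  have : Nonempty (∀ i : {i // i ≠ j}, {x // x ∈ 𝒯.S i}) :=
    ⟨fun i => (Classical.arbitrary 𝒯.Pts) i⟩
  have h1 : 𝔼 ω : 𝒯.Pts, F (ω j) = 𝔼 p : {x // x ∈ 𝒯.S j} × ∀ i : {i // i ≠ j}, {x // x ∈ 𝒯.S i},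
      F p.1 :=
    Fintype.expect_equiv (Equiv.piSplitAt j fun i => {x // x ∈ 𝒯.S i}) _ _ fun ω => rfl
  rw [h1, ← Finset.univ_product_univ, Finset.expect_product]
  simp

end TSystem

theorem expect_coe_subtype {α : Type*} (S : Finset α) (F : α → ℝ) :
    𝔼 a : {x // x ∈ S}, F a = 𝔼 a ∈ S, F a := by
  rw [Finset.expect_eq_sum_div_card, Finset.expect_eq_sum_div_card, Finset.card_univ,
    Fintype.card_coe, ← Finset.sum_coe_sort S]

/-- The average of a function supported in `S`. -/
theorem expect_of_support {α : Type*} [Fintype α] [DecidableEq α] (S : Finset α) (F : α → ℝ)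
    (hF : ∀ a ∉ S, F a = 0) :
    𝔼 a, F a = prob S Finset.univ * 𝔼 a : {x // x ∈ S}, F a := by
  rw [expect_coe_subtype, Finset.expect_eq_sum_div_card, Finset.expect_eq_sum_div_card, prob,
    Finset.inter_univ]
  have h1 : ∑ a, F a = ∑ a ∈ S, F a :=
    (Finset.sum_subset (Finset.subset_univ S) fun a _ ha => hF a ha).symm
  rw [h1]
  rcases S.eq_empty_or_nonempty with rfl | hS
  · simp
  · have : (S.card : ℝ) ≠ 0 := by exact_mod_cast hS.card_pos.ne'
    field_simp

/-- The iterated average of `Φ` over `S 0 × ⋯ × S (n - 1)`. -/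
noncomputable def iterExpect {α : Type*} : (n : ℕ) → (Fin n → Finset α) → ((Fin n → α) → ℝ) → ℝ
  | 0, _, Φ => Φ ![]
  | n + 1, S, Φ => 𝔼 a ∈ S 0, iterExpect n (fun i => S i.succ) fun v => Φ (Matrix.vecCons a v)

theorem iterExpect_zero_fun {α : Type*} (n : ℕ) (S : Fin n → Finset α) :
    iterExpect n S (fun _ => 0) = 0 := by
  induction n with
  | zero => rfl
  | succ n ih => simp [iterExpect, ih]

/-- Iterated averages of functions supported in a product set. -/
theorem iterExpect_univ_of_support {α : Type*} [Fintype α] [DecidableEq α] {n : ℕ}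
    (S : Fin n → Finset α) (Φ : (Fin n → α) → ℝ) (hΦ : ∀ v, (∃ i, v i ∉ S i) → Φ v = 0) :
    iterExpect n (fun _ => Finset.univ) Φ
      = (∏ i, prob (S i) Finset.univ) * iterExpect n S Φ := by
  induction n with
  | zero => simp [iterExpect]
  | succ n ih =>
    have h1 : ∀ a : α, iterExpect n (fun _ => Finset.univ) (fun v => Φ (Matrix.vecCons a v))
        = (∏ i : Fin n, prob (S i.succ) Finset.univ) *
          iterExpect n (fun i => S i.succ) (fun v => Φ (Matrix.vecCons a v)) := fun a =>
      ih (fun i => S i.succ) _ fun v ⟨i, hi⟩ => hΦ _ ⟨i.succ, by simpa using hi⟩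
    simp only [iterExpect, h1]
    rw [expect_of_support (S 0), Fin.prod_univ_succ, mul_assoc,
      Finset.mul_expect _ _ (∏ i : Fin n, prob (S i.succ) Finset.univ),
      expect_coe_subtype (S 0) fun a => (∏ i : Fin n, prob (S i.succ) Finset.univ) *
        iterExpect n (fun i => S i.succ) fun v => Φ (Matrix.vecCons a v)]
    intro a ha
    have : (fun v => Φ (Matrix.vecCons a v)) = fun _ => 0 :=
      funext fun v => hΦ _ ⟨0, by simpa using ha⟩
    rw [this, iterExpect_zero_fun, mul_zero]

namespace TSystem

theorem expect_pts_eq_iterExpect (𝒯 : TSystem G) [Nonempty 𝒯.Pts] {n : ℕ} (j : Fin n → Fin 4)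
    (Φ : (Fin n → G) → ℝ) :
    𝔼 y : Fin n → 𝒯.Pts, Φ (fun i => (y i (j i) : G)) = iterExpect n (fun i => 𝒯.S (j i)) Φ := by
  induction n with
  | zero =>
    have : ∀ y : Fin 0 → 𝒯.Pts, Φ (fun i => (y i (j i) : G)) = Φ ![] := fun y =>
      congrArg Φ (Subsingleton.elim _ _)
    simp only [this, iterExpect, Fintype.expect_const]
  | succ n ih =>
    rw [expect_fin_succ, iterExpect, ← expect_coe_subtype (𝒯.S (j 0)), ← 𝒯.expect_pts (j 0) fun a =>
      iterExpect n (fun i => 𝒯.S (j i.succ)) fun v => Φ (Matrix.vecCons (a : G) v)]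
    refine Finset.expect_congr rfl fun ω _ => ?_
    rw [← ih fun i => j i.succ]
    refine Finset.expect_congr rfl fun y _ => congrArg Φ ?_
    ext i
    refine Fin.cases ?_ (fun i => ?_) i <;> simp

/-- Averages of functions of finitely many coordinates, attached to distinct vertices. -/
theorem expect_eq_iterExpect (𝒯 : TSystem G) [Nonempty 𝒯.Pts] {J : Type*} [Fintype J]
    [DecidableEq J] {n : ℕ} {p : Fin n → J} (hp : Function.Injective p) (j : Fin n → Fin 4)
    (Φ : (Fin n → G) → ℝ) :
    𝔼 x : J → 𝒯.Pts, Φ (fun i => (x (p i) (j i) : G)) = iterExpect n (fun i => 𝒯.S (j i)) Φ := by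
  rw [← expect_pts_eq_iterExpect]
  exact expect_comp_injective hp (fun y : Fin n → 𝒯.Pts => Φ fun i => (y i (j i) : G))

/-- The product defining the three-dimensional box norm, as a function of six variables. -/
def cube3 {G : Type*} (f : G → G → G → ℝ) (v : Fin 6 → G) : ℝ :=
  f (v 0) (v 2) (v 4) * f (v 0) (v 3) (v 4) * f (v 1) (v 2) (v 4) * f (v 1) (v 3) (v 4) *
    (f (v 0) (v 2) (v 5) * f (v 0) (v 3) (v 5) * f (v 1) (v 2) (v 5) * f (v 1) (v 3) (v 5))

theorem prod_powerset_singleton {α : Type*} [DecidableEq α] (a : α) (f : Finset α → ℝ) :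
    ∏ s ∈ ({a} : Finset α).powerset, f s = f ∅ * f {a} := by
  rw [← insert_empty_eq, Finset.prod_powerset_insert (Finset.notMem_empty a)]
  simp

theorem boxE_pair (𝒯 : TSystem G) [Nonempty 𝒯.Pts] {i j : Fin 4} (hij : i ≠ j) (F : G → G → ℝ) :
    boxE {i, j} (fun z : Fin 4 → 𝒯.Pts => F (𝒯.diag z i) (𝒯.diag z j)) =
      𝔼 x ∈ 𝒯.S i, 𝔼 x' ∈ 𝒯.S i, 𝔼 y ∈ 𝒯.S j, 𝔼 y' ∈ 𝒯.S j,
        F x y * F x y' * F x' y * F x' y' := by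
  have hp : Function.Injective ![(i, false), (i, true), (j, false), (j, true)] := by
    intro a b h
    fin_cases a <;> fin_cases b <;> simp_all
  have key := 𝒯.expect_eq_iterExpect hp ![i, i, j, j]
    (fun v => F (v 0) (v 2) * F (v 0) (v 3) * F (v 1) (v 2) * F (v 1) (v 3))
  refine Eq.trans (Finset.expect_congr rfl fun x _ => ?_) key
  rw [Finset.prod_powerset_insert (by simpa using hij)]
  simp only [prod_powerset_singleton]
  simp [select, diag, hij, hij.symm]
  ring

theorem boxE_triple (𝒯 : TSystem G) [Nonempty 𝒯.Pts] {i j k : Fin 4} (hij : i ≠ j) (hik : i ≠ k)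
    (hjk : j ≠ k) (F : G → G → G → ℝ) :
    boxE {i, j, k} (fun z : Fin 4 → 𝒯.Pts => F (𝒯.diag z i) (𝒯.diag z j) (𝒯.diag z k)) =
      iterExpect 6 (fun n => 𝒯.S (![i, i, j, j, k, k] n)) (cube3 F) := by
  have hp : Function.Injective
      ![(i, false), (i, true), (j, false), (j, true), (k, false), (k, true)] := by
    intro a b h
    fin_cases a <;> fin_cases b <;> simp_all
  have key := 𝒯.expect_eq_iterExpect hp ![i, i, j, j, k, k] (cube3 F)
  refine Eq.trans (Finset.expect_congr rfl fun x _ => ?_) key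
  rw [Finset.prod_powerset_insert (by simp [hij, hik]),
    Finset.prod_powerset_insert (by simpa using hjk),
    Finset.prod_powerset_insert (by simpa using hjk)]
  simp only [prod_powerset_singleton]
  simp [select, diag, cube3, hij, hij.symm, hik, hik.symm, hjk, hjk.symm]
  ring

end TSystem

/-! ### Counting the copies of a single face -/

namespace WeightSystem

variable {K Ω E L : Type*} [Fintype E] [Fintype L] [DecidableEq K] {𝒲 : WeightSystem K Ω E L}

/-- The expected density of the configuration of all the copies `(l, s)`, `s ⊆ C`, of the face
`l`: every edge of the face and the face itself contribute one factor for each of their copies. -/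
noncomputable def faceDens (𝒲 : WeightSystem K Ω E L) (l : L) (C : Finset K) : ℝ :=
  ∏ b : E ⊕ L with 𝒲.sp b ⊆ 𝒲.sp (Sum.inr l), 𝒲.d b ^ 2 ^ (C ∩ 𝒲.sp b).card

theorem faceDens_pos (l : L) (C : Finset K) : 0 < 𝒲.faceDens l C :=
  Finset.prod_pos fun _ _ => pow_pos (𝒲.d_pos _) _

theorem abs_expect_face_sub_le [Fintype K] [Fintype Ω] [DecidableEq L] {err : ℝ}
    (hlin : LinearForms Finset.univ 𝒲.sp 𝒲.nw err) {l : L} {C : Finset K}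
    (hC : C ⊆ 𝒲.sp (Sum.inr l)) :
    |(𝔼 x : K × Bool → Ω, ∏ s ∈ C.powerset, 𝒲.w (Sum.inr l) (select x s)) - 𝒲.faceDens l C|
      ≤ err * 𝒲.faceDens l C := by
  classical
  have h1 := hlin
    ((Finset.univ.filter fun b => 𝒲.sp b ⊆ 𝒲.sp (Sum.inr l)).sigma fun b => (C ∩ 𝒲.sp b).powerset)
    (by
      rintro ⟨b, s⟩ hq
      simp only [Finset.mem_sigma, Finset.mem_powerset] at hq
      exact ⟨Finset.mem_univ _, hq.2.trans Finset.inter_subset_right⟩)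
    (by
      rintro ⟨b, s⟩ hq b' _ hb'
      simp only [Finset.mem_sigma, Finset.mem_powerset, Finset.mem_filter, Finset.mem_univ,
        true_and] at hq hb' ⊢
      exact ⟨hb'.trans hq.1, Finset.inter_subset_inter_right
        (hq.2.trans Finset.inter_subset_left)⟩)
  have hpos := 𝒲.faceDens_pos l C
  have h2 : ∀ x : K × Bool → Ω, ∏ q ∈ (Finset.univ.filter fun b => 𝒲.sp b ⊆
      𝒲.sp (Sum.inr l)).sigma fun b => (C ∩ 𝒲.sp b).powerset, 𝒲.nw q.1 (select x q.2) =
      (∏ s ∈ C.powerset, 𝒲.w (Sum.inr l) (select x s)) / 𝒲.faceDens l C := by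
    intro x
    rw [Finset.prod_sigma]
    simp only [nw, Finset.prod_div_distrib, Finset.prod_const, Finset.card_powerset]
    rw [faceDens]
    congr 1
    rw [← Finset.mul_prod_erase _ _ (Finset.mem_filter.2 ⟨Finset.mem_univ (Sum.inr l),
      Finset.Subset.refl _⟩), Finset.inter_eq_left.2 hC]
    by_cases hz : ∏ s ∈ C.powerset, 𝒲.w (Sum.inr l) (select x s) = 0
    · rw [hz, zero_mul]
    rw [Finset.prod_eq_one (s := Finset.erase _ _), mul_one]
    intro b hb
    simp only [Finset.mem_erase, Finset.mem_filter, Finset.mem_univ, true_and] at hb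
    refine Finset.prod_eq_one fun s hs => 𝒲.eq_one ?_
    have hs' : s ⊆ C := (Finset.mem_powerset.1 hs).trans Finset.inter_subset_left
    have hw := Finset.prod_ne_zero_iff.1 hz s (Finset.mem_powerset.2 hs')
    rcases b with a | l'
    · exact 𝒲.supp a l _ hb.2 hw
    · refine absurd (𝒲.sp_injective (Finset.eq_of_subset_of_card_le hb.2 ?_)) hb.1
      rw [𝒲.card_face, 𝒲.card_face]
  simp only [h2] at h1
  rw [← Finset.expect_div] at h1
  have h3 : (𝔼 x : K × Bool → Ω, ∏ s ∈ C.powerset, 𝒲.w (Sum.inr l) (select x s))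
      - 𝒲.faceDens l C = ((𝔼 x : K × Bool → Ω, ∏ s ∈ C.powerset,
        𝒲.w (Sum.inr l) (select x s)) / 𝒲.faceDens l C - 1) * 𝒲.faceDens l C := by
    field_simp
  rw [h3, abs_mul, abs_of_pos hpos]
  exact mul_le_mul_of_nonneg_right h1 hpos.le

end WeightSystem

/-! ### Translation of the hypotheses -/

theorem le_pow_of_rpow_le {x r p : ℝ} {n : ℕ} (hn : n ≠ 0) (hp : p = (n : ℝ)⁻¹) (hr : 0 ≤ r)
    (h : x ^ p ≤ r) : x ≤ r ^ n := by
  rcases lt_or_ge x 0 with hx | hx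
  · exact hx.le.trans (pow_nonneg hr n)
  · calc x = (x ^ p) ^ n := by rw [hp, Real.rpow_inv_natCast_pow hx hn]
      _ ≤ r ^ n := pow_le_pow_left₀ (Real.rpow_nonneg hx _) h n

theorem succAbove_ne (l : Fin 4) : l.succAbove 0 ≠ l.succAbove 1 ∧
    l.succAbove 0 ≠ l.succAbove 2 ∧ l.succAbove 1 ≠ l.succAbove 2 := by
  revert l; decide

namespace TSystem

theorem boxE_edge_le (𝒯 : TSystem G) [Nonempty 𝒯.Pts] {i j : Fin 4} (hij : i ≠ j) {F : G → G → ℝ}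
    {b : ℝ} (hb : 0 ≤ b) (h : boxNorm2 (𝒯.S i) (𝒯.S j) F ≤ b) :
    boxE {i, j} (fun z : Fin 4 → 𝒯.Pts => F (𝒯.diag z i) (𝒯.diag z j)) ≤ b ^ 4 := by
  rw [𝒯.boxE_pair hij]
  exact le_pow_of_rpow_le (n := 4) (by norm_num) (by norm_num) hb h

/-- A choice of points whose diagonal is the family of coordinates of a point of `T`. -/
theorem exists_diag_eq (𝒯 : TSystem G) {x : G × G × G} (hx : x ∈ 𝒯.T) :
    ∃ ω : 𝒯.Pts, ∀ l, facePt l (𝒯.diag fun _ => ω) = x :=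
  ⟨fun j => ⟨coord j x, 𝒯.coord_mem hx j⟩, fun l => facePt_coord l x⟩

/-- Restricting the box norm to the diagonal in the first variable. -/
theorem diagonal_le (𝒯 : TSystem G) {i j k : Fin 4} (hS : (𝒯.S i).Nonempty) {F h : G → G → G → ℝ}
    {ρ : ℝ} (hρ : 0 ≤ ρ) (hh : ∀ a b c, 0 ≤ h a b c) (hF : ∀ a b c, ρ * h a b c ≤ F a b c ^ 2) :
    ρ ^ 4 * iterExpect 5 (fun n => 𝒯.S (![i, j, j, k, k] n)) (fun v =>
      h (v 0) (v 1) (v 3) * h (v 0) (v 2) (v 3) * (h (v 0) (v 1) (v 4) * h (v 0) (v 2) (v 4))) ≤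
      (𝒯.S i).card * iterExpect 6 (fun n => 𝒯.S (![i, i, j, j, k, k] n)) (cube3 F) := by
  have e6 : iterExpect 6 (fun n => 𝒯.S (![i, i, j, j, k, k] n)) (cube3 F) =
      𝔼 x ∈ 𝒯.S i, 𝔼 x' ∈ 𝒯.S i, 𝔼 y ∈ 𝒯.S j, 𝔼 y' ∈ 𝒯.S j, 𝔼 z ∈ 𝒯.S k, 𝔼 z' ∈ 𝒯.S k,
        F x y z * F x y' z * F x' y z * F x' y' z *
          (F x y z' * F x y' z' * F x' y z' * F x' y' z') := rfl
  have e5 : iterExpect 5 (fun n => 𝒯.S (![i, j, j, k, k] n)) (fun v =>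
      h (v 0) (v 1) (v 3) * h (v 0) (v 2) (v 3) * (h (v 0) (v 1) (v 4) * h (v 0) (v 2) (v 4))) =
      𝔼 x ∈ 𝒯.S i, 𝔼 y ∈ 𝒯.S j, 𝔼 y' ∈ 𝒯.S j, 𝔼 z ∈ 𝒯.S k, 𝔼 z' ∈ 𝒯.S k,
        h x y z * h x y' z * (h x y z' * h x y' z') := rfl
  rw [e5, e6, Finset.mul_expect, Finset.mul_expect]
  refine Finset.expect_le_expect fun x hx => ?_
  have hnn : ∀ x' ∈ 𝒯.S i, 0 ≤ 𝔼 y ∈ 𝒯.S j, 𝔼 y' ∈ 𝒯.S j, 𝔼 z ∈ 𝒯.S k, 𝔼 z' ∈ 𝒯.S k,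
        F x y z * F x y' z * F x' y z * F x' y' z *
          (F x y z' * F x y' z' * F x' y z' * F x' y' z') := by
    intro x' _
    refine Finset.expect_nonneg fun y _ => Finset.expect_nonneg fun y' _ => ?_
    rw [← Finset.expect_mul_expect]
    exact mul_self_nonneg _
  have hcard : ((𝒯.S i).card : ℝ) ≠ 0 := by exact_mod_cast hS.card_pos.ne'
  rw [Finset.expect_eq_sum_div_card (𝒯.S i), mul_div_cancel₀ _ hcard]
  refine le_trans ?_ (Finset.single_le_sum hnn hx)
  rw [Finset.mul_expect]
  refine Finset.expect_le_expect fun y _ => ?_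
  rw [Finset.mul_expect]
  refine Finset.expect_le_expect fun y' _ => ?_
  rw [Finset.mul_expect]
  refine Finset.expect_le_expect fun z _ => ?_
  rw [Finset.mul_expect]
  refine Finset.expect_le_expect fun z' _ => ?_
  have hpos : ∀ a b c, 0 ≤ ρ * h a b c := fun a b c => mul_nonneg hρ (hh a b c)
  calc ρ ^ 4 * (h x y z * h x y' z * (h x y z' * h x y' z'))
      = (ρ * h x y z) * (ρ * h x y' z) * ((ρ * h x y z') * (ρ * h x y' z')) := by ring
    _ ≤ (F x y z ^ 2) * (F x y' z ^ 2) * ((F x y z' ^ 2) * (F x y' z' ^ 2)) := by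
        refine mul_le_mul (mul_le_mul (hF _ _ _) (hF _ _ _) (hpos _ _ _) (by positivity))
          (mul_le_mul (hF _ _ _) (hF _ _ _) (hpos _ _ _) (by positivity))
          (mul_nonneg (hpos _ _ _) (hpos _ _ _)) (by positivity)
    _ = _ := by ring

/-- The average of the product of the copies of `h` in which only the last two of the three
coordinates are doubled. -/
theorem expect_partial_eq (𝒯 : TSystem G) [Nonempty 𝒯.Pts] {i j k : Fin 4} (hij : i ≠ j)
    (hik : i ≠ k) (hjk : j ≠ k) (h : G → G → G → ℝ) :
    𝔼 x : Fin 4 × Bool → 𝒯.Pts, ∏ s ∈ ({j, k} : Finset (Fin 4)).powerset,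
      h (𝒯.diag (select x s) i) (𝒯.diag (select x s) j) (𝒯.diag (select x s) k) =
    iterExpect 5 (fun n => 𝒯.S (![i, j, j, k, k] n)) (fun v =>
      h (v 0) (v 1) (v 3) * h (v 0) (v 2) (v 3) * (h (v 0) (v 1) (v 4) * h (v 0) (v 2) (v 4))) := by
  have hp : Function.Injective
      ![(i, false), (j, false), (j, true), (k, false), (k, true)] := by
    intro a b h
    fin_cases a <;> fin_cases b <;> simp_all
  have key := 𝒯.expect_eq_iterExpect hp ![i, j, j, k, k] (fun v =>
      h (v 0) (v 1) (v 3) * h (v 0) (v 2) (v 3) * (h (v 0) (v 1) (v 4) * h (v 0) (v 2) (v 4)))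
  refine Eq.trans (Finset.expect_congr rfl fun x _ => ?_) key
  rw [Finset.prod_powerset_insert (by simpa using hjk)]
  simp only [prod_powerset_singleton]
  simp [select, diag, hij, hik, hjk, hjk.symm]
  ring

variable [Fintype G]

theorem mem_S_of_ofCoords_mem (𝒯 : TSystem G) {l : Fin 4} {a b c : G}
    (h : ofCoords l a b c ∈ 𝒯.Tface l) :
    a ∈ 𝒯.S (l.succAbove 0) ∧ b ∈ 𝒯.S (l.succAbove 1) ∧ c ∈ 𝒯.S (l.succAbove 2) := by
  have hc := coord_ofCoords l a b c
  have h0 := coord_mem_of_mem_Tface h (Fin.succAbove_ne l 0)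
  have h1 := coord_mem_of_mem_Tface h (Fin.succAbove_ne l 1)
  have h2 := coord_mem_of_mem_Tface h (Fin.succAbove_ne l 2)
  rw [hc.1] at h0
  rw [hc.2.1] at h1
  rw [hc.2.2] at h2
  exact ⟨h0, h1, h2⟩

/-- The box norm in the coordinates off `l`, of a function supported in `T_l`, in terms of averages
over the sets `S_j`. -/
theorem coordBoxNorm_eq (𝒯 : TSystem G) [Nonempty 𝒯.Pts] (l : Fin 4) {f : G × G × G → ℝ}
    (hf : ∀ x ∉ 𝒯.Tface l, f x = 0) :
    coordBoxNorm l f = ((∏ n : Fin 6, prob (𝒯.S (![l.succAbove 0, l.succAbove 0, l.succAbove 1,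
      l.succAbove 1, l.succAbove 2, l.succAbove 2] n)) Finset.univ) *
      boxE (faceSpan (Sum.inr l)) (fun z : Fin 4 → 𝒯.Pts => f (facePt l (𝒯.diag z))))
        ^ (1 / 8 : ℝ) := by
  obtain ⟨h01, h02, h12⟩ := succAbove_ne l
  have h1 := 𝒯.boxE_triple h01 h02 h12 (fun a b c => f (ofCoords l a b c))
  have h2 : boxE (faceSpan (Sum.inr l)) (fun z : Fin 4 → 𝒯.Pts => f (facePt l (𝒯.diag z))) =
      boxE {l.succAbove 0, l.succAbove 1, l.succAbove 2} (fun z : Fin 4 → 𝒯.Pts =>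
        f (ofCoords l (𝒯.diag z (l.succAbove 0)) (𝒯.diag z (l.succAbove 1))
          (𝒯.diag z (l.succAbove 2)))) := rfl
  rw [h2, h1, ← iterExpect_univ_of_support]
  · rfl
  · have hF : ∀ a b c, (a ∉ 𝒯.S (l.succAbove 0) ∨ b ∉ 𝒯.S (l.succAbove 1) ∨
        c ∉ 𝒯.S (l.succAbove 2)) → f (ofCoords l a b c) = 0 := by
      intro a b c h
      refine hf _ fun hmem => ?_
      have := 𝒯.mem_S_of_ofCoords_mem hmem
      tauto
    rintro v ⟨n, hn⟩
    simp only [cube3]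
    fin_cases n
    · rw [hF (v 0) (v 2) (v 4) (Or.inl hn)]; ring
    · rw [hF (v 1) (v 2) (v 4) (Or.inl hn)]; ring
    · rw [hF (v 0) (v 2) (v 4) (Or.inr (Or.inl hn))]; ring
    · rw [hF (v 0) (v 3) (v 4) (Or.inr (Or.inl hn))]; ring
    · rw [hF (v 0) (v 2) (v 4) (Or.inr (Or.inr hn))]; ring
    · rw [hF (v 0) (v 2) (v 5) (Or.inr (Or.inr hn))]; ring

theorem boxE_face_le (𝒯 : TSystem G) [Nonempty 𝒯.Pts] (l : Fin 4) {f h : G × G × G → ℝ}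
    (hf : ∀ x ∉ 𝒯.Tface l, f x = 0) (hh : ∀ x ∉ 𝒯.Tface l, h x = 0) (hh0 : ∀ x, 0 ≤ h x)
    (hT : 𝒯.T.Nonempty) (hh1 : ∀ x ∈ 𝒯.T, h x = 1) {r : ℝ} (hr : 0 ≤ r)
    (hle : coordBoxNorm l f / coordBoxNorm l h ≤ r) :
    boxE (faceSpan (Sum.inr l)) (fun z : Fin 4 → 𝒯.Pts => f (facePt l (𝒯.diag z))) ≤
      r ^ 8 * boxE (faceSpan (Sum.inr l)) (fun z : Fin 4 → 𝒯.Pts => h (facePt l (𝒯.diag z))) := by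
  obtain ⟨x, hx⟩ := hT
  set π : ℝ := ∏ n : Fin 6, prob (𝒯.S (![l.succAbove 0, l.succAbove 0, l.succAbove 1,
      l.succAbove 1, l.succAbove 2, l.succAbove 2] n)) Finset.univ with hπ
  have hπ0 : 0 < π := by
    refine Finset.prod_pos fun n _ => ?_
    rw [prob, Finset.inter_univ]
    have h1 : 0 < (𝒯.S (![l.succAbove 0, l.succAbove 0, l.succAbove 1,
      l.succAbove 1, l.succAbove 2, l.succAbove 2] n)).card := Finset.card_pos.2
        ⟨_, 𝒯.coord_mem hx _⟩
    have h2 : 0 < (Finset.univ : Finset G).card := Finset.card_pos.2 ⟨0, Finset.mem_univ _⟩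
    positivity
  set X := boxE (faceSpan (Sum.inr l)) (fun z : Fin 4 → 𝒯.Pts => f (facePt l (𝒯.diag z))) with hX
  set Y := boxE (faceSpan (Sum.inr l)) (fun z : Fin 4 → 𝒯.Pts => h (facePt l (𝒯.diag z))) with hY
  have hY0 : 0 < Y := by
    have hnn : ∀ y : Fin 4 × Bool → 𝒯.Pts, 0 ≤ ∏ s ∈ (faceSpan (Sum.inr l)).powerset,
        h (facePt l (𝒯.diag (select y s))) := fun y => Finset.prod_nonneg fun s _ => hh0 _
    refine lt_of_le_of_ne (Finset.expect_nonneg fun y _ => hnn y) fun h0 => ?_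
    obtain ⟨ω, hω⟩ := 𝒯.exists_diag_eq hx
    have h1 := (Finset.expect_eq_zero_iff_of_nonneg (s := Finset.univ)
      (fun y _ => hnn y)).1 h0.symm (fun _ => ω) (Finset.mem_univ _)
    have h2 : ∀ s : Finset (Fin 4), h (facePt l (𝒯.diag (select (fun _ : Fin 4 × Bool => ω) s)))
        = 1 := fun s => by
      have : select (fun _ : Fin 4 × Bool => ω) s = fun _ => ω := rfl
      rw [this, hω, hh1 x hx]
    simp only [h2, Finset.prod_const_one] at h1
    exact one_ne_zero h1
  rw [𝒯.coordBoxNorm_eq l hf, 𝒯.coordBoxNorm_eq l hh, ← hπ, ← hX, ← hY] at hle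
  rcases lt_or_ge X 0 with hX0 | hX0
  · exact hX0.le.trans (by positivity)
  clear_value π X Y
  rw [← Real.div_rpow (mul_nonneg hπ0.le hX0) (mul_nonneg hπ0.le hY0.le),
    mul_div_mul_left _ _ hπ0.ne'] at hle
  have := le_pow_of_rpow_le (n := 8) (by norm_num) (by norm_num) hr hle
  rwa [div_le_iff₀ hY0] at this

/-! ### Counting the points of `T` and the degenerate tetrahedra -/

/-- Counting the points of a subset of `T` by their coordinates off `l`. -/
theorem card_mul_expect_face (𝒯 : TSystem G) [Nonempty 𝒯.Pts] (l : Fin 4)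
    {A : Finset (G × G × G)} (hA : A ⊆ 𝒯.T) :
    ((𝒯.S (l.succAbove 0)).card * (𝒯.S (l.succAbove 1)).card * (𝒯.S (l.succAbove 2)).card : ℝ) *
      𝔼 z : Fin 4 → 𝒯.Pts, ind A (facePt l (𝒯.diag z)) = A.card := by
  obtain ⟨h01, h02, h12⟩ := succAbove_ne l
  have hp : Function.Injective ![l.succAbove 0, l.succAbove 1, l.succAbove 2] := by
    intro a b h
    fin_cases a <;> fin_cases b <;> simp_all
  set Φ : (Fin 3 → G) → ℝ := fun v => ind A (ofCoords l (v 0) (v 1) (v 2)) with hΦ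
  have h1 := 𝒯.expect_eq_iterExpect hp ![l.succAbove 0, l.succAbove 1, l.succAbove 2] Φ
  have h2 := iterExpect_univ_of_support
    (fun n => 𝒯.S (![l.succAbove 0, l.succAbove 1, l.succAbove 2] n)) Φ (by
      rintro v ⟨n, hn⟩
      refine if_neg fun hmem => ?_
      have := 𝒯.mem_S_of_ofCoords_mem (𝒯.T_subset_Tface l (hA hmem))
      fin_cases n
      exacts [hn this.1, hn this.2.1, hn this.2.2])
  have h3 : iterExpect 3 (fun _ => (Finset.univ : Finset G)) Φ =
      𝔼 a : G, 𝔼 b : G, 𝔼 c : G, ind A (ofCoords l a b c) := rfl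
  have h4 : 𝔼 a : G, 𝔼 b : G, 𝔼 c : G, ind A (ofCoords l a b c) = 𝔼 x : G × G × G, ind A x := by
    have e1 : ∀ a : G, 𝔼 b : G, 𝔼 c : G, ind A (ofCoords l a b c) =
        𝔼 q : G × G, ind A (ofCoords l a q.1 q.2) := fun a => by
      rw [← Finset.univ_product_univ, Finset.expect_product]
    simp only [e1]
    have e2 : 𝔼 a : G, 𝔼 q : G × G, ind A (ofCoords l a q.1 q.2) =
        𝔼 r : G × G × G, ind A (ofCoords l r.1 r.2.1 r.2.2) := by
      rw [← Finset.univ_product_univ (α := G) (β := G × G), Finset.expect_product]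
    rw [e2]
    refine Fintype.expect_equiv
      ⟨fun r => ofCoords l r.1 r.2.1 r.2.2,
        fun x => (coord (l.succAbove 0) x, coord (l.succAbove 1) x, coord (l.succAbove 2) x),
        fun r => ?_, fun x => ofCoords_coord l x⟩ _ _ fun r => rfl
    obtain ⟨q0, q1, q2⟩ := coord_ofCoords l r.1 r.2.1 r.2.2
    simp only [q0, q1, q2]
  have h5 : 𝔼 x : G × G × G, ind A x = A.card / (Fintype.card G : ℝ) ^ 3 := by
    rw [Fintype.expect_eq_sum_div_card]
    congr 1
    · simp [ind]
    · simp only [Fintype.card_prod]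
      push_cast
      ring
  have h6 : 𝔼 z : Fin 4 → 𝒯.Pts, ind A (facePt l (𝒯.diag z)) =
      iterExpect 3 (fun n => 𝒯.S (![l.succAbove 0, l.succAbove 1, l.succAbove 2] n)) Φ := h1
  rw [h3, h4, h5, Fin.prod_univ_three] at h2
  simp only [Matrix.cons_val_zero, Matrix.cons_val_one, Matrix.cons_val, prob, Finset.inter_univ,
    Finset.card_univ] at h2
  have hN : (Fintype.card G : ℝ) ≠ 0 := by exact_mod_cast Fintype.card_ne_zero
  rw [h6]
  field_simp at h2
  linarith

/-- If `A` contains no nontrivial corner, the tetrahedra with all their faces in `A` are degenerate,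
hence few. -/
theorem card_mul_expect_tetra_le (𝒯 : TSystem G) [Nonempty 𝒯.Pts] {A : Finset (G × G × G)}
    (hA : A ⊆ 𝒯.T) (hcorner : ¬ HasCorner A) :
    (∏ j, ((𝒯.S j).card : ℝ)) * 𝔼 z : Fin 4 → 𝒯.Pts, ∏ l, ind A (facePt l (𝒯.diag z)) ≤ A.card := by
  have hS : (𝒯.S 3).Nonempty := ⟨_, ((Classical.arbitrary 𝒯.Pts) 3).2⟩
  have hs3 : (0 : ℝ) < (𝒯.S 3).card := by exact_mod_cast hS.card_pos
  have hdeg : ∀ y : Fin 4 → G, ∏ l, ind A (facePt l y) ≤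
      ind A (y 0, y 1, y 2) * if y 3 = y 0 + y 1 + y 2 then 1 else 0 := by
    intro y
    by_cases hz : ∏ l, ind A (facePt l y) = 0
    · rw [hz]
      exact mul_nonneg (ind_nonneg _ _) (by split_ifs <;> norm_num)
    have hmem : ∀ l, facePt l y ∈ A := fun l =>
      ind_ne_zero.1 (Finset.prod_ne_zero_iff.1 hz l (Finset.mem_univ l))
    have m0 : (y 3 - y 1 - y 2, y 1, y 2) ∈ A := hmem 0
    have m1 : (y 0, y 3 - y 0 - y 2, y 2) ∈ A := hmem 1
    have m2 : (y 0, y 1, y 3 - y 0 - y 1) ∈ A := hmem 2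
    have m3 : (y 0, y 1, y 2) ∈ A := hmem 3
    have hy : y 3 = y 0 + y 1 + y 2 := by
      by_contra hne
      refine hcorner ⟨y 0, y 1, y 2, y 3 - (y 0 + y 1 + y 2), sub_ne_zero.2 hne, m3, ?_, ?_, ?_⟩
      · convert m0 using 2; abel
      · convert m1 using 3; abel
      · convert m2 using 3; abel
    rw [if_pos hy, ind_of_mem m3, mul_one]
    exact Finset.prod_le_one (fun l _ => ind_nonneg _ _) fun l _ => by
      rcases ind_zero_or_one A (facePt l y) with h | h <;> simp [h]
  have hbound : (𝒯.S 3).card * 𝔼 z : Fin 4 → 𝒯.Pts, ∏ l, ind A (facePt l (𝒯.diag z)) ≤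
      𝔼 z : Fin 4 → 𝒯.Pts, ind A (facePt 3 (𝒯.diag z)) := by
    have h4 := 𝒯.expect_eq_iterExpect (J := Fin 4) Function.injective_id id (fun v =>
      ind A (v 0, v 1, v 2) * if v 3 = v 0 + v 1 + v 2 then 1 else 0)
    have h3 := 𝒯.expect_eq_iterExpect (J := Fin 4) (p := ![0, 1, 2]) (by decide) ![0, 1, 2]
      (fun v => ind A (v 0, v 1, v 2))
    have e4 : 𝔼 z : Fin 4 → 𝒯.Pts, ∏ l, ind A (facePt l (𝒯.diag z)) ≤
        𝔼 a ∈ 𝒯.S 0, 𝔼 b ∈ 𝒯.S 1, 𝔼 c ∈ 𝒯.S 2, 𝔼 s ∈ 𝒯.S 3,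
          ind A (a, b, c) * if s = a + b + c then 1 else 0 :=
      (Finset.expect_le_expect fun z _ => hdeg (𝒯.diag z)).trans (le_of_eq h4)
    have e3 : 𝔼 z : Fin 4 → 𝒯.Pts, ind A (facePt 3 (𝒯.diag z)) =
        𝔼 a ∈ 𝒯.S 0, 𝔼 b ∈ 𝒯.S 1, 𝔼 c ∈ 𝒯.S 2, ind A (a, b, c) := h3
    refine (mul_le_mul_of_nonneg_left e4 hs3.le).trans ?_
    rw [e3, Finset.mul_expect]
    refine Finset.expect_le_expect fun a _ => ?_
    rw [Finset.mul_expect]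
    refine Finset.expect_le_expect fun b _ => ?_
    rw [Finset.mul_expect]
    refine Finset.expect_le_expect fun c _ => ?_
    rw [← Finset.mul_expect, Finset.expect_eq_sum_div_card, Finset.sum_ite_eq']
    have : (if a + b + c ∈ 𝒯.S 3 then (1 : ℝ) else 0) ≤ 1 := by split_ifs <;> norm_num
    calc ((𝒯.S 3).card : ℝ) *
          (ind A (a, b, c) * ((if a + b + c ∈ 𝒯.S 3 then (1 : ℝ) else 0) / (𝒯.S 3).card))
        = ind A (a, b, c) * (if a + b + c ∈ 𝒯.S 3 then (1 : ℝ) else 0) := by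
          field_simp
      _ ≤ ind A (a, b, c) * 1 := mul_le_mul_of_nonneg_left this (ind_nonneg _ _)
      _ = ind A (a, b, c) := mul_one _
  have hA3 := 𝒯.card_mul_expect_face 3 hA
  rw [← hA3, Fin.prod_univ_four]
  have e0 : (3 : Fin 4).succAbove 0 = 0 := rfl
  have e1 : (3 : Fin 4).succAbove 1 = 1 := rfl
  have e2 : (3 : Fin 4).succAbove 2 = 2 := rfl
  rw [e0, e1, e2, mul_assoc _ ((𝒯.S 3).card : ℝ)]
  exact mul_le_mul_of_nonneg_left hbound (by positivity)

/-! ### Lower bounds for the densities -/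

theorem prob_le_densT (𝒯 : TSystem G) (l : Fin 4) : prob 𝒯.T Finset.univ ≤ 𝒯.densT l := by
  rw [prob, densT, prob, Finset.inter_univ, Finset.inter_eq_left.2 (𝒯.T_subset_Tface l)]
  rcases 𝒯.T.eq_empty_or_nonempty with h | ⟨x, hx⟩
  · simp [h]
  have h1 : 0 < (𝒯.Tface l).card := Finset.card_pos.2 ⟨x, 𝒯.T_subset_Tface l hx⟩
  have h2 : (𝒯.Tface l).card ≤ (Finset.univ : Finset (G × G × G)).card :=
    Finset.card_le_card (Finset.subset_univ _)
  exact div_le_div_of_nonneg_left (by positivity) (by exact_mod_cast h1) (by exact_mod_cast h2)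

theorem prob_le_densR (𝒯 : TSystem G) {j k : Fin 4} (hjk : j < k) :
    prob 𝒯.T Finset.univ ≤ 𝒯.densR j k := by
  -- three of the four coordinates, among them the `j`-th and the `k`-th, determine a point
  have hidx : ∀ j k : Fin 4, j < k → ∃ l m : Fin 4, ∀ i : Fin 3,
      l.succAbove i = j ∨ l.succAbove i = k ∨ l.succAbove i = m := by decide
  obtain ⟨l, m, hlm⟩ := hidx j k hjk
  have hcard : 𝒯.T.card ≤ (𝒯.R j k ×ˢ (Finset.univ : Finset G)).card := by
    refine Finset.card_le_card_of_injOn (fun x => ((coord j x, coord k x), coord m x)) ?_ ?_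
    · intro x hx
      simpa using 𝒯.T_subset j k hjk x hx
    · intro x _ y _ hxy
      simp only [Prod.mk.injEq] at hxy
      have hi : ∀ i : Fin 3, coord (l.succAbove i) x = coord (l.succAbove i) y := by
        intro i
        rcases hlm i with h | h | h <;> rw [h]
        exacts [hxy.1.1, hxy.1.2, hxy.2]
      rw [← ofCoords_coord l x, ← ofCoords_coord l y, hi, hi, hi]
  rw [Finset.card_product, Finset.card_univ] at hcard
  rw [densR, prob, prob, Finset.inter_univ, Finset.inter_eq_left.2 (𝒯.R_subset j k hjk),
    Finset.card_univ]
  simp only [Fintype.card_prod, Finset.card_product]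
  rcases 𝒯.T.eq_empty_or_nonempty with h | ⟨x, hx⟩
  · simp only [h, Finset.card_empty, Nat.cast_zero, zero_div]
    positivity
  have hN : (0 : ℝ) < Fintype.card G := by exact_mod_cast Fintype.card_pos
  have hsj : 0 < (𝒯.S j).card := Finset.card_pos.2 ⟨_, 𝒯.coord_mem hx j⟩
  have hsk : 0 < (𝒯.S k).card := Finset.card_pos.2 ⟨_, 𝒯.coord_mem hx k⟩
  have hj : ((𝒯.S j).card : ℝ) ≤ Fintype.card G := by exact_mod_cast Finset.card_le_univ _
  have hk : ((𝒯.S k).card : ℝ) ≤ Fintype.card G := by exact_mod_cast Finset.card_le_univ _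
  have hc : (𝒯.T.card : ℝ) ≤ (𝒯.R j k).card * Fintype.card G := by exact_mod_cast hcard
  push_cast
  calc (𝒯.T.card : ℝ) / (Fintype.card G * (Fintype.card G * Fintype.card G))
      ≤ ((𝒯.R j k).card * Fintype.card G) / (Fintype.card G * (Fintype.card G * Fintype.card G)) :=
        div_le_div_of_nonneg_right hc (by positivity)
    _ = (𝒯.R j k).card / (Fintype.card G * Fintype.card G) := by field_simp
    _ ≤ (𝒯.R j k).card / ((𝒯.S j).card * (𝒯.S k).card) :=
        div_le_div_of_nonneg_left (by positivity) (by positivity)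
          (mul_le_mul hj hk (by positivity) hN.le)

end TSystem

/-! ### Numerical estimates -/

theorem mul_rpow_mul_rpow_le {C κ κ₀ x y : ℝ} {n : ℕ} (hC : n ≤ C) (hκ : κ ≤ κ₀) (hκ₀ : 0 ≤ κ₀)
    (hx0 : 0 < x) (hx1 : x ≤ 1) (hy0 : 0 < y) (hy1 : y ≤ 1) :
    κ * x ^ C * y ^ C ≤ κ₀ * (x * y) ^ n := by
  rw [mul_assoc, ← Real.mul_rpow hx0.le hy0.le, ← Real.rpow_natCast]
  have h1 : (x * y) ^ C ≤ (x * y) ^ (n : ℝ) :=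
    Real.rpow_le_rpow_of_exponent_ge (mul_pos hx0 hy0) (mul_le_one₀ hx1 hy0.le hy1) hC
  exact mul_le_mul hκ h1 (Real.rpow_nonneg (mul_pos hx0 hy0).le _) hκ₀

/-- The error terms in the replacement of a face of density `d`: with `τ = t ^ 8 / 2 ^ 13`, the
box norm error `(τ ^ 2 * (ε * d) ^ 2000) ^ 8` and the error in the graph counts are together small
compared with the eighth power of the density of `32` faces. -/
theorem face_error_le {t ε P d : ℝ} (ht0 : 0 < t) (ht1 : t ≤ 1) (hε0 : 0 < ε) (hε1 : ε ≤ 1)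
    (hP0 : 0 < P) (hPd : P ≤ d) (hd1 : d ≤ 1) :
    2 ^ 8 * (2 * ((t ^ 8 / 2 ^ 13) ^ 2 * (ε * d) ^ 2000) ^ 8
      + 2 * √(2 * (96 * (t ^ 8 / 2 ^ 13) ^ 2 * (ε * P) ^ 1904))) ≤ (t * ε ^ 64 * d ^ 32) ^ 8 := by
  set τ : ℝ := t ^ 8 / 2 ^ 13 with hτ
  have hd0 : 0 < d := hP0.trans_le hPd
  have hτ0 : 0 < τ := by positivity
  have hτ1 : τ ≤ 1 := by
    have : t ^ 8 ≤ 1 := pow_le_one₀ ht0.le ht1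
    rw [hτ, div_le_one (by norm_num)]
    linarith
  set q := ε * d with hq
  have hq0 : 0 < q := mul_pos hε0 hd0
  have hq1 : q ≤ 1 := mul_le_one₀ hε1 hd0.le hd1
  have h1 : (τ ^ 2 * q ^ 2000) ^ 8 ≤ τ * q ^ 512 := by
    rw [mul_pow, ← pow_mul, ← pow_mul]
    exact mul_le_mul (pow_le_of_le_one hτ0.le hτ1 (by norm_num))
      (pow_le_pow_of_le_one hq0.le hq1 (by norm_num)) (by positivity) hτ0.le
  have h2 : √(2 * (96 * τ ^ 2 * (ε * P) ^ 1904)) ≤ 14 * τ * q ^ 512 := by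
    rw [Real.sqrt_le_left (by positivity)]
    have h3 : (ε * P) ^ 1904 ≤ q ^ 1024 :=
      (pow_le_pow_left₀ (by positivity) (mul_le_mul_of_nonneg_left hPd hε0.le) _).trans
        (pow_le_pow_of_le_one hq0.le hq1 (by norm_num))
    have h4 : (14 * τ * q ^ 512) ^ 2 = 196 * τ ^ 2 * q ^ 1024 := by
      rw [mul_pow, mul_pow, ← pow_mul]; norm_num
    rw [h4]
    have h5 : 0 ≤ τ ^ 2 * q ^ 1024 := by positivity
    have h6 : τ ^ 2 * (ε * P) ^ 1904 ≤ τ ^ 2 * q ^ 1024 :=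
      mul_le_mul_of_nonneg_left h3 (by positivity)
    linarith
  have h7 : (t * ε ^ 64 * d ^ 32) ^ 8 = t ^ 8 * (ε ^ 512 * d ^ 256) := by
    rw [mul_pow, mul_pow, ← pow_mul, ← pow_mul, mul_assoc]
  have h8 : q ^ 512 ≤ ε ^ 512 * d ^ 256 := by
    rw [hq, mul_pow]
    exact mul_le_mul_of_nonneg_left (pow_le_pow_of_le_one hd0.le hd1 (by norm_num)) (by positivity)
  have h9 : t ^ 8 = 2 ^ 13 * τ := by rw [hτ]; field_simp
  rw [h7, h9]
  have h10 : τ * q ^ 512 ≤ τ * (ε ^ 512 * d ^ 256) := mul_le_mul_of_nonneg_left h8 hτ0.le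
  have h11 : 0 ≤ τ * q ^ 512 := by positivity
  linarith

/-- The error term in the replacement of `A` by a multiple of `T`. -/
theorem tetra_error_le {ε : ℝ} (hε0 : 0 < ε) :
    2 ^ 8 * (2 * ((1 / 2) ^ 10 * ε ^ 4) ^ 8 + 2 * √(2 * ((1 / 2) ^ 161 * ε ^ 64)))
      ≤ (ε ^ 4 / 64) ^ 8 := by
  have h1 : √(2 * ((1 / 2) ^ 161 * ε ^ 64)) = (1 / 2) ^ 80 * ε ^ 32 := by
    rw [show 2 * ((1 / 2 : ℝ) ^ 161 * ε ^ 64) = ((1 / 2) ^ 80 * ε ^ 32) ^ 2 by ring]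
    exact Real.sqrt_sq (by positivity)
  have h2 : 0 ≤ ε ^ 32 := by positivity
  have h3 : ((1 / 2) ^ 10 * ε ^ 4) ^ 8 = (1 / 2) ^ 80 * ε ^ 32 := by ring
  have h4 : (ε ^ 4 / 64) ^ 8 = ε ^ 32 / 2 ^ 48 := by ring
  rw [h1, h3, h4]
  norm_num
  linarith

/-- Three inequalities on the densities around a vertex, multiplied together. -/
theorem le_mul_of_three_le {y a b c u v w : ℝ} (hy : 0 ≤ y) (ha : 0 ≤ a) (hb : 0 ≤ b) (hc : 0 ≤ c)
    (hu : 0 ≤ u) (hv : 0 ≤ v) (hw : 0 ≤ w) (ha1 : a ≤ 1) (hb1 : b ≤ 1) (hc1 : c ≤ 1) (hu1 : u ≤ 1)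
    (hv1 : v ≤ 1) (hw1 : w ≤ 1) (h1 : 4 ≤ y * (u ^ 4 * b ^ 2 * c ^ 2))
    (h2 : 4 ≤ y * (v ^ 4 * a ^ 2 * c ^ 2)) (h3 : 4 ≤ y * (w ^ 4 * a ^ 2 * b ^ 2)) :
    4 ≤ y * (a * b * c * u * v * w) := by
  -- in the product of the three hypotheses every density occurs to the fourth power
  refine le_of_pow_le_pow_left₀ (n := 3) (by norm_num) (by positivity) ?_
  set m := a * b * c * u * v * w with hm
  have hm0 : 0 ≤ m := by positivity
  have hm1 : m ≤ 1 := by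
    have := mul_le_one₀ (mul_le_one₀ (mul_le_one₀ (mul_le_one₀ (mul_le_one₀ ha1 hb hb1) hc hc1)
      hu hu1) hv hv1) hw hw1
    exact this
  calc (4 : ℝ) ^ 3 = 4 * 4 * 4 := by norm_num
    _ ≤ (y * (u ^ 4 * b ^ 2 * c ^ 2)) * (y * (v ^ 4 * a ^ 2 * c ^ 2)) *
        (y * (w ^ 4 * a ^ 2 * b ^ 2)) :=
      mul_le_mul (mul_le_mul h1 h2 (by norm_num) (by positivity)) h3 (by norm_num) (by positivity)
    _ = y ^ 3 * m ^ 4 := by rw [hm]; ring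
    _ ≤ y ^ 3 * m ^ 3 :=
      mul_le_mul_of_nonneg_left (pow_le_pow_of_le_one hm0 hm1 (by norm_num)) (by positivity)
    _ = (y * m) ^ 3 := by ring

/-! ### Densities of the copies of a face -/

theorem LinearForms.mono {V Ω ι : Type*} [Fintype V] [DecidableEq V] [Fintype Ω] {I : Finset ι}
    {e : ι → Finset V} {ν : ι → (V → Ω) → ℝ} {err err' : ℝ} (h : LinearForms I e ν err)
    (hle : err ≤ err') : LinearForms I e ν err' := fun P h1 h2 => (h P h1 h2).trans hle

theorem prod_edge (f : Edge → ℝ) : ∏ p, f p = f ⟨(0, 1), by decide⟩ * f ⟨(0, 2), by decide⟩ *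
    f ⟨(0, 3), by decide⟩ * f ⟨(1, 2), by decide⟩ * f ⟨(1, 3), by decide⟩ *
    f ⟨(2, 3), by decide⟩ := by
  have h : (Finset.univ : Finset Edge) = {⟨(0, 1), by decide⟩, ⟨(0, 2), by decide⟩,
      ⟨(0, 3), by decide⟩, ⟨(1, 2), by decide⟩, ⟨(1, 3), by decide⟩, ⟨(2, 3), by decide⟩} := by
    decide
  rw [h, Finset.prod_insert (by decide), Finset.prod_insert (by decide),
    Finset.prod_insert (by decide), Finset.prod_insert (by decide), Finset.prod_insert (by decide),
    Finset.prod_singleton]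
  ring

namespace TSystem

variable [Fintype G]

theorem faceDens_weights (𝒯 : TSystem G) (hR : ∀ p : Edge, 0 < 𝒯.densR p.1.1 p.1.2)
    (hT : ∀ l, 0 < 𝒯.densT l) {l i j k : Fin 4} (hij : i < j) (hjk : j < k) (hi : i ≠ l)
    (hj : j ≠ l) (hk : k ≠ l) (C : Finset (Fin 4)) :
    (𝒯.weights hR hT).faceDens l C = 𝒯.densT l ^ 2 ^ (C ∩ {i, j, k}).card *
      (𝒯.densR i j ^ 2 ^ (C ∩ {i, j}).card * 𝒯.densR i k ^ 2 ^ (C ∩ {i, k}).card *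
        𝒯.densR j k ^ 2 ^ (C ∩ {j, k}).card) := by
  have hfilter : ∀ l i j k : Fin 4, ∀ (hij : i < j) (hjk : j < k), i ≠ l → j ≠ l → k ≠ l →
      faceSpan (Sum.inr l) = {i, j, k} ∧
      (Finset.univ.filter fun b : Edge ⊕ Fin 4 => faceSpan b ⊆ faceSpan (Sum.inr l)) =
        {Sum.inr l, Sum.inl ⟨(i, j), hij⟩, Sum.inl ⟨(i, k), hij.trans hjk⟩,
          Sum.inl ⟨(j, k), hjk⟩} := by
    decide
  obtain ⟨h1, h2⟩ := hfilter l i j k hij hjk hi hj hk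
  have e : (𝒯.weights hR hT).faceDens l C =
      ∏ b : Edge ⊕ Fin 4 with faceSpan b ⊆ faceSpan (Sum.inr l),
        (𝒯.weights hR hT).d b ^ 2 ^ (C ∩ faceSpan b).card := rfl
  rw [e, h2, Finset.prod_insert, Finset.prod_insert, Finset.prod_insert, Finset.prod_singleton, h1]
  · simp only [weights, Sum.elim_inl, Sum.elim_inr, faceSpan]
    ring
  · simp [hij.ne]
  · simp [hij.ne, hjk.ne]
  · simp

/-- The average of a face weight over a single simplex. -/
theorem expect_face_le (𝒯 : TSystem G) [Nonempty 𝒯.Pts] (hR : ∀ p : Edge, 0 < 𝒯.densR p.1.1 p.1.2)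
    (hT : ∀ l, 0 < 𝒯.densT l) {err : ℝ}
    (hlin : LinearForms Finset.univ (𝒯.weights hR hT).sp (𝒯.weights hR hT).nw err) :
    𝔼 z : Fin 4 → 𝒯.Pts, ind 𝒯.T (facePt 0 (𝒯.diag z)) ≤
      (1 + err) * (𝒯.densT 0 * (𝒯.densR 1 2 * 𝒯.densR 1 3 * 𝒯.densR 2 3)) := by
  have h1 := (𝒯.weights hR hT).abs_expect_face_sub_le hlin (l := 0) (Finset.empty_subset _)
  rw [𝒯.faceDens_weights hR hT (l := 0) (i := 1) (j := 2) (k := 3) (by decide) (by decide)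
    (by decide) (by decide) (by decide)] at h1
  simp only [Finset.empty_inter, Finset.card_empty, pow_zero, pow_one, Finset.powerset_empty,
    Finset.prod_singleton] at h1
  have h2 := expect_comp_injective (Ω := 𝒯.Pts) (f := fun v : Fin 4 => (v, false))
    (fun a b hab => (Prod.mk.inj hab).1) (fun z => ind 𝒯.T (facePt 0 (𝒯.diag z)))
  have h3 : 𝔼 x : Fin 4 × Bool → 𝒯.Pts, (𝒯.weights hR hT).w (Sum.inr 0) (select x ∅) =
      𝔼 x : Fin 4 × Bool → 𝒯.Pts,
        ind 𝒯.T (facePt 0 (𝒯.diag (x ∘ fun v : Fin 4 => (v, false)))) := rfl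
  rw [h3, h2] at h1
  linarith [(abs_le.1 h1).2]

/-- A lower bound for the number of points of `S_0`: a function which is bounded below on `T_l` and
has small box norm there forces the diagonal of the first variable to be negligible. -/
theorem diagonal_lower_bound (𝒯 : TSystem G) [Nonempty 𝒯.Pts]
    (hR : ∀ p : Edge, 0 < 𝒯.densR p.1.1 p.1.2) (hT : ∀ l, 0 < 𝒯.densT l) {err : ℝ}
    (herr : err ≤ 1 / 2)
    (hlin : LinearForms Finset.univ (𝒯.weights hR hT).sp (𝒯.weights hR hT).nw err) {l j k : Fin 4}
    (hj0 : 0 < j) (hjk : j < k) (hl0 : 0 ≠ l) (hjl : j ≠ l) (hkl : k ≠ l)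
    {f : G × G × G → ℝ} {ρ H : ℝ} (hρ : 0 ≤ ρ) (hH : 0 ≤ H) (hf : ∀ x, ρ * ind 𝒯.T x ≤ f x ^ 2)
    (hbox : boxE (faceSpan (Sum.inr l)) (fun z : Fin 4 → 𝒯.Pts => f (facePt l (𝒯.diag z))) ≤
      H * boxE (faceSpan (Sum.inr l))
        (fun z : Fin 4 → 𝒯.Pts => ind 𝒯.T (facePt l (𝒯.diag z)))) :
    ρ ^ 4 ≤ 3 * H * ((𝒯.S 0).card * (𝒯.densT l ^ 4 * 𝒯.densR 0 j ^ 2 * 𝒯.densR 0 k ^ 2)) := by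
  have hidx : ∀ l j k : Fin 4, 0 < j → j < k → 0 ≠ l → j ≠ l → k ≠ l →
      l.succAbove 0 = 0 ∧ l.succAbove 1 = j ∧ l.succAbove 2 = k := by decide
  obtain ⟨i0, i1, i2⟩ := hidx l j k hj0 hjk hl0 hjl hkl
  have hspan : faceSpan (Sum.inr l) = {0, j, k} := by
    change {l.succAbove 0, l.succAbove 1, l.succAbove 2} = _
    rw [i0, i1, i2]
  have hface : ∀ y : Fin 4 → G, facePt l y = ofCoords l (y 0) (y j) (y k) := fun y => by
    rw [facePt, i0, i1, i2]
  have h0j : (0 : Fin 4) ≠ j := hj0.ne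
  have h0k : (0 : Fin 4) ≠ k := (hj0.trans hjk).ne
  have hS : (𝒯.S 0).Nonempty := ⟨_, ((Classical.arbitrary 𝒯.Pts) 0).2⟩
  have hdiag := 𝒯.diagonal_le (i := 0) (j := j) (k := k) hS
    (F := fun a b c => f (ofCoords l a b c)) (h := fun a b c => ind 𝒯.T (ofCoords l a b c)) hρ
    (fun _ _ _ => ind_nonneg _ _) (fun _ _ _ => hf _)
  rw [← 𝒯.boxE_triple h0j h0k hjk.ne,
    ← 𝒯.expect_partial_eq h0j h0k hjk.ne (fun a b c => ind 𝒯.T (ofCoords l a b c))] at hdiag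
  simp only [hface, hspan] at hbox
  have hQ := (𝒯.weights hR hT).abs_expect_face_sub_le hlin (l := l) (C := {j, k}) (by
    change _ ⊆ faceSpan (Sum.inr l)
    rw [hspan]
    simp)
  have hO := (𝒯.weights hR hT).abs_expect_face_sub_le hlin (l := l) (C := {0, j, k}) (by
    change _ ⊆ faceSpan (Sum.inr l)
    rw [hspan])
  have hcard : ∀ j k : Fin 4, 0 < j → j < k →
      (({j, k} : Finset (Fin 4)) ∩ {0, j, k}).card = 2 ∧
      (({j, k} : Finset (Fin 4)) ∩ {0, j}).card = 1 ∧
      (({j, k} : Finset (Fin 4)) ∩ {0, k}).card = 1 ∧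
      (({j, k} : Finset (Fin 4)) ∩ {j, k}).card = 2 ∧
      (({0, j, k} : Finset (Fin 4)) ∩ {0, j, k}).card = 3 ∧
      (({0, j, k} : Finset (Fin 4)) ∩ {0, j}).card = 2 ∧
      (({0, j, k} : Finset (Fin 4)) ∩ {0, k}).card = 2 ∧
      (({0, j, k} : Finset (Fin 4)) ∩ {j, k}).card = 2 := by decide
  obtain ⟨c1, c2, c3, c4, c5, c6, c7, c8⟩ := hcard j k hj0 hjk
  rw [𝒯.faceDens_weights hR hT hj0 hjk hl0 hjl hkl, c1, c2, c3, c4] at hQ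
  rw [𝒯.faceDens_weights hR hT hj0 hjk hl0 hjl hkl, c5, c6, c7, c8] at hO
  have eQ : 𝔼 x : Fin 4 × Bool → 𝒯.Pts, ∏ s ∈ ({j, k} : Finset (Fin 4)).powerset,
      (𝒯.weights hR hT).w (Sum.inr l) (select x s) =
      𝔼 x : Fin 4 × Bool → 𝒯.Pts, ∏ s ∈ ({j, k} : Finset (Fin 4)).powerset,
      ind 𝒯.T (ofCoords l (𝒯.diag (select x s) 0) (𝒯.diag (select x s) j)
        (𝒯.diag (select x s) k)) := by
    simp only [← hface]
    rfl
  have eO : 𝔼 x : Fin 4 × Bool → 𝒯.Pts, ∏ s ∈ ({0, j, k} : Finset (Fin 4)).powerset,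
      (𝒯.weights hR hT).w (Sum.inr l) (select x s) =
      boxE {0, j, k} (fun z : Fin 4 → 𝒯.Pts =>
        ind 𝒯.T (ofCoords l (𝒯.diag z 0) (𝒯.diag z j) (𝒯.diag z k))) := by
    simp only [← hface]
    rfl
  rw [eQ] at hQ
  rw [eO] at hO
  have p1 : 0 < 𝒯.densT l := hT l
  have p2 : 0 < 𝒯.densR 0 j := hR ⟨(0, j), hj0⟩
  have p3 : 0 < 𝒯.densR 0 k := hR ⟨(0, k), hj0.trans hjk⟩
  have p4 : 0 < 𝒯.densR j k := hR ⟨(j, k), hjk⟩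
  -- the expected counts are `Q` on the diagonal and `Q * X` for the full octahedron: the diagonal
  -- inequality compares them, and `Q` cancels
  set Q := 𝒯.densT l ^ 2 ^ 2 * (𝒯.densR 0 j ^ 2 ^ 1 * 𝒯.densR 0 k ^ 2 ^ 1 *
    𝒯.densR j k ^ 2 ^ 2) with hQdef
  set X := 𝒯.densT l ^ 4 * 𝒯.densR 0 j ^ 2 * 𝒯.densR 0 k ^ 2 with hX
  have hQ0 : 0 < Q := by positivity
  have hX0 : 0 < X := by positivity
  have hO' : 𝒯.densT l ^ 2 ^ 3 * (𝒯.densR 0 j ^ 2 ^ 2 * 𝒯.densR 0 k ^ 2 ^ 2 *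
    𝒯.densR j k ^ 2 ^ 2) = Q * X := by rw [hQdef, hX]; ring
  rw [hO'] at hO
  have hs : (0 : ℝ) ≤ (𝒯.S 0).card := by positivity
  have hQ1 := (abs_le.1 hQ).1
  have hO1 := (abs_le.1 hO).2
  have b1 : err * Q ≤ 1 / 2 * Q := mul_le_mul_of_nonneg_right herr hQ0.le
  have b2 : err * (Q * X) ≤ 1 / 2 * (Q * X) :=
    mul_le_mul_of_nonneg_right herr (by positivity)
  have l1 : ρ ^ 4 * (1 / 2 * Q) ≤ ρ ^ 4 * 𝔼 x : Fin 4 × Bool → 𝒯.Pts,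
      ∏ s ∈ ({j, k} : Finset (Fin 4)).powerset, ind 𝒯.T (ofCoords l (𝒯.diag (select x s) 0)
        (𝒯.diag (select x s) j) (𝒯.diag (select x s) k)) :=
    mul_le_mul_of_nonneg_left (by linarith) (by positivity)
  have l2 : boxE {0, j, k} (fun z : Fin 4 → 𝒯.Pts =>
      f (ofCoords l (𝒯.diag z 0) (𝒯.diag z j) (𝒯.diag z k))) ≤ H * (3 / 2 * (Q * X)) :=
    hbox.trans (mul_le_mul_of_nonneg_left (by linarith) hH)
  have l3 : ρ ^ 4 * (1 / 2 * Q) ≤ (𝒯.S 0).card * (H * (3 / 2 * (Q * X))) :=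
    l1.trans (hdiag.trans (mul_le_mul_of_nonneg_left l2 hs))
  refine le_of_mul_le_mul_right ?_ hQ0
  linarith

end TSystem

/-! ### Counting corners -/

namespace TSystem

theorem nonempty_pts (𝒯 : TSystem G) (hne : 𝒯.T.Nonempty) : Nonempty 𝒯.Pts :=
  let ⟨_, hx⟩ := hne
  let ⟨ω, _⟩ := 𝒯.exists_diag_eq hx
  ⟨ω⟩

variable [Fintype G]

theorem prob_pos (𝒯 : TSystem G) (hne : 𝒯.T.Nonempty) : 0 < prob 𝒯.T Finset.univ := by
  rw [prob, Finset.inter_univ]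
  have : Nonempty (G × G × G) := ⟨hne.choose⟩
  have h1 : 0 < 𝒯.T.card := hne.card_pos
  have h2 : 0 < (Finset.univ : Finset (G × G × G)).card := Finset.card_pos.2 Finset.univ_nonempty
  positivity

/-- In an admissible system the weights of the `R_{j,k}` and of the faces satisfy the linear forms
condition. -/
theorem linearForms_weights (𝒯 : TSystem G) (hne : 𝒯.T.Nonempty) {C κ ε t : ℝ} (ht0 : 0 < t)
    (ht : t ≤ (1 / 2) ^ 170) (hε0 : 0 < ε) (hε1 : ε ≤ 1) (hC : 2000 ≤ C)
    (hκ : κ ≤ (t ^ 8 / 2 ^ 13) ^ 2) (hadm : 𝒯.Admissible C κ ε)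
    (hR : ∀ p : Edge, 0 < 𝒯.densR p.1.1 p.1.2) (hT : ∀ l, 0 < 𝒯.densT l) :
    LinearForms Finset.univ (𝒯.weights hR hT).sp (𝒯.weights hR hT).nw
      ((1 / 2) ^ 161 * ε ^ 64) := by
  have := 𝒯.nonempty_pts hne
  have ht1 : t ≤ 1 := ht.trans (pow_le_one₀ (by norm_num) (by norm_num))
  set P := prob 𝒯.T Finset.univ with hP
  have hP0 : 0 < P := 𝒯.prob_pos hne
  have hP1 : P ≤ 1 := prob_le_one _ _
  set τ : ℝ := t ^ 8 / 2 ^ 13 with hτ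
  have hτ0 : 0 < τ := by positivity
  have hτt : τ ≤ t := by
    have : t ^ 8 ≤ t := pow_le_of_le_one ht0.le ht1 (by norm_num)
    rw [hτ, div_le_iff₀ (by norm_num)]
    linarith
  have hτ2 : τ ^ 2 ≤ t := (pow_le_of_le_one hτ0.le (hτt.trans ht1) two_ne_zero).trans hτt
  have hC' : ((2000 : ℕ) : ℝ) ≤ C := by exact_mod_cast hC
  have hεP0 : 0 < ε * P := mul_pos hε0 hP0
  have hεP1 : ε * P ≤ 1 := mul_le_one₀ hε1 hP0.le hP1
  have hpow : (ε * P) ^ 1904 ≤ ε ^ 64 :=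
    (pow_le_pow_of_le_one hεP0.le hεP1 (by norm_num : 64 ≤ 1904)).trans
      (pow_le_pow_left₀ hεP0.le (mul_le_of_le_one_right hε0.le hP1) _)
  have hθ : 96 * τ ^ 2 * (ε * P) ^ 1904 ≤ 96 * t * ε ^ 64 :=
    mul_le_mul (mul_le_mul_of_nonneg_left hτ2 (by norm_num)) hpow (by positivity) (by positivity)
  have hε64 : ε ^ 64 ≤ 1 := pow_le_one₀ hε0.le hε1
  have hlin := WeightSystem.linearForms_self (𝒲 := 𝒯.weights hR hT)
    (b := τ ^ 2 * (ε * P) ^ 2000) (p := P) (by positivity)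
    (fun p => 𝒯.boxE_edge_le (F := fun x y => ind (𝒯.R p.1.1 p.1.2) (x, y) - 𝒯.densR p.1.1 p.1.2)
      p.2.ne (by positivity) ((hadm.box2 _ _ p.2).trans
        (mul_rpow_mul_rpow_le hC' hκ (by positivity) hε0 hε1 hP0 hP1)))
    hP0 (fun p => 𝒯.prob_le_densR p.2)
    (η := fun l => (τ ^ 2 * (ε * 𝒯.densT l) ^ 2000) ^ 8)
    (fun l => by have := hT l; positivity)
    (fun l => by
      have hd1 : 𝒯.densT l ≤ 1 := prob_le_one _ _
      have hd0 := hT l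
      have h1 := 𝒯.boxE_face_le l
        (f := fun x => ind 𝒯.T x - 𝒯.densT l * ind (𝒯.Tface l) x) (h := ind (𝒯.Tface l))
        (fun x hx => by
          have h2 : x ∉ 𝒯.T := fun h => hx (𝒯.T_subset_Tface l h)
          simp [ind, hx, h2])
        (fun x hx => if_neg hx) (ind_nonneg _) hne
        (fun x hx => ind_of_mem (𝒯.T_subset_Tface l hx))
        (r := τ ^ 2 * (ε * 𝒯.densT l) ^ 2000) (by positivity)
        ((hadm.box3 l).trans (mul_rpow_mul_rpow_le hC' hκ (by positivity) hε0 hε1 hd0 hd1))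
      have e1 : (𝒯.weights hR hT).edgeProd l =
          fun z => ind (𝒯.Tface l) (facePt l (𝒯.diag z)) :=
        funext (𝒯.edgeProd_weights hR hT l)
      have e2 : (𝒯.weights hR hT).dev l = fun z => ind 𝒯.T (facePt l (𝒯.diag z)) -
          𝒯.densT l * ind (𝒯.Tface l) (facePt l (𝒯.diag z)) := by
        funext z
        rw [← 𝒯.edgeProd_weights hR hT l z]
        rfl
      rw [e1, e2]
      exact h1)
    -- the `6` edges have `4` copies each, the `4` faces have `8`
    (nE := 24) (nF := 32) (by decide) (by decide)
    (θ := 96 * τ ^ 2 * (ε * P) ^ 1904) (ζ := t * ε ^ 64)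
    (by
      rw [div_le_iff₀ (by positivity)]
      have h1 : (ε * P) ^ 2000 = (ε * P) ^ 1904 * (ε * P) ^ 96 := by rw [← pow_add]
      have h2 : (ε * P) ^ 96 ≤ P ^ 96 :=
        pow_le_pow_left₀ hεP0.le (mul_le_of_le_one_left hP0.le hε1) _
      rw [h1]
      push_cast
      have h3 : 96 * τ ^ 2 * (ε * P) ^ 1904 * (ε * P) ^ 96 ≤
          96 * τ ^ 2 * (ε * P) ^ 1904 * P ^ 96 := mul_le_mul_of_nonneg_left h2 (by positivity)
      linarith)
    (by
      have h1 : 96 * t * ε ^ 64 ≤ 96 * t * 1 := mul_le_mul_of_nonneg_left hε64 (by positivity)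
      have h2 : (1 / 2 : ℝ) ^ 170 ≤ 1 / 96 := by norm_num
      linarith)
    (by positivity)
    (fun l => face_error_le ht0 ht1 hε0 hε1 hP0 (𝒯.prob_le_densT l) (prob_le_one _ _))
  refine hlin.mono ?_
  push_cast
  have h1 : t * ε ^ 64 ≤ (1 / 2) ^ 170 * ε ^ 64 :=
    mul_le_mul_of_nonneg_right ht (by positivity)
  have h2 : (0 : ℝ) ≤ ε ^ 64 := by positivity
  have h3 : (1 / 2 : ℝ) ^ 161 = 512 * (1 / 2) ^ 170 := by norm_num
  have h4 : (0 : ℝ) ≤ (1 / 2) ^ 170 * ε ^ 64 := by positivity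
  rw [h3]
  linarith

/-- The number of tetrahedra in `A` is at least almost what it would be if `A` were a random subset
of `T` of density `ε`, the `R_{j,k}` and `T` being random as well. -/
theorem expect_tetra_ge (𝒯 : TSystem G) (hne : 𝒯.T.Nonempty) {A : Finset (G × G × G)}
    (hA : A ⊆ 𝒯.T) {ε : ℝ} (hε0 : 0 < ε) (hε1 : ε ≤ 1)
    (hR : ∀ p : Edge, 0 < 𝒯.densR p.1.1 p.1.2) (hT : ∀ l, 0 < 𝒯.densT l)
    (hlin : LinearForms Finset.univ (𝒯.weights hR hT).sp (𝒯.weights hR hT).nw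
      ((1 / 2) ^ 161 * ε ^ 64))
    (hbox : ∀ l, boxE (faceSpan (Sum.inr l))
        (fun z : Fin 4 → 𝒯.Pts => ind A (facePt l (𝒯.diag z)) - ε * ind 𝒯.T (facePt l (𝒯.diag z))) ≤
      ((1 / 2) ^ 10 * ε ^ 4) ^ 8 * boxE (faceSpan (Sum.inr l))
        (fun z : Fin 4 → 𝒯.Pts => ind 𝒯.T (facePt l (𝒯.diag z)))) :
    9 / 10 * ε ^ 4 * ((∏ p : Edge, 𝒯.densR p.1.1 p.1.2) * ∏ l, 𝒯.densT l) ≤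
      𝔼 z : Fin 4 → 𝒯.Pts, ∏ l, ind A (facePt l (𝒯.diag z)) := by
  have := 𝒯.nonempty_pts hne
  have hε64 : ε ^ 64 ≤ ε ^ 4 := pow_le_pow_of_le_one hε0.le hε1 (by norm_num)
  have hε4 : ε ^ 4 ≤ 1 := pow_le_one₀ hε0.le hε1
  have hε40 : 0 < ε ^ 4 := by positivity
  have h161 : (1 / 2 : ℝ) ^ 161 ≤ 1 / 32 := by norm_num
  have herr : (1 / 2 : ℝ) ^ 161 * ε ^ 64 ≤ 1 / 32 * ε ^ 4 :=
    mul_le_mul h161 hε64 (by positivity) (by norm_num)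
  have key := WeightSystem.abs_expect_simplex_sub_le (𝒲 := 𝒯.weights hR hT)
    (err := (1 / 2) ^ 161 * ε ^ 64) (by positivity) (by linarith) hlin
    (α := fun l z => ind A (facePt l (𝒯.diag z)))
    (fun l z z' h => by
      refine congrArg (ind A) (facePt_congr fun j hj => ?_)
      simp only [diag]
      rw [h j (mem_faceSpan_inr.2 hj)])
    (fun l z => ind_nonneg _ _)
    (fun l z => by
      change ind A (facePt l (𝒯.diag z)) ≤ ind 𝒯.T (facePt l (𝒯.diag z))
      by_cases h : facePt l (𝒯.diag z) ∈ A
      · rw [ind_of_mem h, ind_of_mem (hA h)]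
      · rw [show ind A (facePt l (𝒯.diag z)) = 0 from if_neg h]
        exact ind_nonneg _ _)
    hε0.le hε1 (by positivity) hbox (θ := ε ^ 4 / 64) (by positivity) (tetra_error_le hε0)
  set D := (∏ p : Edge, 𝒯.densR p.1.1 p.1.2) * ∏ l, 𝒯.densT l with hD
  have hD0 : 0 < D := mul_pos (Finset.prod_pos fun p _ => hR p) (Finset.prod_pos fun l _ => hT l)
  -- the weights of the edges are equal to `1` wherever all the faces lie in `A`
  have e1 : 𝔼 z : Fin 4 → 𝒯.Pts, (∏ a, (𝒯.weights hR hT).nw (Sum.inl a) z) *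
      ∏ l, (ind A (facePt l (𝒯.diag z)) / (𝒯.weights hR hT).d (Sum.inr l)) =
      (𝔼 z : Fin 4 → 𝒯.Pts, ∏ l, ind A (facePt l (𝒯.diag z))) / D := by
    rw [Finset.expect_div]
    refine Finset.expect_congr rfl fun z _ => ?_
    have e2 : ∏ a, (𝒯.weights hR hT).nw (Sum.inl a) z =
        (∏ p : Edge, ind (𝒯.R p.1.1 p.1.2) (𝒯.diag z p.1.1, 𝒯.diag z p.1.2)) /
          ∏ p : Edge, 𝒯.densR p.1.1 p.1.2 := by
      rw [← Finset.prod_div_distrib]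
      rfl
    have e3 : ∏ l, (ind A (facePt l (𝒯.diag z)) / (𝒯.weights hR hT).d (Sum.inr l)) =
        (∏ l, ind A (facePt l (𝒯.diag z))) / ∏ l, 𝒯.densT l := by
      rw [← Finset.prod_div_distrib]
      rfl
    rw [e2, e3, div_mul_div_comm, hD]
    congr 1
    by_cases hz : ∏ l, ind A (facePt l (𝒯.diag z)) = 0
    · rw [hz, mul_zero]
    have hmem : ∀ l, facePt l (𝒯.diag z) ∈ 𝒯.T := fun l =>
      hA (ind_ne_zero.1 (Finset.prod_ne_zero_iff.1 hz l (Finset.mem_univ l)))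
    rw [Finset.prod_eq_one, one_mul]
    rintro p -
    have hidx : ∀ p : Edge, ∃ l, p.1.1 ≠ l ∧ p.1.2 ≠ l := by decide
    obtain ⟨l, h1, h2⟩ := hidx p
    have h3 := 𝒯.T_subset _ _ p.2 _ (hmem l)
    rw [coord_facePt h1, coord_facePt h2] at h3
    exact ind_of_mem h3
  rw [e1, Fintype.card_fin] at key
  have h1 := (abs_le.1 key).1
  push_cast at h1
  rw [← le_div_iff₀ hD0]
  linarith

end TSystem

theorem CornerSystem.card_mul_densA (𝒜 : CornerSystem G) (hne : 𝒜.T.Nonempty) :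
    (𝒜.A.card : ℝ) = 𝒜.densA * 𝒜.T.card := by
  have : (𝒜.T.card : ℝ) ≠ 0 := by exact_mod_cast hne.card_pos.ne'
  rw [CornerSystem.densA, prob, Finset.inter_eq_left.2 𝒜.A_subset]
  field_simp

/-- The difference between `A` and its average over `T` is bounded below on `T`. -/
theorem CornerSystem.sq_le_sq_sub (𝒜 : CornerSystem G) {ε : ℝ} (hε : ε ≤ 3 / 4)
    (x : G × G × G) : (ε / 3) ^ 2 * ind 𝒜.T x ≤ (ind 𝒜.A x - ε * ind 𝒜.T x) ^ 2 := by
  by_cases hT : x ∈ 𝒜.T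
  · rw [ind_of_mem hT]
    rcases ind_zero_or_one 𝒜.A x with h | h <;> rw [h] <;> nlinarith [sq_nonneg ε]
  · have h0 : ind 𝒜.T x = 0 := if_neg hT
    rw [h0, mul_zero]
    positivity

theorem prod_edge_filter (f : Fin 4 → Fin 4 → ℝ) :
    ∏ p : Fin 4 × Fin 4 with p.1 < p.2, f p.1 p.2 = ∏ p : Edge, f p.1.1 p.1.2 :=
  Finset.prod_subtype _ (by simp) fun p : Fin 4 × Fin 4 => f p.1 p.2

variable [Fintype G]

/-- The von Neumann lemma in an arbitrary finite abelian group. -/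
theorem hasCorner_of_admissible (𝒜 : CornerSystem G) {C κ t : ℝ} (ht0 : 0 < t)
    (ht : t ≤ (1 / 2) ^ 170) (hC : 2000 ≤ C) (hκ : κ ≤ (t ^ 8 / 2 ^ 13) ^ 2)
    (hadm : 𝒜.toTSystem.Admissible C κ 𝒜.densA)
    (hbig : 4 * (𝒜.A.card : ℝ) < 𝒜.densA * (∏ j, 𝒜.densS j) * (∏ p : Edge, 𝒜.densR p.1.1 p.1.2) *
      (∏ l, 𝒜.densT l) * (Fintype.card G : ℝ) ^ 4)
    (hbox : ∀ l, coordBoxNorm l (fun x => ind 𝒜.A x - 𝒜.densA * ind 𝒜.T x) /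
      coordBoxNorm l (ind 𝒜.T) ≤ (1 / 2) ^ 10 * 𝒜.densA ^ 4) : HasCorner 𝒜.A := by
  by_contra hcorner
  set ε := 𝒜.densA with hε
  have hpos : 0 < ε * (∏ j, 𝒜.densS j) * (∏ p : Edge, 𝒜.densR p.1.1 p.1.2) *
      (∏ l, 𝒜.densT l) * (Fintype.card G : ℝ) ^ 4 := lt_of_le_of_lt (by positivity) hbig
  have hε0 : 0 < ε := (prob_nonneg _ _).lt_of_ne' fun h => by
    rw [show ε = 0 from h] at hpos
    simp at hpos
  have hε1 : ε ≤ 1 := prob_le_one _ _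
  have hR : ∀ p : Edge, 0 < 𝒜.densR p.1.1 p.1.2 := fun p =>
    (prob_nonneg _ _).lt_of_ne' fun h => by
      have : ∏ p : Edge, 𝒜.densR p.1.1 p.1.2 = 0 := Finset.prod_eq_zero (Finset.mem_univ p) h
      simp [this] at hpos
  have hT : ∀ l, 0 < 𝒜.densT l := fun l =>
    (prob_nonneg _ _).lt_of_ne' fun h => by
      have : ∏ l, 𝒜.densT l = 0 := Finset.prod_eq_zero (Finset.mem_univ l) h
      simp [this] at hpos
  have hne : 𝒜.T.Nonempty := by
    by_contra h
    rw [Finset.not_nonempty_iff_eq_empty] at h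
    have : ε = 0 := by simp [hε, CornerSystem.densA, prob, h]
    exact hε0.ne' this
  have hpts := 𝒜.nonempty_pts hne
  have hAcard := 𝒜.card_mul_densA hne
  have hlin := 𝒜.linearForms_weights hne ht0 ht hε0 hε1 hC hκ hadm hR hT
  have hbox' : ∀ l, boxE (faceSpan (Sum.inr l)) (fun z : Fin 4 → 𝒜.Pts =>
        ind 𝒜.A (facePt l (𝒜.diag z)) - ε * ind 𝒜.T (facePt l (𝒜.diag z))) ≤
      ((1 / 2) ^ 10 * ε ^ 4) ^ 8 * boxE (faceSpan (Sum.inr l))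
        (fun z : Fin 4 → 𝒜.Pts => ind 𝒜.T (facePt l (𝒜.diag z))) := fun l =>
    𝒜.boxE_face_le l (f := fun x => ind 𝒜.A x - ε * ind 𝒜.T x) (h := ind 𝒜.T)
      (fun x hx => by
        have h2 : x ∉ 𝒜.T := fun h => hx (𝒜.T_subset_Tface l h)
        have h3 : x ∉ 𝒜.A := fun h => h2 (𝒜.A_subset h)
        simp [ind, h2, h3])
      (fun x hx => if_neg fun h => hx (𝒜.T_subset_Tface l h)) (ind_nonneg _) hne
      (fun x hx => ind_of_mem hx) (by positivity) (hbox l)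
  have hcount := 𝒜.expect_tetra_ge hne 𝒜.A_subset hε0 hε1 hR hT hlin hbox'
  have hdeg := 𝒜.card_mul_expect_tetra_le 𝒜.A_subset hcorner
  have hs : ∀ j, (0 : ℝ) < (𝒜.S j).card := fun j => by
    have : (𝒜.S j).Nonempty := ⟨_, ((Classical.arbitrary 𝒜.Pts) j).2⟩
    exact_mod_cast this.card_pos
  set D := (∏ p : Edge, 𝒜.densR p.1.1 p.1.2) * ∏ l, 𝒜.densT l with hD
  have hs' : (0 : ℝ) < ∏ j, ((𝒜.S j).card : ℝ) := Finset.prod_pos fun j _ => hs j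
  -- the tetrahedra in `A` are degenerate, so that `|T|` is large
  have hTcard : 9 / 10 * ε ^ 3 * ((∏ j, ((𝒜.S j).card : ℝ)) * D) ≤ 𝒜.T.card := by
    have h1 := (mul_le_mul_of_nonneg_left hcount hs'.le).trans hdeg
    rw [hAcard] at h1
    refine le_of_mul_le_mul_left ?_ hε0
    linarith
  -- for `ε` close to `1` the hypothesis on `|A|` is at odds with this; otherwise `A` is far from
  -- being constant on `T`, and the smallness of the box norms of `A - ε T` makes `|T|` small
  rcases lt_or_ge (3 / 4) ε with hbig_ε | hsmall_ε
  · have hN : (Fintype.card G : ℝ) ≠ 0 := by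
      intro h
      simp [h] at hpos
    have e1 : (∏ j, 𝒜.densS j) * (Fintype.card G : ℝ) ^ 4 = ∏ j, ((𝒜.S j).card : ℝ) := by
      have : ∀ j, ((𝒜.S j).card : ℝ) = 𝒜.densS j * Fintype.card G := fun j => by
        rw [TSystem.densS, prob, Finset.inter_univ, Finset.card_univ]
        field_simp
      rw [Finset.prod_congr rfl fun j _ => this j, Finset.prod_mul_distrib]
      simp
    have h1 : 4 * (𝒜.T.card : ℝ) < (∏ j, ((𝒜.S j).card : ℝ)) * D := by
      rw [hAcard] at hbig
      refine lt_of_mul_lt_mul_left ?_ hε0.le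
      rw [← e1, hD]
      linarith
    have h2 : (27 : ℝ) / 64 ≤ ε ^ 3 := by
      have := pow_le_pow_left₀ (by norm_num : (0 : ℝ) ≤ 3 / 4) hbig_ε.le 3
      norm_num at this
      linarith
    have h3 : 27 / 64 * ((∏ j, ((𝒜.S j).card : ℝ)) * D) ≤
        ε ^ 3 * ((∏ j, ((𝒜.S j).card : ℝ)) * D) :=
      mul_le_mul_of_nonneg_right h2
        ((by positivity : (0 : ℝ) ≤ 4 * 𝒜.T.card).trans h1.le)
    have h4 : (0 : ℝ) ≤ 𝒜.T.card := by positivity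
    linarith
  · have hε64 : ε ^ 64 ≤ 1 := pow_le_one₀ hε0.le hε1
    have h161 : (1 / 2 : ℝ) ^ 161 ≤ 1 / 2 := by norm_num
    have herr : (1 / 2 : ℝ) ^ 161 * ε ^ 64 ≤ 1 / 2 :=
      (mul_le_of_le_one_right (by positivity) hε64).trans h161
    have hface := 𝒜.expect_face_le hR hT (hlin.mono herr)
    have hTface := 𝒜.card_mul_expect_face 0 (Finset.Subset.refl 𝒜.T)
    have hdiag : ∀ {l j k : Fin 4}, 0 < j → j < k → 0 ≠ l → j ≠ l → k ≠ l →
        4 ≤ ε ^ 3 * (𝒜.S 0).card * (𝒜.densT l ^ 4 * 𝒜.densR 0 j ^ 2 * 𝒜.densR 0 k ^ 2) := by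
      intro l j k hj0 hjk hl0 hjl hkl
      have h1 := 𝒜.diagonal_lower_bound hR hT herr hlin hj0 hjk hl0 hjl hkl
        (f := fun x => ind 𝒜.A x - ε * ind 𝒜.T x) (ρ := (ε / 3) ^ 2) (by positivity) (by positivity)
        (𝒜.sq_le_sq_sub hsmall_ε) (hbox' l)
      set X := 𝒜.densT l ^ 4 * 𝒜.densR 0 j ^ 2 * 𝒜.densR 0 k ^ 2 with hX
      have hX0 : 0 ≤ X := by positivity
      have h2 : ε ^ 24 ≤ ε ^ 3 := pow_le_pow_of_le_one hε0.le hε1 (by norm_num)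
      have h3 : ε ^ 24 * ((𝒜.S 0).card * X) ≤ ε ^ 3 * ((𝒜.S 0).card * X) :=
        mul_le_mul_of_nonneg_right h2 (by positivity)
      have h4 : (1 : ℝ) ≤ 3 * 6561 * (1 / 2) ^ 80 * (ε ^ 24 * ((𝒜.S 0).card * X)) := by
        refine le_of_mul_le_mul_left (a := ε ^ 8) ?_ (by positivity)
        have e1 : ((ε / 3) ^ 2) ^ 4 = ε ^ 8 / 6561 := by ring
        have e2 : ((1 / 2) ^ 10 * ε ^ 4) ^ 8 = (1 / 2) ^ 80 * (ε ^ 8 * ε ^ 24) := by ring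
        rw [e1, e2] at h1
        rw [div_le_iff₀ (by norm_num)] at h1
        linarith
      have h5 : (3 : ℝ) * 6561 * (1 / 2) ^ 80 ≤ 1 / 4 := by norm_num
      have h6 : 3 * 6561 * (1 / 2) ^ 80 * (ε ^ 24 * ((𝒜.S 0).card * X)) ≤
          1 / 4 * (ε ^ 24 * ((𝒜.S 0).card * X)) :=
        mul_le_mul_of_nonneg_right h5 (by positivity)
      linarith
    have hprod := le_mul_of_three_le (y := ε ^ 3 * (𝒜.S 0).card) (a := 𝒜.densR 0 1)
      (b := 𝒜.densR 0 2) (c := 𝒜.densR 0 3) (u := 𝒜.densT 1) (v := 𝒜.densT 2) (w := 𝒜.densT 3)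
      (by positivity) (prob_nonneg _ _) (prob_nonneg _ _) (prob_nonneg _ _) (prob_nonneg _ _)
      (prob_nonneg _ _) (prob_nonneg _ _) (prob_le_one _ _) (prob_le_one _ _) (prob_le_one _ _)
      (prob_le_one _ _) (prob_le_one _ _) (prob_le_one _ _)
      (hdiag (by decide) (by decide) (by decide) (by decide) (by decide))
      (hdiag (by decide) (by decide) (by decide) (by decide) (by decide))
      (hdiag (by decide) (by decide) (by decide) (by decide) (by decide))
    have i0 : (0 : Fin 4).succAbove 0 = 1 := rfl
    have i1 : (0 : Fin 4).succAbove 1 = 2 := rfl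
    have i2 : (0 : Fin 4).succAbove 2 = 3 := rfl
    rw [i0, i1, i2] at hTface
    set Z := ((𝒜.S 1).card * (𝒜.S 2).card * (𝒜.S 3).card : ℝ) *
      (𝒜.densT 0 * (𝒜.densR 1 2 * 𝒜.densR 1 3 * 𝒜.densR 2 3)) with hZ
    have hZ0 : 0 < Z := by
      have h1 := hs 1
      have h2 := hs 2
      have h3 := hs 3
      have h4 := hT 0
      have h5 : 0 < 𝒜.densR 1 2 := hR ⟨(1, 2), by decide⟩
      have h6 : 0 < 𝒜.densR 1 3 := hR ⟨(1, 3), by decide⟩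
      have h7 : 0 < 𝒜.densR 2 3 := hR ⟨(2, 3), by decide⟩
      positivity
    have hTle : (𝒜.T.card : ℝ) ≤ 3 / 2 * Z := by
      have h1 := mul_le_mul_of_nonneg_left hface (by
        have h1 := hs 1
        have h2 := hs 2
        have h3 := hs 3
        positivity : (0 : ℝ) ≤ (𝒜.S 1).card * (𝒜.S 2).card * (𝒜.S 3).card)
      rw [hTface] at h1
      linarith
    have hDZ : 9 / 10 * ε ^ 3 * ((∏ j, ((𝒜.S j).card : ℝ)) * D) = 9 / 10 *
        (ε ^ 3 * (𝒜.S 0).card * (𝒜.densR 0 1 * 𝒜.densR 0 2 * 𝒜.densR 0 3 * 𝒜.densT 1 *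
          𝒜.densT 2 * 𝒜.densT 3)) * Z := by
      rw [hD, hZ, prod_edge, Fin.prod_univ_four, Fin.prod_univ_four]
      ring
    rw [hDZ] at hTcard
    have hfin := mul_le_mul_of_nonneg_right hprod hZ0.le
    linarith

end Corners

theorem mainTheorem2 :
    ∃ C₀ κ₀ κ : ℝ, 64 ≤ C₀ ∧ 0 < κ₀ ∧ κ₀ < 1 ∧ 0 < κ ∧
      ∀ Cadm κadm : ℝ, C₀ ≤ Cadm → 0 < κadm → κadm ≤ κ₀ →
      ∀ (n : ℕ) (H : Submodule (ZMod 5) (Fin n → ZMod 5)) [Fintype H]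
        (𝒜 : Corners.CornerSystem H),
        𝒜.toTSystem.Admissible Cadm κadm 𝒜.densA →
        𝒜.densA * (∏ j, 𝒜.densS j)
            * (∏ p : Fin 4 × Fin 4 with p.1 < p.2, 𝒜.densR p.1 p.2)
            * (∏ l, 𝒜.densT l) * (Fintype.card H : ℝ) ^ 4 > 4 * (𝒜.A.card : ℝ) →
        (∀ l : Fin 4,
          Corners.coordBoxNorm l
              (fun x => Corners.ind 𝒜.A x - 𝒜.densA * Corners.ind 𝒜.T x)
            / Corners.coordBoxNorm l (Corners.ind 𝒜.T) ≤ κ * 𝒜.densA ^ 4) →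
        Corners.HasCorner 𝒜.A := by
  -- The numerical requirements are those of `face_error_le` and `linearForms_weights`. The value of
  -- `t` is kept abstract, so that its powers are never evaluated.
  obtain ⟨t, ht⟩ : ∃ t : ℝ, t = (1 / 2) ^ 170 := ⟨_, rfl⟩
  have ht0 : 0 < t := by rw [ht]; positivity
  have ht1 : t ≤ 1 := by rw [ht]; exact pow_le_one₀ (by norm_num) (by norm_num)
  refine ⟨2000, (t ^ 8 / 2 ^ 13) ^ 2, (1 / 2) ^ 10, by norm_num, by positivity, ?_,
    by positivity, ?_⟩
  · have h1 : t ^ 8 ≤ 1 := pow_le_one₀ ht0.le ht1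
    refine pow_lt_one₀ (by positivity) ?_ two_ne_zero
    rw [div_lt_one (by norm_num)]
    exact h1.trans_lt (by norm_num)
  · intro C κ hC _ hκ n H _ 𝒜 hadm hbig hbox
    refine Corners.hasCorner_of_admissible 𝒜 ht0 ht.le hC hκ hadm ?_ hbox
    rw [← Corners.prod_edge_filter]
    exact hbig
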